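/- Let $G$ be a (finite-dimensional, real, smooth, Hausdorff) Lie group with identity $e$ and Lie algebra $\mathfrak g$, let $\mathbb I$ be an inner product on $\mathfrak g$ (the kinetic energy tensor) with associated isomorphisms $\mathbb I^\flat:\mathfrak g\to\mathfrak g^*$ and $\mathbb I^\sharp=(\mathbb I^\flat)^{-1}$, and let $\mathscr L_g$ denote left translation by $g$. Consider $n$ identical simple mechanical control systems with states $(\gamma_i,v_i)\in G\times\mathfrak g$, $$\gamma_i'=\mathrm T_e\mathscr L_{\gamma_i}(v_i),\qquad v_i'-\mathbb I^\sharp\big(\operatorname{ad}^*_{v_i}\mathbb I^\flat(v_i)\big)=\mathbb I^\sharp(u_i),\qquad i=1,\dots,n,$$ where $\langle\operatorname{ad}^*_\xi\mu,\eta\rangle=\langle\mu,[\xi,\eta]\rangle$. The agents communicate over an undirected connected tree on $\{1,\dots,n\}$ with adjacency matrix $(a_{ij})$. Let $\Psi_G:G\to\mathbb R_{\ge 0}$ be smooth and proper, with $\Psi_G(e)=0$, $\mathrm d\Psi_G(e)=0$, $\operatorname{Hess}\Psi_G(e)$ positive-definite, and such that $\Psi_{G,r}(g_1,g_2)=\Psi_G(g_2^{-1}g_1)$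 is symmetric in $(g_1,g_2)$. Let $R_{\mathrm{diss}}$ be a bilinear form on $\mathfrak g$ with $R_{\mathrm{diss}}(v,v)>0$ for $v\ne0$, write $R^\flat_{\mathrm{diss}}(v)=R_{\mathrm{diss}}(v,\cdot)$, and let $K_p,\alpha_1,\dots,\alpha_n>0$. Apply the control inputs $$u_i=-\operatorname{ad}^*_{v_i}\mathbb I^\flat(v_i)-\frac1{\alpha_i}\Big(R^\flat_{\mathrm{diss}}(v_i)+K_p\sum_{j=1}^n a_{ij}\,(\mathrm T_e\mathscr L_{\gamma_i})^*\big(\mathrm d_i\Psi_{G,r}(\gamma_i,\gamma_j)\big)\Big),$$ where $\mathrm d_i$ is the differential with respect to the first argument $\gamma_i$. Let $$\tau_L=\sup\big\{L\in\mathbb R : e\in\Psi_G^{-1}(\le L)\ \text{and}\ \mathrm d\Psi_G(g)\neq0\ \text{for all } g\in\Psi_G^{-1}(\le L)\setminus\{e\}\big\}\in[-\infty,+\infty],$$ $$\mathcal E^*=\{(g,v)\in G^n\times\mathfrak g^n : g_1=\dots=g_n,\ v_1=\dots=v_n=0\},$$ $$\mathcal S^1=\Big\{(g,v)\in G^n\times\mathfrak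 g^n : \tfrac{K_p}2\sum_{i,j=1}^n a_{ij}\Psi_{G,r}(g_i,g_j)+\tfrac12\sum_{i=1}^n\alpha_i\,\mathbb I(v_i,v_i)\le\tfrac{K_p}2\tau_L\Big\}.$$ Then for the closed-loop system: a trajectory defined on $[0,\infty)$ exists for every initial state; every point of $\mathcal E^*$ is an equilibrium; the consensus set $\mathcal E^*$ is locally asymptotically stable, i.e. for every neighbourhood $U$ of $\mathcal E^*$ there is a neighbourhood $W$ of $\mathcal E^*$ such that trajectories starting in $W$ remain in $U$ for all $t\ge0$, and all trajectories starting in some neighbourhood of $\mathcal E^*$ converge to $\mathcal E^*$; and every trajectory with initial condition in $\mathcal S^1$ converges to $\mathcal E^*$. Here convergence to $\mathcal E^*$ means being eventually in every neighbourhood of $\mathcal E^*$ (in particular $\gamma_j(t)^{-1}\gamma_i(t)\to e$ and $v_i(t)\to0$ for all $i,j$). -/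

import Mathlib

open Filter Topology Set
open scoped Manifold ContDiff

noncomputable section

/-! ### Set stability for a family of forward trajectories -/

/-- Lyapunov stability of a set `A`: every neighbourhood of `A` contains all forward trajectories
that start in some smaller neighbourhood of `A`. -/
def SetStable {X : Type*} [TopologicalSpace X] (traj : (ℝ → X) → Prop) (A : Set X) : Prop :=
  ∀ U ∈ 𝓝ˢ A, ∃ W ∈ 𝓝ˢ A, ∀ ξ : ℝ → X, traj ξ → ξ 0 ∈ W → ∀ t : ℝ, 0 ≤ t → ξ t ∈ U

/-- Every forward trajectory starting in `S` converges to the set `A`, i.e. is eventually in every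
neighbourhood of `A`. -/
def SetAttracts {X : Type*} [TopologicalSpace X] (traj : (ℝ → X) → Prop) (A S : Set X) : Prop :=
  ∀ ξ : ℝ → X, traj ξ → ξ 0 ∈ S → Tendsto ξ atTop (𝓝ˢ A)

/-- Local asymptotic stability of a set: Lyapunov stable and locally attractive. -/
def SetLocallyAsymptoticallyStable {X : Type*} [TopologicalSpace X] (traj : (ℝ → X) → Prop)
    (A : Set X) : Prop :=
  SetStable traj A ∧ ∃ W ∈ 𝓝ˢ A, SetAttracts traj A W

/-! ### Kinetic energy tensor -/

/-- An inner product on a vector space, as a bilinear form. -/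
structure KineticEnergyTensor (V : Type*) [AddCommGroup V] [Module ℝ V] where
  form : LinearMap.BilinForm ℝ V
  symm : ∀ v w, form v w = form w v
  pos : ∀ v, v ≠ 0 → 0 < form v v

namespace KineticEnergyTensor

variable {V : Type*} [AddCommGroup V] [Module ℝ V]

lemma nondegenerate (K : KineticEnergyTensor V) : K.form.Nondegenerate := by
  refine ⟨fun v hv => ?_, fun v hv => ?_⟩ <;>
  · by_contra h
    exact (K.pos v h).ne' (hv v)

/-- `v ↦ ⟪v, ·⟫`. -/
def flat (K : KineticEnergyTensor V) : V →ₗ[ℝ] Module.Dual ℝ V := K.form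

/-- The inverse of `flat`. -/
def sharp [FiniteDimensional ℝ V] (K : KineticEnergyTensor V) : Module.Dual ℝ V →ₗ[ℝ] V :=
  (K.form.toDual K.nondegenerate).symm

lemma flat_sharp [FiniteDimensional ℝ V] (K : KineticEnergyTensor V) (u : Module.Dual ℝ V) :
    K.flat (K.sharp u) = u :=
  (K.form.toDual K.nondegenerate).apply_symm_apply u

end KineticEnergyTensor

/-! ### Lie group preliminaries -/

section LieGroupDefs

variable {E : Type*} [NormedAddCommGroup E] [NormedSpace ℝ E]
  {G : Type*} [TopologicalSpace G] [ChartedSpace E G] [Group G]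

instance [FiniteDimensional ℝ E] (g : G) : FiniteDimensional ℝ (TangentSpace 𝓘(ℝ, E) g) :=
  inferInstanceAs (FiniteDimensional ℝ E)

/-- The tangent map `T_e L_g : 𝔤 → T_g G` of left translation by `g`. -/
def leftTangent (g : G) : GroupLieAlgebra 𝓘(ℝ, E) G →L[ℝ] TangentSpace 𝓘(ℝ, E) g :=
  (mfderiv 𝓘(ℝ, E) 𝓘(ℝ, E) (fun h : G => g * h) 1 : _)

/-- The dual map `(T_e L_g)^* : T_g^* G → 𝔤^*`. -/
def leftCotangent (g : G) (μ : TangentSpace 𝓘(ℝ, E) g →L[ℝ] ℝ) :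
    Module.Dual ℝ (GroupLieAlgebra 𝓘(ℝ, E) G) :=
  (μ.comp (leftTangent g)).toLinearMap

/-- The coadjoint operator `⟨ad^*_ξ μ, η⟩ = ⟨μ, [ξ, η]⟩`. -/
def coadjoint [FiniteDimensional ℝ E] [LieGroup 𝓘(ℝ, E) ∞ G] (ξ : GroupLieAlgebra 𝓘(ℝ, E) G)
    (μ : Module.Dual ℝ (GroupLieAlgebra 𝓘(ℝ, E) G)) :
    Module.Dual ℝ (GroupLieAlgebra 𝓘(ℝ, E) G) :=
  haveI : LieGroup 𝓘(ℝ, E) (minSmoothness ℝ 3) G :=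
    LieGroup.of_le (n := ∞) (by
      rw [minSmoothness_of_isRCLikeNormedField]
      exact ENat.LEInfty.out)
  haveI : CompleteSpace E := FiniteDimensional.complete ℝ E
  μ ∘ₗ (LieAlgebra.ad ℝ (GroupLieAlgebra 𝓘(ℝ, E) G) ξ)

/-- The differential `dΨ(g) ∈ T_g^* G` of a real-valued function on `G`. -/
def groupDifferential (E : Type*) [NormedAddCommGroup E] [NormedSpace ℝ E]
    {G : Type*} [TopologicalSpace G] [ChartedSpace E G]
    (Ψ : G → ℝ) (g : G) : TangentSpace 𝓘(ℝ, E) g →L[ℝ] ℝ :=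
  (mfderiv 𝓘(ℝ, E) 𝓘(ℝ, ℝ) Ψ g : _)

/-- The Hessian of `Ψ` at a point `g`, computed in the preferred chart at `g`. It is used only at
critical points, where it does not depend on the chart. -/
def chartHessian (E : Type*) [NormedAddCommGroup E] [NormedSpace ℝ E]
    {G : Type*} [TopologicalSpace G] [ChartedSpace E G]
    (Ψ : G → ℝ) (g : G) : E →L[ℝ] E →L[ℝ] ℝ :=
  fderiv ℝ (fderiv ℝ (Ψ ∘ (extChartAt 𝓘(ℝ, E) g).symm)) (extChartAt 𝓘(ℝ, E) g g)

/-- A configuration error function on `G`: smooth, nonnegative, proper, vanishing at the identity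
with zero differential and positive-definite Hessian there, and such that
`(g₁, g₂) ↦ Ψ (g₂⁻¹ g₁)` is symmetric. -/
structure IsErrorFunction (E : Type*) [NormedAddCommGroup E] [NormedSpace ℝ E]
    {G : Type*} [TopologicalSpace G] [ChartedSpace E G] [Group G] (Ψ : G → ℝ) : Prop where
  smooth : ContMDiff 𝓘(ℝ, E) 𝓘(ℝ, ℝ) ∞ Ψ
  nonneg : ∀ g, 0 ≤ Ψ g
  proper : IsProperMap Ψ
  map_one : Ψ 1 = 0
  differential_one : groupDifferential E Ψ 1 = 0
  hessian_one : ∀ w : E, w ≠ 0 → 0 < chartHessian E Ψ 1 w w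
  symmetric : ∀ g₁ g₂ : G, Ψ (g₂⁻¹ * g₁) = Ψ (g₁⁻¹ * g₂)

/-- The right tracking error function `Ψ_{G,r}(g₁, g₂) = Ψ_G(g₂⁻¹ g₁)`. -/
def rightTrackingError {G : Type*} [Group G] (Ψ : G → ℝ) (g₁ g₂ : G) : ℝ := Ψ (g₂⁻¹ * g₁)

/-- The levels `L` whose sublevel set contains `e` and no critical point of `Ψ` other than `e`. -/
def regularLevels (E : Type*) [NormedAddCommGroup E] [NormedSpace ℝ E]
    {G : Type*} [TopologicalSpace G] [ChartedSpace E G] [Group G] (Ψ : G → ℝ) : Set ℝ :=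
  {L | (1 : G) ∈ {g | Ψ g ≤ L} ∧ ∀ g ∈ {g | Ψ g ≤ L} \ {1}, groupDifferential E Ψ g ≠ 0}

/-- `τ_L`, the supremum of `regularLevels`; it is `⊤` if there are no other critical points, and
`⊥` if there is no such level at all. -/
def criticalThreshold (E : Type*) [NormedAddCommGroup E] [NormedSpace ℝ E]
    {G : Type*} [TopologicalSpace G] [ChartedSpace E G] [Group G] (Ψ : G → ℝ) : EReal :=
  sSup ((fun L : ℝ => (L : EReal)) '' regularLevels E Ψ)

/-! ### The multi-agent system -/

variable (E G) in
/-- States `(g₁, …, gₙ; v₁, …, vₙ) ∈ Gⁿ × 𝔤ⁿ`. -/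
abbrev AgentState (n : ℕ) : Type _ := (Fin n → G) × (Fin n → GroupLieAlgebra 𝓘(ℝ, E) G)

/-- `ξ = (γ, v)` is on `[0, ∞)` a trajectory of `n` identical simple mechanical control systems
with kinetic energy tensor `K` and (feedback) control inputs `u`:
`γᵢ' = T_e L_{γᵢ}(vᵢ)` and `vᵢ' - 𝕀^♯(ad^*_{vᵢ} 𝕀^♭ vᵢ) = 𝕀^♯(uᵢ)`. -/
def IsControlledTrajectory [FiniteDimensional ℝ E] [LieGroup 𝓘(ℝ, E) ∞ G] {n : ℕ}
    (K : KineticEnergyTensor (GroupLieAlgebra 𝓘(ℝ, E) G))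
    (u : AgentState E G n → Fin n → Module.Dual ℝ (GroupLieAlgebra 𝓘(ℝ, E) G))
    (ξ : ℝ → AgentState E G n) : Prop :=
  ∀ t : ℝ, 0 ≤ t → ∀ i : Fin n,
    HasMFDerivWithinAt 𝓘(ℝ, ℝ) 𝓘(ℝ, E) (fun s => (ξ s).1 i) (Ici 0) t
      ((1 : ℝ →L[ℝ] ℝ).smulRight (leftTangent ((ξ t).1 i) ((ξ t).2 i))) ∧
    ∃ v' : GroupLieAlgebra 𝓘(ℝ, E) G,
      HasDerivWithinAt (fun s => (ξ s).2 i) v' (Ici 0) t ∧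
      v' - K.sharp (coadjoint ((ξ t).2 i) (K.flat ((ξ t).2 i))) = K.sharp (u (ξ t) i)

/-- The consensus control input
`uᵢ = -ad^*_{vᵢ} 𝕀^♭ vᵢ - (1/αᵢ) (R^♭ vᵢ + Kₚ ∑ⱼ aᵢⱼ (T_e L_{gᵢ})^* dᵢΨ_{G,r}(gᵢ, gⱼ))`. -/
def consensusInput [FiniteDimensional ℝ E] [LieGroup 𝓘(ℝ, E) ∞ G] {n : ℕ}
    (𝒢 : SimpleGraph (Fin n)) [DecidableRel 𝒢.Adj]
    (K : KineticEnergyTensor (GroupLieAlgebra 𝓘(ℝ, E) G))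
    (R : LinearMap.BilinForm ℝ (GroupLieAlgebra 𝓘(ℝ, E) G))
    (Ψ : G → ℝ) (Kp : ℝ) (α : Fin n → ℝ)
    (x : AgentState E G n) (i : Fin n) : Module.Dual ℝ (GroupLieAlgebra 𝓘(ℝ, E) G) :=
  -coadjoint (x.2 i) (K.flat (x.2 i)) -
    (1 / α i) • (R (x.2 i) +
      Kp • ∑ j, 𝒢.adjMatrix ℝ i j •
        leftCotangent (x.1 i) (groupDifferential E (fun g => rightTrackingError Ψ g (x.1 j)) (x.1 i)))

/-- The weighted energy
`(Kₚ/2) ∑ᵢ ∑ⱼ aᵢⱼ Ψ_{G,r}(gᵢ, gⱼ) + (1/2) ∑ᵢ αᵢ ⟪vᵢ, vᵢ⟫_𝕀`. -/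
def weightedEnergy {n : ℕ} (𝒢 : SimpleGraph (Fin n)) [DecidableRel 𝒢.Adj]
    (K : KineticEnergyTensor (GroupLieAlgebra 𝓘(ℝ, E) G))
    (Ψ : G → ℝ) (Kp : ℝ) (α : Fin n → ℝ) (x : AgentState E G n) : ℝ :=
  Kp / 2 * ∑ i, ∑ j, 𝒢.adjMatrix ℝ i j * rightTrackingError Ψ (x.1 i) (x.1 j) +
    1 / 2 * ∑ i, α i * K.form (x.2 i) (x.2 i)

/-- The set `S¹` of states with weighted energy at most `(Kₚ/2) τ_L`. -/
def lowEnergySet {n : ℕ} (𝒢 : SimpleGraph (Fin n)) [DecidableRel 𝒢.Adj]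
    (K : KineticEnergyTensor (GroupLieAlgebra 𝓘(ℝ, E) G))
    (Ψ : G → ℝ) (Kp : ℝ) (α : Fin n → ℝ) : Set (AgentState E G n) :=
  {x | ((weightedEnergy 𝒢 K Ψ Kp α x : ℝ) : EReal) ≤
    ((Kp / 2 : ℝ) : EReal) * criticalThreshold E Ψ}

variable (E G) in
/-- The consensus equilibrium set `g₁ = ⋯ = gₙ`, `v₁ = ⋯ = vₙ = 0`. -/
def consensusSet (n : ℕ) : Set (AgentState E G n) :=
  {x | (∀ i j, x.1 i = x.1 j) ∧ ∀ i, x.2 i = 0}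

end LieGroupDefs

end

/-! The feedback cancels the coadjoint term, leaving `αᵢ vᵢ' = -(A vᵢ + Kp fᵢ)`. Here `A` is the
dissipation raised by the metric and `fᵢ` is the sum over the neighbours `j` of the left-trivialized
gradients of `Ψ` at `gⱼ⁻¹ gᵢ`. Only relative positions enter. By symmetry of `Ψ` the weighted energy
`W` satisfies `W' = -∑ 𝕀(A vᵢ, vᵢ)` (`IsSolution.hasDerivWithinAt_energy`), which shows dissipation
in the velocities only.

A strict Lyapunov function is `W + ε ∑ αᵢ 𝕀(fᵢ, vᵢ)` with `ε` small: differentiating the cross term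
produces `-Kp ∑ 𝕀(fᵢ, fᵢ)`, so the total derivative is at most `-b (‖v‖² + ‖f‖²)`. Exponential decay
follows once `W ≤ C (‖v‖² + ‖f‖²)` (`IsRegular.exists_energy_le`), which has two sources. The
positive Hessian makes `Ψ` and `‖∇Ψ‖²` comparable near `e`, and compactness extends this to any
compact set of relative positions with no other critical point (`IsRegular.exists_estimates`). On a
tree the vertex sums `fᵢ` control every single edge gradient, by peeling off leaves
(`SimpleGraph.IsTree.exists_norm_edge_le`).

Exponentially decaying velocities give curves of finite length, so every `γᵢ` converges in `G`
(`exists_tendsto_of_exp_velocity`), and the limits agree along edges because `Ψ` tends to zero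
there. The same length bound, made small, gives stability at each consensus point. Working at
individual points matters because the consensus set may be noncompact.

Relative positions stay in the compact set because every edge is counted twice in `W`, whence `Kp
Ψ(gⱼ⁻¹ gᵢ) ≤ W`. Against the bound `(Kp/2) τ_L` this leaves a factor of two, hence a regular level
`L` with `W < Kp L` (`exists_regularLevel_gt`). Local attraction uses a small compact neighbourhood
of `e` instead, since `τ_L` may be `-∞`.

Global existence: bounded energy bounds the velocities and, `Ψ` being proper, confines the relative
positions of neighbours to a compact set. In charts translated to the initial positions the field
then has uniform bounds, so Picard–Lindelöf gives a uniform existence time, which is iterated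
because `W` does not increase. -/

open scoped NNReal

noncomputable section

set_option linter.unusedSectionVars false

/-! ### Left translation in the chart at the identity. -/

section Charts

variable {E : Type*} [NormedAddCommGroup E] [NormedSpace ℝ E]
  {G : Type*} [TopologicalSpace G] [ChartedSpace E G] [Group G]

variable (E G) in
/-- Coordinates of the identity in the preferred chart at the identity. -/
def chartOrigin : E := extChartAt 𝓘(ℝ, E) (1 : G) 1

variable (E G) in
/-- The open set on which the inverse of the chart at the identity is defined. -/
def chartDomain : Set E := (extChartAt 𝓘(ℝ, E) (1 : G)).target

variable (E) in
/-- The preferred chart at the identity. -/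
def toChart (g : G) : E := extChartAt 𝓘(ℝ, E) (1 : G) g

variable (G) in
/-- The inverse of the preferred chart at the identity. -/
def ofChart (x : E) : G := (extChartAt 𝓘(ℝ, E) (1 : G)).symm x

variable (G) in
/-- Multiplication in the chart at the identity. -/
def chartMul (x y : E) : E := toChart E (ofChart G x * ofChart G y)

variable (G) in
/-- Tangent map of left translation in the chart at the identity. -/
def chartLeftTangent (x : E) : E →L[ℝ] E := fderiv ℝ (chartMul G x) (chartOrigin E G)

lemma toChart_one : toChart E (1 : G) = chartOrigin E G := rfl

lemma ofChart_chartOrigin : ofChart G (chartOrigin E G) = 1 := extChartAt_to_inv 1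

lemma isOpen_chartDomain : IsOpen (chartDomain E G) := isOpen_extChartAt_target 1

lemma chartOrigin_mem : chartOrigin E G ∈ chartDomain E G := mem_extChartAt_target 1

lemma toChart_ofChart {x : E} (hx : x ∈ chartDomain E G) : toChart E (ofChart G x) = x :=
  (extChartAt 𝓘(ℝ, E) (1 : G)).right_inv hx

lemma ofChart_toChart {g : G} (hg : g ∈ (chartAt E (1 : G)).source) :
    ofChart G (toChart E g) = g :=
  (extChartAt 𝓘(ℝ, E) (1 : G)).left_inv (by rwa [extChartAt_source])

lemma ofChart_mem_source {x : E} (hx : x ∈ chartDomain E G) :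
    ofChart G x ∈ (chartAt E (1 : G)).source := by
  have := (extChartAt 𝓘(ℝ, E) (1 : G)).map_target hx
  rwa [extChartAt_source] at this

lemma toChart_mem_chartDomain {g : G} (hg : g ∈ (chartAt E (1 : G)).source) :
    toChart E g ∈ chartDomain E G := by
  apply (extChartAt 𝓘(ℝ, E) (1 : G)).map_source
  rwa [extChartAt_source]

lemma source_mem_nhds_one : (chartAt E (1 : G)).source ∈ 𝓝 (1 : G) :=
  (chartAt E (1 : G)).open_source.mem_nhds (mem_chart_source E 1)

lemma eventually_ofChart_toChart : ∀ᶠ g in 𝓝 (1 : G), ofChart G (toChart E g) = g := by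
  filter_upwards [source_mem_nhds_one (E := E)] with g hg using ofChart_toChart hg

variable [LieGroup 𝓘(ℝ, E) ∞ G]

lemma contMDiffAt_toChart {g : G} (hg : g ∈ (chartAt E (1 : G)).source) :
    ContMDiffAt 𝓘(ℝ, E) 𝓘(ℝ, E) ∞ (toChart E : G → E) g :=
  contMDiffAt_extChartAt' hg

lemma contMDiffAt_ofChart {x : E} (hx : x ∈ chartDomain E G) :
    ContMDiffAt 𝓘(ℝ, E) 𝓘(ℝ, E) ∞ (ofChart G : E → G) x :=
  (contMDiffOn_extChartAt_symm (n := ∞) (1 : G)).contMDiffAt (isOpen_chartDomain.mem_nhds hx)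

lemma contMDiff_leftMul (g : G) : ContMDiff 𝓘(ℝ, E) 𝓘(ℝ, E) ∞ (fun h : G => g * h) :=
  contMDiff_mul_left

lemma mfderiv_toChart_one :
    mfderiv 𝓘(ℝ, E) 𝓘(ℝ, E) (toChart E : G → E) 1 = ContinuousLinearMap.id ℝ E := by
  have : IsManifold 𝓘(ℝ, E) 1 G := IsManifold.of_le (n := ∞) (by exact_mod_cast le_top)
  exact mfderiv_extChartAt_self

lemma contDiffAt_chartMul {x : E} (hx : x ∈ chartDomain E G) :
    ContDiffAt ℝ ∞ (Function.uncurry (chartMul G)) (x, chartOrigin E G) := by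
  rw [← contMDiffAt_iff_contDiffAt]
  have h1 : ContMDiffAt 𝓘(ℝ, E × E) 𝓘(ℝ, E) ∞ (fun p : E × E => ofChart G p.1)
      (x, chartOrigin E G) :=
    (contMDiffAt_ofChart hx).comp (x, chartOrigin E G) contDiffAt_fst.contMDiffAt
  have h2 : ContMDiffAt 𝓘(ℝ, E × E) 𝓘(ℝ, E) ∞ (fun p : E × E => ofChart G p.2)
      (x, chartOrigin E G) :=
    (contMDiffAt_ofChart chartOrigin_mem).comp (x, chartOrigin E G) contDiffAt_snd.contMDiffAt
  refine ContMDiffAt.comp (x, chartOrigin E G) (contMDiffAt_toChart ?_) (h1.mul h2)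
  simpa [ofChart_chartOrigin] using ofChart_mem_source hx

lemma contDiffAt_chartLeftTangent {x : E} (hx : x ∈ chartDomain E G) :
    ContDiffAt ℝ ∞ (chartLeftTangent G : E → E →L[ℝ] E) x :=
  ContDiffAt.fderiv (n := ∞) (contDiffAt_chartMul hx) contDiffAt_const (by simp)

lemma chartMul_chartOrigin_right {x : E} (hx : x ∈ chartDomain E G) :
    chartMul G x (chartOrigin E G) = x := by
  simp [chartMul, ofChart_chartOrigin, toChart_ofChart hx]

lemma chartLeftTangent_chartOrigin :
    chartLeftTangent G (chartOrigin E G) = ContinuousLinearMap.id ℝ E := by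
  rw [chartLeftTangent, ← fderiv_id (𝕜 := ℝ) (x := chartOrigin E G)]
  apply Filter.EventuallyEq.fderiv_eq
  filter_upwards [isOpen_chartDomain.mem_nhds (chartOrigin_mem (E := E) (G := G))] with x hx
  simp [chartMul, ofChart_chartOrigin, toChart_ofChart hx]

lemma differentiableAt_chartMul {x : E} (hx : x ∈ chartDomain E G) :
    DifferentiableAt ℝ (chartMul G x) (chartOrigin E G) := by
  have := (contDiffAt_chartMul hx).differentiableAt (by simp)
  exact this.comp (chartOrigin E G) ((differentiableAt_const x).prodMk differentiableAt_id)

lemma mdifferentiableAt_translate_ofChart (c : G) {x : E} (hx : x ∈ chartDomain E G) :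
    MDifferentiableAt 𝓘(ℝ, E) 𝓘(ℝ, E) (fun y : E => c * ofChart G y) x :=
  (((contMDiff_leftMul c).contMDiffAt).comp x (contMDiffAt_ofChart hx)).mdifferentiableAt (by simp)

/-- The tangent map of left translation, computed through the chart at the identity. -/
lemma leftTangent_translate_ofChart (c : G) {x : E} (hx : x ∈ chartDomain E G) (v : E) :
    leftTangent (E := E) (c * ofChart G x) v =
      mfderiv 𝓘(ℝ, E) 𝓘(ℝ, E) (fun y : E => c * ofChart G y) x (chartLeftTangent G x v) := by
  -- Near `1` left translation factors through the chart product, so the claim is the chain rule for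
  -- this factorization.
  have e : (fun h : G => c * ofChart G x * h) =ᶠ[𝓝 1]
      ((fun y : E => c * ofChart G y) ∘ chartMul G x) ∘ toChart E := by
    have h1 : ∀ᶠ h in 𝓝 (1 : G), ofChart G x * h ∈ (chartAt E (1 : G)).source := by
      have : Tendsto (fun h : G => ofChart G x * h) (𝓝 1) (𝓝 (ofChart G x * 1)) :=
        ((contMDiff_leftMul (E := E) (ofChart G x)).continuous).tendsto 1
      rw [mul_one] at this
      exact this.eventually ((chartAt E (1 : G)).open_source.mem_nhds (ofChart_mem_source hx))
    filter_upwards [h1, eventually_ofChart_toChart (E := E)] with h h1 h2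
    simp [chartMul, h2, ofChart_toChart h1, mul_assoc]
  have d1 : HasMFDerivAt 𝓘(ℝ, E) 𝓘(ℝ, E) (toChart E : G → E) 1 (ContinuousLinearMap.id ℝ E) := by
    have := ((contMDiffAt_toChart (E := E) (mem_chart_source E (1 : G))).mdifferentiableAt
      (by simp)).hasMFDerivAt
    rwa [mfderiv_toChart_one] at this
  have d2 : HasMFDerivAt 𝓘(ℝ, E) 𝓘(ℝ, E) (chartMul G x) (chartOrigin E G)
      (chartLeftTangent G x : E →L[ℝ] E) :=
    hasMFDerivAt_iff_hasFDerivAt.mpr (differentiableAt_chartMul hx).hasFDerivAt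
  have d3 := (mdifferentiableAt_translate_ofChart c hx).hasMFDerivAt
  have d3' : HasMFDerivAt 𝓘(ℝ, E) 𝓘(ℝ, E) (fun y : E => c * ofChart G y)
      (chartMul G x (chartOrigin E G))
      (mfderiv 𝓘(ℝ, E) 𝓘(ℝ, E) (fun y : E => c * ofChart G y) x) := by
    rw [chartMul_chartOrigin_right hx]; exact d3
  have d4 := (HasMFDerivAt.comp (1 : G) (d3'.comp (chartOrigin E G) d2) d1).congr_of_eventuallyEq e
  exact DFunLike.congr_fun d4.mfderiv v

/-- A curve read in a translated chart solves the coordinate kinematic equation. -/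
lemma hasMFDerivWithinAt_translate_ofChart (c : G) {x : ℝ → E} {v : E} {s : Set ℝ} {t : ℝ}
    (hx : x t ∈ chartDomain E G)
    (hd : HasDerivWithinAt x (chartLeftTangent G (x t) v) s t) :
    HasMFDerivWithinAt 𝓘(ℝ, ℝ) 𝓘(ℝ, E) (fun τ => c * ofChart G (x τ)) s t
      ((1 : ℝ →L[ℝ] ℝ).smulRight (leftTangent (E := E) (c * ofChart G (x t)) v)) := by
  have d1 := (mdifferentiableAt_translate_ofChart c hx).hasMFDerivAt
  have d2 : HasMFDerivWithinAt 𝓘(ℝ, ℝ) 𝓘(ℝ, E) x s t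
      ((1 : ℝ →L[ℝ] ℝ).smulRight (chartLeftTangent G (x t) v)) :=
    hasMFDerivWithinAt_iff_hasFDerivWithinAt.mpr hd.hasFDerivWithinAt
  have d3 := d1.comp_hasMFDerivWithinAt t d2
  rw [leftTangent_translate_ofChart c hx]
  refine d3.congr_mfderiv ?_
  ext
  exact map_smul (mfderiv 𝓘(ℝ, E) 𝓘(ℝ, E) (fun y : E => c * ofChart G y) (x t)) (1 : ℝ) _

end Charts

/-! ### Derivatives of functions of relative positions. -/

section Relative

variable {E : Type*} [NormedAddCommGroup E] [NormedSpace ℝ E]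
  {G : Type*} [TopologicalSpace G] [ChartedSpace E G] [Group G] [LieGroup 𝓘(ℝ, E) ∞ G]
  {V : Type*} [NormedAddCommGroup V] [NormedSpace ℝ V]

/-- A curve solving the kinematic equation, read in a translated chart. -/
lemma hasDerivWithinAt_toChart_translate (c : G) {γ : ℝ → G} {v : E} {s : Set ℝ} {t : ℝ}
    (hc : c⁻¹ * γ t ∈ (chartAt E (1 : G)).source)
    (hd : HasMFDerivWithinAt 𝓘(ℝ, ℝ) 𝓘(ℝ, E) γ s t
      ((1 : ℝ →L[ℝ] ℝ).smulRight (leftTangent (E := E) (γ t) v))) :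
    HasDerivWithinAt (fun τ => toChart E (c⁻¹ * γ τ))
      (chartLeftTangent G (toChart E (c⁻¹ * γ t)) v) s t := by
  obtain ⟨x, hxdef⟩ : ∃ x, x = toChart E (c⁻¹ * γ t) := ⟨_, rfl⟩
  have hx : x ∈ chartDomain E G := hxdef ▸ toChart_mem_chartDomain hc
  have hγ : c * ofChart G x = γ t := by
    rw [hxdef, ofChart_toChart hc, mul_inv_cancel_left]
  have d1 : HasMFDerivAt 𝓘(ℝ, E) 𝓘(ℝ, E) (fun g : G => toChart E (c⁻¹ * g)) (γ t)
      (mfderiv 𝓘(ℝ, E) 𝓘(ℝ, E) (fun g : G => toChart E (c⁻¹ * g)) (γ t)) :=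
    (((contMDiffAt_toChart hc).comp (γ t) (contMDiff_leftMul c⁻¹).contMDiffAt).mdifferentiableAt
      (by simp)).hasMFDerivAt
  have d2 := (mdifferentiableAt_translate_ofChart c hx).hasMFDerivAt
  have d1' : HasMFDerivAt 𝓘(ℝ, E) 𝓘(ℝ, E) (fun g : G => toChart E (c⁻¹ * g)) (c * ofChart G x)
      (mfderiv 𝓘(ℝ, E) 𝓘(ℝ, E) (fun g : G => toChart E (c⁻¹ * g)) (γ t)) := by
    rw [hγ]; exact d1
  -- The translated chart and its inverse compose to the identity near `x`, so the derivative of one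
  -- undoes that of the other.
  have e : (id : E → E) =ᶠ[𝓝 x]
      (fun g : G => toChart E (c⁻¹ * g)) ∘ (fun y : E => c * ofChart G y) := by
    filter_upwards [isOpen_chartDomain.mem_nhds hx] with y hy
    simp [toChart_ofChart hy]
  have d3 := ((d1'.comp x d2).congr_of_eventuallyEq e).mfderiv
  have key : mfderiv 𝓘(ℝ, E) 𝓘(ℝ, E) (fun g : G => toChart E (c⁻¹ * g)) (γ t)
      (leftTangent (E := E) (γ t) v) = chartLeftTangent G x v := by
    have h1 := leftTangent_translate_ofChart c hx v
    rw [mfderiv_id] at d3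
    rw [hγ] at h1
    rw [h1]
    exact (DFunLike.congr_fun d3 (chartLeftTangent G x v)).symm
  have d4 := d1.comp_hasMFDerivWithinAt t hd
  have d5 : HasMFDerivWithinAt 𝓘(ℝ, ℝ) 𝓘(ℝ, E) (fun τ => toChart E (c⁻¹ * γ τ)) s t
      ((1 : ℝ →L[ℝ] ℝ).smulRight (chartLeftTangent G x v)) := by
    refine d4.congr_mfderiv ?_
    ext
    refine (map_smul (mfderiv 𝓘(ℝ, E) 𝓘(ℝ, E) (fun g : G => toChart E (c⁻¹ * g)) (γ t))
      (1 : ℝ) _).trans ?_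
    rw [key]
    rfl
  have d6 : HasFDerivWithinAt (fun τ => toChart E (c⁻¹ * γ τ))
      ((1 : ℝ →L[ℝ] ℝ).smulRight (chartLeftTangent G x v : E)) s t :=
    hasMFDerivWithinAt_iff_hasFDerivWithinAt.mp d5
  rw [← hxdef]
  simpa using d6.hasDerivWithinAt

/-- `F` at a perturbed relative configuration: `(x, y) ↦ F (σ(y)⁻¹ h σ(x))` with `σ` the inverse
chart. -/
def perturbed (F : G → V) (h : G) (z : E × E) : V := F ((ofChart G z.2)⁻¹ * h * ofChart G z.1)

variable (E) in
/-- The differential of `F` at `h` in terms of velocities on the right and on the left. -/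
def relDifferential (F : G → V) (h : G) : E × E →L[ℝ] V :=
  fderiv ℝ (perturbed F h) (chartOrigin E G, chartOrigin E G)

lemma contMDiffAt_perturbed {F : G → V} (hF : ContMDiff 𝓘(ℝ, E) 𝓘(ℝ, V) ∞ F) (h : G) {z : E × E}
    (hz : z ∈ chartDomain E G ×ˢ chartDomain E G) :
    ContMDiffAt (𝓘(ℝ, E).prod 𝓘(ℝ, E × E)) 𝓘(ℝ, V) ∞ (Function.uncurry (perturbed F)) (h, z) := by
  have h0 : ContMDiffAt (𝓘(ℝ, E).prod 𝓘(ℝ, E × E)) 𝓘(ℝ, E) ∞ (fun p : G × (E × E) => p.1)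
      (h, z) := contMDiffAt_fst
  have h1 : ContMDiffAt (𝓘(ℝ, E).prod 𝓘(ℝ, E × E)) 𝓘(ℝ, E) ∞
      (fun p : G × (E × E) => ofChart G p.2.1) (h, z) :=
    (contMDiffAt_ofChart hz.1).comp (h, z)
      ((contDiff_fst.contMDiff.contMDiffAt (x := z)).comp (h, z) contMDiffAt_snd)
  have h2 : ContMDiffAt (𝓘(ℝ, E).prod 𝓘(ℝ, E × E)) 𝓘(ℝ, E) ∞
      (fun p : G × (E × E) => ofChart G p.2.2) (h, z) :=
    (contMDiffAt_ofChart hz.2).comp (h, z)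
      ((contDiff_snd.contMDiff.contMDiffAt (x := z)).comp (h, z) contMDiffAt_snd)
  exact hF.contMDiffAt.comp (h, z) ((h2.inv.mul h0).mul h1)

lemma differentiableAt_perturbed {F : G → V} (hF : ContMDiff 𝓘(ℝ, E) 𝓘(ℝ, V) ∞ F) (h : G)
    {z : E × E} (hz : z ∈ chartDomain E G ×ˢ chartDomain E G) :
    DifferentiableAt ℝ (perturbed F h : E × E → V) z := by
  have := (contMDiffAt_perturbed hF h hz).comp z
    (contMDiffAt_const.prodMk contMDiffAt_id : ContMDiffAt 𝓘(ℝ, E × E)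
      (𝓘(ℝ, E).prod 𝓘(ℝ, E × E)) ∞ (fun z : E × E => (h, z)) z)
  exact (contMDiffAt_iff_contDiffAt.mp this).differentiableAt (by simp)

/-- Continuity is joint in the base point and the chart point, so that compactness can later give
Lipschitz constants uniform over the relative positions. Over model spaces tangent coordinates are
trivial, so smoothness of `mfderiv` becomes continuity of `fderiv`. -/
lemma continuousAt_fderiv_perturbed {F : G → V} (hF : ContMDiff 𝓘(ℝ, E) 𝓘(ℝ, V) ∞ F) (h : G)
    {z : E × E} (hz : z ∈ chartDomain E G ×ˢ chartDomain E G) :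
    ContinuousAt (fun p : G × (E × E) => fderiv ℝ (perturbed F p.1) p.2) (h, z) := by
  have h1 : ContMDiffAt ((𝓘(ℝ, E).prod 𝓘(ℝ, E × E)).prod 𝓘(ℝ, E × E)) 𝓘(ℝ, V) ∞
      (Function.uncurry fun (p : G × (E × E)) (w : E × E) => perturbed F p.1 w) ((h, z), z) :=
    ContMDiffAt.comp (g := Function.uncurry (perturbed F)) ((h, z), z)
      (contMDiffAt_perturbed hF h hz)
      ((contMDiffAt_fst.comp ((h, z), z) contMDiffAt_fst).prodMk contMDiffAt_snd)
  have h2 := ContMDiffAt.mfderiv (m := ∞) _ (fun p : G × (E × E) => p.2) h1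
    contMDiffAt_snd (by simp)
  have e := inTangentCoordinates_model_space (I := 𝓘(ℝ, E × E)) (I' := 𝓘(ℝ, V))
    (fun p : G × (E × E) => p.2) (fun p : G × (E × E) => perturbed F p.1 p.2)
    (fun p : G × (E × E) => fderiv ℝ (perturbed F p.1) p.2) (h, z)
  rw [← e]
  simp only [mfderiv_eq_fderiv] at h2
  exact h2.continuousAt

lemma contMDiff_relDifferential {F : G → V} (hF : ContMDiff 𝓘(ℝ, E) 𝓘(ℝ, V) ∞ F) :
    ContMDiff 𝓘(ℝ, E) 𝓘(ℝ, E × E →L[ℝ] V) ∞ (relDifferential E F) := by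
  intro h
  have h2 := ContMDiffAt.mfderiv (m := ∞) (perturbed F)
    (fun _ : G => (chartOrigin E G, chartOrigin E G))
    (contMDiffAt_perturbed hF h ⟨chartOrigin_mem, chartOrigin_mem⟩) contMDiffAt_const (by simp)
  have e := inTangentCoordinates_model_space (I := 𝓘(ℝ, E × E)) (I' := 𝓘(ℝ, V))
    (fun _ : G => (chartOrigin E G, chartOrigin E G))
    (fun h : G => perturbed F h (chartOrigin E G, chartOrigin E G)) (relDifferential E F) h
  rw [← e]
  simp only [mfderiv_eq_fderiv] at h2
  exact h2

/-- The derivative of `F (γ₂⁻¹ γ₁)` along two curves with given left-trivialized velocities. -/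
lemma hasDerivWithinAt_comp_relative {F : G → V} (hF : ContMDiff 𝓘(ℝ, E) 𝓘(ℝ, V) ∞ F)
    {γ₁ γ₂ : ℝ → G} {v₁ v₂ : E} {s : Set ℝ} {t : ℝ}
    (h₁ : HasMFDerivWithinAt 𝓘(ℝ, ℝ) 𝓘(ℝ, E) γ₁ s t
      ((1 : ℝ →L[ℝ] ℝ).smulRight (leftTangent (E := E) (γ₁ t) v₁)))
    (h₂ : HasMFDerivWithinAt 𝓘(ℝ, ℝ) 𝓘(ℝ, E) γ₂ s t
      ((1 : ℝ →L[ℝ] ℝ).smulRight (leftTangent (E := E) (γ₂ t) v₂))) :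
    HasDerivWithinAt (fun τ => F ((γ₂ τ)⁻¹ * γ₁ τ))
      (relDifferential E F ((γ₂ t)⁻¹ * γ₁ t) (v₁, v₂)) s t := by
  -- Each curve is read in the chart centred at its own value at time `t`, where the coordinate left
  -- translation has identity tangent map; the coordinate velocity is therefore `v` itself.
  have hcont : ∀ {γ : ℝ → G} {v : E}, HasMFDerivWithinAt 𝓘(ℝ, ℝ) 𝓘(ℝ, E) γ s t
      ((1 : ℝ →L[ℝ] ℝ).smulRight (leftTangent (E := E) (γ t) v)) →
      HasDerivWithinAt (fun τ => toChart E ((γ t)⁻¹ * γ τ)) v s t ∧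
      ∀ᶠ τ in 𝓝[s] t, γ τ = γ t * ofChart G (toChart E ((γ t)⁻¹ * γ τ)) := by
    intro γ v hγ
    constructor
    · have := hasDerivWithinAt_toChart_translate (γ t) (by simp) hγ
      simpa [toChart_one, chartLeftTangent_chartOrigin] using this
    · have h1 : Tendsto (fun τ => (γ t)⁻¹ * γ τ) (𝓝[s] t) (𝓝 ((γ t)⁻¹ * γ t)) :=
        ((contMDiff_leftMul (E := E) (γ t)⁻¹).continuous.tendsto (γ t)).comp hγ.continuousWithinAt
      rw [inv_mul_cancel] at h1
      filter_upwards [h1.eventually (eventually_ofChart_toChart (E := E))] with τ hτ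
      rw [hτ, mul_inv_cancel_left]
  obtain ⟨d₁, e₁⟩ := hcont h₁
  obtain ⟨d₂, e₂⟩ := hcont h₂
  have hd := (differentiableAt_perturbed hF ((γ₂ t)⁻¹ * γ₁ t)
    (z := (chartOrigin E G, chartOrigin E G)) ⟨chartOrigin_mem, chartOrigin_mem⟩).hasFDerivAt
  have hp := d₁.prodMk d₂
  have hd' : HasFDerivAt (perturbed F ((γ₂ t)⁻¹ * γ₁ t))
      (relDifferential E F ((γ₂ t)⁻¹ * γ₁ t))
      (toChart E ((γ₁ t)⁻¹ * γ₁ t), toChart E ((γ₂ t)⁻¹ * γ₂ t)) := by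
    rw [inv_mul_cancel, inv_mul_cancel, toChart_one]
    exact hd
  have := hd'.comp_hasDerivWithinAt t hp
  refine this.congr_of_eventuallyEq ?_ ?_
  · filter_upwards [e₁, e₂] with τ h1 h2
    simp only [Function.comp, perturbed]
    congr 1
    nth_rewrite 1 [h1, h2]
    simp only [mul_inv_rev, mul_assoc]
  · simp [perturbed, toChart_one, ofChart_chartOrigin]

end Relative

/-! ### Quadratic behaviour at a nondegenerate minimum, and comparison on compact sets. -/

section QuadraticEstimates

variable {E : Type*} [NormedAddCommGroup E] [NormedSpace ℝ E] [FiniteDimensional ℝ E]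

/-- A positive, continuous, 2-homogeneous function dominates a multiple of the squared norm. -/
lemma exists_pos_mul_norm_sq_le {q : E → ℝ} (hq : Continuous q)
    (hom : ∀ (r : ℝ) (w : E), q (r • w) = r ^ 2 * q w) (pos : ∀ w, w ≠ 0 → 0 < q w) :
    ∃ c > 0, ∀ w, c * ‖w‖ ^ 2 ≤ q w := by
  rcases (Metric.sphere (0 : E) 1).eq_empty_or_nonempty with h | h
  · refine ⟨1, one_pos, fun w => ?_⟩
    have hw : w = 0 := by
      by_contra hw
      have : ‖w‖⁻¹ • w ∈ Metric.sphere (0 : E) 1 := by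
        simp [norm_smul, inv_mul_cancel₀ (norm_ne_zero_iff.mpr hw)]
      simp [h] at this
    subst hw
    have := hom 0 0
    simp at this
    simp [this]
  · obtain ⟨u, hu, hmin⟩ := (isCompact_sphere (0 : E) 1).exists_isMinOn h hq.continuousOn
    have hu0 : u ≠ 0 := by rintro rfl; simp at hu
    refine ⟨q u, pos u hu0, fun w => ?_⟩
    by_cases hw : w = 0
    · subst hw
      have := hom 0 0
      simp at this
      simp [this]
    · have hw' : ‖w‖ ≠ 0 := norm_ne_zero_iff.mpr hw
      have h1 : ‖w‖⁻¹ • w ∈ Metric.sphere (0 : E) 1 := by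
        simp [norm_smul, inv_mul_cancel₀ hw']
      have h2 : q u ≤ q (‖w‖⁻¹ • w) := hmin h1
      have h3 : q w = ‖w‖ ^ 2 * q (‖w‖⁻¹ • w) := by
        rw [← hom, smul_smul, mul_inv_cancel₀ hw', one_smul]
      rw [h3, mul_comm]
      gcongr

/-- Quadratic behaviour of a `C²` function at a nondegenerate minimum. -/
lemma quadratic_estimates_of_hessian_pos {ψ : E → ℝ} {o : E} (hψ : ContDiffAt ℝ 2 ψ o)
    (h0 : ψ o = 0) (h1 : fderiv ℝ ψ o = 0)
    (h2 : ∀ w, w ≠ 0 → 0 < fderiv ℝ (fderiv ℝ ψ) o w w) :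
    ∃ c > 0, ∃ C > 0, ∀ᶠ x in 𝓝 o, c * ‖x - o‖ ^ 2 ≤ ψ x ∧ ψ x ≤ C * ‖x - o‖ ^ 2 ∧
      c * ‖x - o‖ ≤ ‖fderiv ℝ ψ x‖ ∧ ‖fderiv ℝ ψ x‖ ≤ C * ‖x - o‖ := by
  set H := fderiv ℝ (fderiv ℝ ψ) o with hH
  obtain ⟨c, hc, hcw⟩ : ∃ c > 0, ∀ w, c * ‖w‖ ^ 2 ≤ H w w := by
    refine exists_pos_mul_norm_sq_le (by fun_prop) (fun r w => ?_) h2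
    simp; ring
  have hd : HasFDerivAt (fderiv ℝ ψ) H o :=
    ((hψ.fderiv_right (m := 1) (by norm_num)).differentiableAt (by simp)).hasFDerivAt
  have hdiff : ∀ᶠ x in 𝓝 o, DifferentiableAt ℝ ψ x :=
    (hψ.eventually (by simp)).mono fun x hx => hx.differentiableAt (by simp)
  have hb : ∀ᶠ x in 𝓝 o, ‖fderiv ℝ ψ x - H (x - o)‖ ≤ c / 2 * ‖x - o‖ := by
    have := hd.isLittleO.def (half_pos hc)
    simpa [h1] using this
  obtain ⟨r, hr, hball⟩ := Metric.eventually_nhds_iff_ball.mp (hdiff.and hb)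
  have hlow : ∀ w : E, c * ‖w‖ ≤ ‖H w‖ := by
    intro w
    by_cases hw : w = 0
    · simp [hw]
    · have := (hcw w).trans ((le_abs_self _).trans ((H w).le_opNorm w))
      rw [pow_two, ← mul_assoc] at this
      exact le_of_mul_le_mul_right this (norm_pos_iff.mpr hw)
  -- On the ball the differential is within `c/2 * ‖x - o‖` of its linearization. Radial slopes are
  -- thus at least `s * (c/2) * ‖x - o‖²`, which integrates to `c/4`; the bounds on the differential
  -- itself, `c/2` and `‖H‖ + c/2`, are weaker requirements.
  refine ⟨c / 4, by positivity, ‖H‖ + c, by positivity, ?_⟩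
  filter_upwards [Metric.ball_mem_nhds o hr] with x hx
  have hHn : ‖H (x - o)‖ ≤ ‖H‖ * ‖x - o‖ := H.le_opNorm _
  have hxo : 0 ≤ ‖x - o‖ := norm_nonneg _
  have hbx := (hball x hx).2
  have ray : ∀ s ∈ Icc (0 : ℝ) 1, o + s • (x - o) ∈ Metric.ball o r := by
    intro s hs
    rw [mem_ball_iff_norm] at hx ⊢
    rw [add_sub_cancel_left, norm_smul, Real.norm_of_nonneg hs.1]
    nlinarith [hs.2]
  have hder : ∀ s ∈ Icc (0 : ℝ) 1, HasDerivAt (fun s : ℝ => ψ (o + s • (x - o)))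
      (fderiv ℝ ψ (o + s • (x - o)) (x - o)) s := by
    intro s hs
    have e : HasDerivAt (fun s : ℝ => o + s • (x - o)) (x - o) s := by
      simpa using ((hasDerivAt_id s).smul_const (x - o)).const_add o
    exact (hball _ (ray s hs)).1.hasFDerivAt.comp_hasDerivAt s e
  have hslope : ∀ s ∈ Icc (0 : ℝ) 1,
      |fderiv ℝ ψ (o + s • (x - o)) (x - o) - s * H (x - o) (x - o)| ≤
        s * (c / 2 * ‖x - o‖ ^ 2) := by
    intro s hs
    have e1 := (hball _ (ray s hs)).2
    rw [add_sub_cancel_left, norm_smul, Real.norm_of_nonneg hs.1] at e1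
    have e2 := (fderiv ℝ ψ (o + s • (x - o)) - H (s • (x - o))).le_opNorm (x - o)
    have e3 : (fderiv ℝ ψ (o + s • (x - o)) - H (s • (x - o))) (x - o) =
        fderiv ℝ ψ (o + s • (x - o)) (x - o) - s * H (x - o) (x - o) := by simp
    rw [e3, Real.norm_eq_abs] at e2
    nlinarith
  have quad : ∀ k s : ℝ, HasDerivAt (fun s : ℝ => k / 2 * s ^ 2) (k * s) s := by
    intro k s
    refine ((hasDerivAt_pow 2 s).const_mul (k / 2)).congr_deriv ?_
    norm_num
    ring
  have hHu : H (x - o) (x - o) ≤ ‖H‖ * ‖x - o‖ ^ 2 := by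
    have := (le_abs_self _).trans ((H (x - o)).le_opNorm (x - o))
    nlinarith
  have hHl := hcw (x - o)
  have hint : interior (Icc (0 : ℝ) 1) = Ioo 0 1 := interior_Icc
  have lower : c / 4 * ‖x - o‖ ^ 2 ≤ ψ x := by
    -- Comparing slopes along the ray from `o` to `x` replaces a second-order Taylor formula.
    have mono : MonotoneOn (fun s : ℝ => ψ (o + s • (x - o)) - c / 2 * ‖x - o‖ ^ 2 / 2 * s ^ 2)
        (Icc 0 1) := by
      refine monotoneOn_of_hasDerivWithinAt_nonneg (convex_Icc 0 1)
        (fun s hs => (((hder s hs).sub (quad _ s)).continuousAt).continuousWithinAt)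
        (fun s hs => ((hder s (interior_subset hs)).sub (quad _ s)).hasDerivWithinAt) ?_
      intro s hs
      have hs' := interior_subset hs
      have := (abs_le.mp (hslope s hs')).1
      nlinarith [mul_le_mul_of_nonneg_left hHl hs'.1]
    have := mono (left_mem_Icc.mpr zero_le_one) (right_mem_Icc.mpr zero_le_one) zero_le_one
    simp [h0] at this
    linarith
  have upper : ψ x ≤ (‖H‖ + c) * ‖x - o‖ ^ 2 := by
    have mono : AntitoneOn (fun s : ℝ => ψ (o + s • (x - o)) -
        (‖H‖ + c) * ‖x - o‖ ^ 2 / 2 * s ^ 2) (Icc 0 1) := by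
      refine antitoneOn_of_hasDerivWithinAt_nonpos (convex_Icc 0 1)
        (fun s hs => (((hder s hs).sub (quad _ s)).continuousAt).continuousWithinAt)
        (fun s hs => ((hder s (interior_subset hs)).sub (quad _ s)).hasDerivWithinAt) ?_
      intro s hs
      have hs' := interior_subset hs
      have := (abs_le.mp (hslope s hs')).2
      nlinarith [mul_le_mul_of_nonneg_left hHu hs'.1,
        mul_nonneg hs'.1 (mul_nonneg hc.le (sq_nonneg ‖x - o‖))]
    have := mono (left_mem_Icc.mpr zero_le_one) (right_mem_Icc.mpr zero_le_one) zero_le_one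
    simp [h0] at this
    nlinarith [mul_nonneg (norm_nonneg H) (sq_nonneg ‖x - o‖), mul_nonneg hc.le (sq_nonneg ‖x - o‖)]
  refine ⟨lower, upper, ?_, ?_⟩
  · have := norm_sub_norm_le (H (x - o)) (fderiv ℝ ψ x)
    rw [norm_sub_rev] at this
    nlinarith [hlow (x - o)]
  · have := norm_sub_norm_le (fderiv ℝ ψ x) (H (x - o))
    nlinarith

/-- Two continuous functions comparable near a point, the second one positive elsewhere on a
compact set, are comparable on that set. -/
lemma exists_le_mul_of_isCompact {X : Type*} [TopologicalSpace X] {D : Set X} (hD : IsCompact D)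
    {p q : X → ℝ} (hp : Continuous p) (hq : Continuous q) (hq0 : ∀ x, 0 ≤ q x) {a : X}
    (hpos : ∀ x ∈ D, x ≠ a → 0 < q x) (hnear : ∃ C, ∀ᶠ x in 𝓝 a, p x ≤ C * q x) :
    ∃ C > 0, ∀ x ∈ D, p x ≤ C * q x := by
  obtain ⟨C₀, hC₀⟩ := hnear
  -- Comparability with some constant passes to subsets and finite unions, so it only has to be
  -- checked near each point.
  refine hD.induction_on (p := fun s => ∃ C > 0, ∀ x ∈ s, p x ≤ C * q x) ⟨1, one_pos, by simp⟩
    ?_ ?_ ?_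
  · rintro s t hst ⟨C, hC, h⟩
    exact ⟨C, hC, fun x hx => h x (hst hx)⟩
  · rintro s t ⟨C, hC, h⟩ ⟨C', hC', h'⟩
    refine ⟨max C C', lt_max_of_lt_left hC, ?_⟩
    rintro x (hx | hx)
    · exact (h x hx).trans (mul_le_mul_of_nonneg_right (le_max_left _ _) (hq0 x))
    · exact (h' x hx).trans (mul_le_mul_of_nonneg_right (le_max_right _ _) (hq0 x))
  · intro x hx
    by_cases hxa : x = a
    · subst hxa
      refine ⟨_, mem_nhdsWithin_of_mem_nhds hC₀, max C₀ 1, lt_max_of_lt_right one_pos, ?_⟩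
      intro y hy
      exact (show p y ≤ C₀ * q y from hy).trans
        (mul_le_mul_of_nonneg_right (le_max_left _ _) (hq0 y))
    · have hqx := hpos x hx hxa
      -- The `+ 1` makes the inequality strict at `x`, hence stable nearby, and the constant
      -- positive.
      have hC : p x < ((|p x| + 1) / q x) * q x := by
        rw [div_mul_cancel₀ _ hqx.ne']
        linarith [le_abs_self (p x)]
      refine ⟨_, mem_nhdsWithin_of_mem_nhds
        (hp.continuousAt.eventually_lt (hq.continuousAt.const_mul ((|p x| + 1) / q x)) hC),
        (|p x| + 1) / q x, by positivity, fun y hy => le_of_lt hy⟩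

end QuadraticEstimates

/-! ### The left-trivialized differential of the error function. -/

section Gradient

variable {E : Type*} [NormedAddCommGroup E] [NormedSpace ℝ E]
  {G : Type*} [TopologicalSpace G] [ChartedSpace E G] [Group G]

variable (E) in
/-- The left-trivialized differential `η ↦ dΨ(h)(T_e L_h η)`. -/
def leftDifferential (Ψ : G → ℝ) (h : G) : E →L[ℝ] ℝ :=
  (relDifferential E Ψ h).comp (ContinuousLinearMap.inl ℝ E E)

lemma leftDifferential_apply (Ψ : G → ℝ) (h : G) (v : E) :
    leftDifferential E Ψ h v = relDifferential E Ψ h (v, 0) := rfl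

variable [LieGroup 𝓘(ℝ, E) ∞ G]

lemma contMDiff_leftDifferential {Ψ : G → ℝ} (hΨ : ContMDiff 𝓘(ℝ, E) 𝓘(ℝ, ℝ) ∞ Ψ) :
    ContMDiff 𝓘(ℝ, E) 𝓘(ℝ, E →L[ℝ] ℝ) ∞ (leftDifferential E Ψ) :=
  ((ContinuousLinearMap.compL ℝ E (E × E) ℝ).flip
    (ContinuousLinearMap.inl ℝ E E)).contMDiff.comp (contMDiff_relDifferential hΨ)

lemma hasFDerivAt_perturbed_right {Ψ : G → ℝ} (hΨ : ContMDiff 𝓘(ℝ, E) 𝓘(ℝ, ℝ) ∞ Ψ) (h : G) :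
    HasFDerivAt (fun y : E => Ψ (h * ofChart G y)) (leftDifferential E Ψ h) (chartOrigin E G) := by
  have hd := (differentiableAt_perturbed hΨ h
    (z := (chartOrigin E G, chartOrigin E G)) ⟨chartOrigin_mem, chartOrigin_mem⟩).hasFDerivAt
  have := HasFDerivAt.comp (g := perturbed Ψ h) (f := fun y : E => (id y, chartOrigin E G))
    (chartOrigin E G) hd ((hasFDerivAt_id (𝕜 := ℝ) (chartOrigin E G)).prodMk
      (hasFDerivAt_const (chartOrigin E G) _))
  have e : (fun y : E => Ψ (h * ofChart G y)) =
      perturbed Ψ h ∘ fun y : E => (id y, chartOrigin E G) := by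
    ext y; simp [perturbed, ofChart_chartOrigin]
  rw [e]
  exact this

/-- Left translations compose, so the potential force in the control law depends only on the
relative position. -/
lemma leftCotangent_groupDifferential {Ψ : G → ℝ} (hΨ : ContMDiff 𝓘(ℝ, E) 𝓘(ℝ, ℝ) ∞ Ψ)
    (g g' : G) (v : E) :
    leftCotangent g (groupDifferential E (fun x => rightTrackingError Ψ x g') g) v =
      leftDifferential E Ψ (g'⁻¹ * g) v := by
  have h1 := leftTangent_translate_ofChart g (chartOrigin_mem (E := E) (G := G)) v
  rw [ofChart_chartOrigin, mul_one, chartLeftTangent_chartOrigin] at h1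
  have d1 : HasMFDerivAt 𝓘(ℝ, E) 𝓘(ℝ, ℝ) (fun x => rightTrackingError Ψ x g')
      (g * ofChart G (chartOrigin E G))
      (mfderiv 𝓘(ℝ, E) 𝓘(ℝ, ℝ) (fun x => rightTrackingError Ψ x g') g) := by
    rw [ofChart_chartOrigin, mul_one]
    exact ((hΨ.comp (contMDiff_leftMul g'⁻¹)).mdifferentiableAt (by simp)).hasMFDerivAt
  have d2 := (mdifferentiableAt_translate_ofChart g
    (chartOrigin_mem (E := E) (G := G))).hasMFDerivAt
  have d3 := d1.comp (chartOrigin E G) d2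
  have d4 := (d3.congr_of_eventuallyEq (f₁ := fun y : E => Ψ (g'⁻¹ * g * ofChart G y))
    (Eventually.of_forall fun y => by simp [rightTrackingError, mul_assoc])).mfderiv
  have d5 : mfderiv 𝓘(ℝ, E) 𝓘(ℝ, ℝ) (fun y : E => Ψ (g'⁻¹ * g * ofChart G y))
      (chartOrigin E G) = leftDifferential E Ψ (g'⁻¹ * g) := by
    rw [mfderiv_eq_fderiv]
    exact (hasFDerivAt_perturbed_right hΨ (g'⁻¹ * g)).fderiv
  have d6 := DFunLike.congr_fun (d4.symm.trans d5) v
  exact (congrArg (mfderiv 𝓘(ℝ, E) 𝓘(ℝ, ℝ) (fun x => rightTrackingError Ψ x g') g) h1).trans d6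

/-- The tangent map of left translation by `h` is onto, being inverted by that of `h⁻¹`, so a
covector vanishing on its image is zero. -/
lemma groupDifferential_eq_zero_of_leftDifferential {Ψ : G → ℝ}
    (hΨ : ContMDiff 𝓘(ℝ, E) 𝓘(ℝ, ℝ) ∞ Ψ) {h : G} (h0 : leftDifferential E Ψ h = 0) :
    groupDifferential E Ψ h = 0 := by
  have d1 : HasMFDerivAt 𝓘(ℝ, E) 𝓘(ℝ, E) (fun x : G => h⁻¹ * x) h
      (mfderiv 𝓘(ℝ, E) 𝓘(ℝ, E) (fun x : G => h⁻¹ * x) h) :=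
    ((contMDiff_leftMul h⁻¹).mdifferentiableAt (by simp)).hasMFDerivAt
  have d2 : HasMFDerivAt 𝓘(ℝ, E) 𝓘(ℝ, E) (fun x : G => h * x) (h⁻¹ * h)
      (mfderiv 𝓘(ℝ, E) 𝓘(ℝ, E) (fun x : G => h * x) 1) := by
    rw [inv_mul_cancel]
    exact ((contMDiff_leftMul h).mdifferentiableAt (by simp)).hasMFDerivAt
  have d3 := (d2.comp h d1).congr_of_eventuallyEq
    (f₁ := id) (Eventually.of_forall fun y => by simp)
  have d4 := d3.mfderiv
  rw [mfderiv_id] at d4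
  ext w
  have h1 := leftCotangent_groupDifferential hΨ h 1
    (mfderiv 𝓘(ℝ, E) 𝓘(ℝ, E) (fun x : G => h⁻¹ * x) h w)
  have e : (fun x : G => rightTrackingError Ψ x 1) = Ψ := by
    ext x; simp [rightTrackingError]
  rw [e, inv_one, one_mul, h0] at h1
  have h2 := DFunLike.congr_fun d4 w
  exact (congrArg (groupDifferential E Ψ h) h2).trans h1

/-- Symmetry of `Ψ` exchanges the two perturbations and replaces `h` by `h⁻¹`, so the derivative in
the second slot is the left differential at the inverse. This is what makes the forces on the two
ends of an edge pair up in the energy balance. -/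
lemma relDifferential_of_symmetric {Ψ : G → ℝ} (hΨ : ContMDiff 𝓘(ℝ, E) 𝓘(ℝ, ℝ) ∞ Ψ)
    (hsymm : ∀ g₁ g₂ : G, Ψ (g₂⁻¹ * g₁) = Ψ (g₁⁻¹ * g₂)) (h : G) (v w : E) :
    relDifferential E Ψ h (v, w) = leftDifferential E Ψ h v + leftDifferential E Ψ h⁻¹ w := by
  have e : (perturbed Ψ h : E × E → ℝ) = perturbed Ψ h⁻¹ ∘ Prod.swap := by
    ext z
    have := hsymm (h * ofChart G z.1) (ofChart G z.2)
    simpa [perturbed, mul_assoc] using this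
  have hd := (differentiableAt_perturbed hΨ h⁻¹
    (z := Prod.swap (chartOrigin E G, chartOrigin E G))
    ⟨chartOrigin_mem, chartOrigin_mem⟩).hasFDerivAt
  have h1 : relDifferential E Ψ h = (relDifferential E Ψ h⁻¹).comp
      (ContinuousLinearEquiv.prodComm ℝ E E : E × E →L[ℝ] E × E) := by
    rw [relDifferential, e]
    exact (hd.comp _ (ContinuousLinearEquiv.prodComm ℝ E E).hasFDerivAt).fderiv
  have h2 : relDifferential E Ψ h (0, w) = leftDifferential E Ψ h⁻¹ w := by
    rw [h1]; rfl
  rw [← h2, leftDifferential_apply, ← map_add]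
  simp

/-- `Ψ` in the chart at the identity is smooth. -/
lemma contDiffAt_comp_ofChart {Ψ : G → ℝ} (hΨ : ContMDiff 𝓘(ℝ, E) 𝓘(ℝ, ℝ) ∞ Ψ) {x : E}
    (hx : x ∈ chartDomain E G) : ContDiffAt ℝ ∞ (fun y => Ψ (ofChart G y)) x :=
  contMDiffAt_iff_contDiffAt.mp (hΨ.contMDiffAt.comp x (contMDiffAt_ofChart hx))

lemma leftDifferential_ofChart {Ψ : G → ℝ} (hΨ : ContMDiff 𝓘(ℝ, E) 𝓘(ℝ, ℝ) ∞ Ψ) {x : E}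
    (hx : x ∈ chartDomain E G) :
    leftDifferential E Ψ (ofChart G x) =
      (fderiv ℝ (fun y => Ψ (ofChart G y)) x).comp (chartLeftTangent G x) := by
  have d1 : HasFDerivAt (fun y => Ψ (ofChart G y)) (fderiv ℝ (fun y => Ψ (ofChart G y)) x)
      (chartMul G x (chartOrigin E G)) := by
    rw [chartMul_chartOrigin_right hx]
    exact ((contDiffAt_comp_ofChart hΨ hx).differentiableAt (by simp)).hasFDerivAt
  have d2 := d1.comp (chartOrigin E G) (differentiableAt_chartMul hx).hasFDerivAt
  refine (hasFDerivAt_perturbed_right hΨ (ofChart G x)).unique (d2.congr_of_eventuallyEq ?_)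
  have h1 : Tendsto (fun y => ofChart G x * ofChart G y) (𝓝 (chartOrigin E G))
      (𝓝 (ofChart G x)) := by
    have : ContinuousAt (fun y : E => ofChart G x * ofChart G y) (chartOrigin E G) :=
      (mdifferentiableAt_translate_ofChart (ofChart G x) chartOrigin_mem).continuousAt
    simpa [ContinuousAt, ofChart_chartOrigin] using this
  filter_upwards [h1.eventually ((chartAt E (1 : G)).open_source.mem_nhds
    (ofChart_mem_source hx))] with y hy
  simp [chartMul, ofChart_toChart hy]

/-- Near the identity an error function is comparable with the squared norm of its differential,
which vanishes only at the identity. -/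
lemma IsErrorFunction.local_estimates [FiniteDimensional ℝ E] {Ψ : G → ℝ}
    (hΨ : IsErrorFunction E Ψ) :
    ∃ C, ∀ᶠ h in 𝓝 (1 : G), Ψ h ≤ C * ‖leftDifferential E Ψ h‖ ^ 2 ∧
      ‖leftDifferential E Ψ h‖ ^ 2 ≤ C * Ψ h ∧ (h ≠ 1 → leftDifferential E Ψ h ≠ 0) := by
  have hs := hΨ.smooth
  have hψ := contDiffAt_comp_ofChart hs (chartOrigin_mem (E := E) (G := G))
  have hd0 : fderiv ℝ (fun y => Ψ (ofChart G y)) (chartOrigin E G) = 0 := by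
    have h1 := leftDifferential_ofChart hs (chartOrigin_mem (E := E) (G := G))
    rw [chartLeftTangent_chartOrigin, ContinuousLinearMap.comp_id] at h1
    rw [← h1]
    ext v
    have h2 := leftCotangent_groupDifferential hs (1 : G) 1 v
    have e : (fun x : G => rightTrackingError Ψ x 1) = Ψ := by
      ext x; simp [rightTrackingError]
    rw [e, hΨ.differential_one, inv_one, one_mul] at h2
    rw [ofChart_chartOrigin]
    exact h2.symm
  obtain ⟨c, hc, C, hC, hq⟩ := quadratic_estimates_of_hessian_pos
    (hψ.of_le ENat.LEInfty.out) (by simp [ofChart_chartOrigin, hΨ.map_one]) hd0 hΨ.hessian_one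
  -- Within `1/2` of the identity, left trivialization changes norms of covectors by a factor of at
  -- most two.
  have hA : ∀ᶠ x in 𝓝 (chartOrigin E G),
      ‖chartLeftTangent G x - ContinuousLinearMap.id ℝ E‖ < 1 / 2 := by
    have := (contDiffAt_chartLeftTangent (chartOrigin_mem (E := E) (G := G))).continuousAt
    rw [ContinuousAt, chartLeftTangent_chartOrigin] at this
    simpa [dist_eq_norm] using (Metric.tendsto_nhds.mp this) (1 / 2) (by norm_num)
  have hto : Tendsto (toChart E : G → E) (𝓝 1) (𝓝 (chartOrigin E G)) :=
    (contMDiffAt_toChart (mem_chart_source E (1 : G))).continuousAt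
  -- With `f` the norm of the left differential and `n` the coordinate distance, the first summand
  -- comes from `c n ≤ 2 f` and `Ψ ≤ C n²`, the second from `f ≤ 2 C n` and `c n² ≤ Ψ`.
  refine ⟨4 * C / c ^ 2 + 4 * C ^ 2 / c, ?_⟩
  filter_upwards [hto.eventually hq, hto.eventually hA, source_mem_nhds_one (E := E)]
    with h hqh hAh hsrc
  have hx := toChart_mem_chartDomain hsrc
  obtain ⟨x, hxd⟩ : ∃ x, x = toChart E h := ⟨_, rfl⟩
  have hh : ofChart G x = h := by rw [hxd, ofChart_toChart hsrc]
  rw [← hxd] at hqh hAh hx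
  have hf := leftDifferential_ofChart hs hx
  rw [hh] at hf hqh
  obtain ⟨q1, q2, q3, q4⟩ := hqh
  set L := fderiv ℝ (fun y => Ψ (ofChart G y)) x
  have hdiff : ‖L.comp (chartLeftTangent G x) - L‖ ≤ ‖L‖ * (1 / 2) := by
    have e : L.comp (chartLeftTangent G x) - L =
        L.comp (chartLeftTangent G x - ContinuousLinearMap.id ℝ E) := by ext; simp
    rw [e]
    exact (L.opNorm_comp_le _).trans (by gcongr)
  have hlow : ‖L‖ ≤ 2 * ‖leftDifferential E Ψ h‖ := by
    have := norm_sub_norm_le L (L.comp (chartLeftTangent G x))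
    rw [norm_sub_rev, ← hf] at this
    rw [← hf] at hdiff
    linarith
  have hup : ‖leftDifferential E Ψ h‖ ≤ 2 * ‖L‖ := by
    have := norm_sub_norm_le (L.comp (chartLeftTangent G x)) L
    rw [← hf] at this hdiff
    linarith [norm_nonneg L]
  set n := ‖x - chartOrigin E G‖ with hn
  have hn0 : 0 ≤ n := norm_nonneg _
  set f := ‖leftDifferential E Ψ h‖ with hfdef
  have hf0 : 0 ≤ f := norm_nonneg _
  have hl : c * n ≤ 2 * f := q3.trans hlow
  have hu : f ≤ 2 * C * n := by nlinarith
  have hPsi := hΨ.nonneg h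
  refine ⟨?_, ?_, ?_⟩
  · have h1 : c ^ 2 * n ^ 2 ≤ 4 * f ^ 2 := by nlinarith [mul_nonneg hc.le hn0]
    have h2 : C * n ^ 2 ≤ 4 * C / c ^ 2 * f ^ 2 := by
      rw [div_mul_eq_mul_div, le_div_iff₀ (by positivity)]
      nlinarith
    have h3 : 0 ≤ 4 * C ^ 2 / c * f ^ 2 := by positivity
    rw [add_mul]
    linarith
  · have h1 : f ^ 2 ≤ 4 * C ^ 2 * n ^ 2 := by nlinarith [mul_nonneg hC.le hn0]
    have h2 : 4 * C ^ 2 * n ^ 2 ≤ 4 * C ^ 2 / c * Ψ h := by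
      rw [div_mul_eq_mul_div, le_div_iff₀ hc]
      nlinarith [sq_nonneg C]
    have h3 : 0 ≤ 4 * C / c ^ 2 * Ψ h := by positivity
    rw [add_mul]
    linarith
  · intro hne hzero
    have hf' : f = 0 := by rw [hfdef, hzero, norm_zero]
    have hn' : n = 0 := by
      rw [hf'] at hl
      nlinarith
    rw [hn, norm_eq_zero, sub_eq_zero] at hn'
    exact hne (by rw [← hh, hn', ofChart_chartOrigin])

end Gradient

/-! ### Recovering edge quantities from vertex sums on a tree. -/

section TreeEstimates

variable {V : Type*} {𝒢 : SimpleGraph V}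

/-- In a tree, a vertex has at most one neighbour closer to a given root. -/
lemma SimpleGraph.IsTree.eq_of_adj_of_dist_eq (h : 𝒢.IsTree) (r : V) {i j k : V}
    (hij : 𝒢.Adj i j) (hik : 𝒢.Adj i k) (hj : 𝒢.dist r i = 𝒢.dist r j + 1)
    (hk : 𝒢.dist r i = 𝒢.dist r k + 1) : j = k := by
  have key : ∀ l, 𝒢.Adj i l → 𝒢.dist r i = 𝒢.dist r l + 1 →
      ∃ p : 𝒢.Walk i r, p.IsPath ∧ p.snd = l := by
    intro l hl hd
    obtain ⟨p, hp⟩ := h.connected.exists_walk_length_eq_dist l r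
    refine ⟨SimpleGraph.Walk.cons hl p, SimpleGraph.Walk.isPath_of_length_eq_dist _ ?_, by simp⟩
    rw [SimpleGraph.Walk.length_cons, hp, SimpleGraph.dist_comm, ← hd, SimpleGraph.dist_comm]
  obtain ⟨p, hp, rfl⟩ := key j hij hj
  obtain ⟨q, hq, rfl⟩ := key k hik hk
  rw [(h.existsUnique_path i r).unique hp hq]

/-- On a tree, edge quantities which are comparable under reversal are controlled by the sums over
the edges at each vertex. -/
lemma SimpleGraph.IsTree.exists_norm_edge_le [Fintype V] [DecidableRel 𝒢.Adj] (h : 𝒢.IsTree)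
    (F : Type*) [NormedAddCommGroup F] [NormedSpace ℝ F] {C : ℝ} (hC : 0 ≤ C) :
    ∃ C' ≥ 0, ∀ x : V → V → F, (∀ i j, 𝒢.Adj i j → ‖x j i‖ ≤ C * ‖x i j‖) →
      ∀ m, (∀ i, ‖∑ j, 𝒢.adjMatrix ℝ i j • x i j‖ ≤ m) →
        ∀ i j, 𝒢.Adj i j → ‖x i j‖ ≤ C' * m := by
  classical
  obtain ⟨r⟩ := h.connected.nonempty
  obtain ⟨N, hN⟩ : ∃ N, ∀ i, 𝒢.dist r i < N :=
    ⟨Finset.univ.sup (𝒢.dist r) + 1, fun i => Nat.lt_succ_of_le (Finset.le_sup (Finset.mem_univ i))⟩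
  -- Induction from the deepest vertices towards the root `r`. At a vertex `i` with parent `j`, all
  -- other edges lead to children and are already bounded, up to reversal, so the vertex sum bounds
  -- the remaining edge. For `d = 0` no vertex is deep enough.
  have step : ∀ d : ℕ, ∃ C' ≥ 0, ∀ x : V → V → F, (∀ i j, 𝒢.Adj i j → ‖x j i‖ ≤ C * ‖x i j‖) →
      ∀ m, (∀ i, ‖∑ j, 𝒢.adjMatrix ℝ i j • x i j‖ ≤ m) →
        ∀ i j, 𝒢.Adj i j → 𝒢.dist r i = 𝒢.dist r j + 1 → N ≤ 𝒢.dist r i + d →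
          ‖x i j‖ ≤ C' * m := by
    intro d
    induction d with
    | zero =>
      refine ⟨0, le_rfl, fun x _ m _ i j _ _ hd => ?_⟩
      have := hN i
      omega
    | succ d ih =>
      obtain ⟨C₁, hC₁, ih⟩ := ih
      refine ⟨1 + Fintype.card V * (C * C₁), by positivity, fun x hx m hm i j hij hd hNd => ?_⟩
      have hm0 : 0 ≤ m := (norm_nonneg _).trans (hm i)
      have hsplit : x i j = (∑ k, 𝒢.adjMatrix ℝ i k • x i k) -
          ∑ k ∈ Finset.univ.erase j, 𝒢.adjMatrix ℝ i k • x i k := by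
        rw [← Finset.add_sum_erase _ _ (Finset.mem_univ j)]
        simp [SimpleGraph.adjMatrix_apply, hij]
      have hother : ‖∑ k ∈ Finset.univ.erase j, 𝒢.adjMatrix ℝ i k • x i k‖ ≤
          Fintype.card V * (C * C₁ * m) := by
        refine (norm_sum_le_of_le (f := fun k => 𝒢.adjMatrix ℝ i k • x i k)
          (n := fun _ => C * C₁ * m) _ fun k hk => ?_).trans ?_
        · by_cases hik : 𝒢.Adj i k
          · have hki : 𝒢.dist r k = 𝒢.dist r i + 1 := by
              rcases h.dist_eq_dist_add_one_of_adj r hik with h1 | h1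
              · exact absurd (h.eq_of_adj_of_dist_eq r hik hij h1 hd) (Finset.ne_of_mem_erase hk)
              · exact h1
            have h1 := ih x hx m hm k i hik.symm hki (by omega)
            have h2 := hx k i hik.symm
            rw [SimpleGraph.adjMatrix_apply, if_pos hik, one_smul, mul_assoc]
            exact h2.trans (by gcongr)
          · rw [SimpleGraph.adjMatrix_apply, if_neg hik, zero_smul, norm_zero]
            positivity
        · rw [Finset.sum_const, nsmul_eq_mul]
          gcongr
          exact Finset.card_le_univ _
      rw [hsplit]
      refine (norm_sub_le _ _).trans ((add_le_add (hm i) hother).trans ?_)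
      linarith
  obtain ⟨C', hC', hb⟩ := step N
  -- Edges pointing towards the root cost `C'`; those pointing away need one more reversal, which
  -- costs `C`.
  refine ⟨C' + C * C', by positivity, fun x hx m hm i j hij => ?_⟩
  have hm0 : 0 ≤ m := (norm_nonneg _).trans (hm i)
  have hCm : 0 ≤ C' * m := by positivity
  rcases h.dist_eq_dist_add_one_of_adj r hij with h1 | h1
  · have := hb x hx m hm i j hij h1 (by omega)
    nlinarith [mul_nonneg hC hCm]
  · have := (hx j i hij.symm).trans
      (mul_le_mul_of_nonneg_left (hb x hx m hm j i hij.symm h1 (by omega)) hC)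
    nlinarith

end TreeEstimates

/-! ### The reduced closed-loop system and its energy balance. -/

section ConsensusSystems

/-- The data of the closed-loop consensus system, with the kinetic energy tensor as a continuous
bilinear form and the dissipation and potential forces expressed as elements of the Lie algebra. -/
structure ConsensusData (E : Type*) [NormedAddCommGroup E] [NormedSpace ℝ E]
    (G : Type*) [TopologicalSpace G] [ChartedSpace E G] [Group G] (n : ℕ) where
  graph : SimpleGraph (Fin n)
  dec : DecidableRel graph.Adj
  isTree : graph.IsTree
  metric : E →L[ℝ] E →L[ℝ] ℝ
  metric_symm : ∀ v w, metric v w = metric w v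
  metric_pos : ∀ v, v ≠ 0 → 0 < metric v v
  damping : E →L[ℝ] E
  damping_pos : ∀ v, v ≠ 0 → 0 < metric (damping v) v
  potential : G → ℝ
  isErrorFunction : IsErrorFunction E potential
  gradient : G → E
  contMDiff_gradient : ContMDiff 𝓘(ℝ, E) 𝓘(ℝ, E) ∞ gradient
  metric_gradient : ∀ h v, metric (gradient h) v = leftDifferential E potential h v
  gain : ℝ
  gain_pos : 0 < gain
  weight : Fin n → ℝ
  weight_pos : ∀ i, 0 < weight i

namespace ConsensusData

attribute [instance] ConsensusData.dec

variable {E : Type*} [NormedAddCommGroup E] [NormedSpace ℝ E]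
  {G : Type*} [TopologicalSpace G] [ChartedSpace E G] [Group G] {n : ℕ}
  (S : ConsensusData E G n)

/-- Entries of the adjacency matrix. -/
def adj (i j : Fin n) : ℝ := S.graph.adjMatrix ℝ i j

lemma adj_comm (i j : Fin n) : S.adj i j = S.adj j i := by
  simp [adj, SimpleGraph.adjMatrix_apply, S.graph.adj_comm]

lemma adj_eq_one {i j : Fin n} (h : S.graph.Adj i j) : S.adj i j = 1 := by
  simp [adj, SimpleGraph.adjMatrix_apply, h]

lemma adj_eq_zero {i j : Fin n} (h : ¬ S.graph.Adj i j) : S.adj i j = 0 := by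
  simp [adj, SimpleGraph.adjMatrix_apply, h]

lemma adj_nonneg (i j : Fin n) : 0 ≤ S.adj i j := by
  by_cases h : S.graph.Adj i j
  · simp [S.adj_eq_one h]
  · simp [S.adj_eq_zero h]

/-- The sum of the potential gradients acting on each agent. -/
def force (g : Fin n → G) (i : Fin n) : E := ∑ j, S.adj i j • S.gradient ((g j)⁻¹ * g i)

/-- The closed-loop acceleration. -/
def acceleration (g : Fin n → G) (v : Fin n → E) (i : Fin n) : E :=
  -((1 / S.weight i) • (S.damping (v i) + S.gain • S.force g i))

/-- The closed-loop energy. -/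
def energy (g : Fin n → G) (v : Fin n → E) : ℝ :=
  S.gain / 2 * ∑ i, ∑ j, S.adj i j * S.potential ((g j)⁻¹ * g i) +
    1 / 2 * ∑ i, S.weight i * S.metric (v i) (v i)

/-- The pairing of forces and momenta. -/
def cross (g : Fin n → G) (v : Fin n → E) : ℝ := ∑ i, S.weight i * S.metric (S.force g i) (v i)

/-- Solutions of the closed-loop equations on a set of times. -/
structure IsSolution (γ : ℝ → Fin n → G) (v : ℝ → Fin n → E) (s : Set ℝ) : Prop where
  pos : ∀ t ∈ s, ∀ i, HasMFDerivWithinAt 𝓘(ℝ, ℝ) 𝓘(ℝ, E) (fun τ => γ τ i) s t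
    ((1 : ℝ →L[ℝ] ℝ).smulRight (leftTangent (E := E) (γ t i) (v t i)))
  vel : ∀ t ∈ s, ∀ i, HasDerivWithinAt (fun τ => v τ i) (S.acceleration (γ t) (v t) i) s t

/-- Configurations whose relative positions along edges lie in `D`. -/
def region (D : Set G) : Set (Fin n → G) := {g | ∀ i j, S.graph.Adj i j → (g j)⁻¹ * g i ∈ D}

variable {S}

lemma weight_smul_acceleration (g : Fin n → G) (v : Fin n → E) (i : Fin n) :
    S.weight i • S.acceleration g v i = -(S.damping (v i) + S.gain • S.force g i) := by
  rw [acceleration, smul_neg, smul_smul, mul_one_div_cancel (S.weight_pos i).ne', one_smul]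

lemma metric_force (g : Fin n → G) (i : Fin n) (w : E) :
    S.metric (S.force g i) w =
      ∑ j, S.adj i j * leftDifferential E S.potential ((g j)⁻¹ * g i) w := by
  simp [force, map_sum, S.metric_gradient]

lemma metric_nonneg (w : E) : 0 ≤ S.metric w w := by
  by_cases hw : w = 0
  · simp [hw]
  · exact (S.metric_pos w hw).le

lemma energy_nonneg (g : Fin n → G) (v : Fin n → E) : 0 ≤ S.energy g v := by
  have h1 := S.gain_pos
  have h3 : 0 ≤ ∑ i, ∑ j, S.adj i j * S.potential ((g j)⁻¹ * g i) :=
    Finset.sum_nonneg fun i _ => Finset.sum_nonneg fun j _ =>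
      mul_nonneg (S.adj_nonneg i j) (S.isErrorFunction.nonneg _)
  have h4 : 0 ≤ ∑ i, S.weight i * S.metric (v i) (v i) :=
    Finset.sum_nonneg fun i _ => mul_nonneg (S.weight_pos i).le (metric_nonneg _)
  rw [energy]
  positivity

/-- The potential along an edge is controlled by the energy. -/
lemma gain_mul_potential_le_energy (g : Fin n → G) (v : Fin n → E) {i j : Fin n}
    (hij : S.graph.Adj i j) : S.gain * S.potential ((g j)⁻¹ * g i) ≤ S.energy g v := by
  have h1 := S.gain_pos
  have hnn : ∀ i j, 0 ≤ S.adj i j * S.potential ((g j)⁻¹ * g i) := fun i j =>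
    mul_nonneg (S.adj_nonneg i j) (S.isErrorFunction.nonneg _)
  have hrow : ∀ i j, S.adj i j * S.potential ((g j)⁻¹ * g i) ≤
      ∑ k, S.adj i k * S.potential ((g k)⁻¹ * g i) := fun i j =>
    Finset.single_le_sum (f := fun k => S.adj i k * S.potential ((g k)⁻¹ * g i))
      (fun k _ => hnn i k) (Finset.mem_univ j)
  -- An edge contributes in both orientations, equally by symmetry of the potential, which cancels
  -- the factor `1/2` in the energy. This doubling is the source of the strict room below the
  -- critical threshold.
  have h2 : S.adj i j * S.potential ((g j)⁻¹ * g i) + S.adj j i * S.potential ((g i)⁻¹ * g j) ≤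
      ∑ i, ∑ j, S.adj i j * S.potential ((g j)⁻¹ * g i) := by
    refine (add_le_add (hrow i j) (hrow j i)).trans ?_
    exact Finset.add_le_sum (f := fun i => ∑ k, S.adj i k * S.potential ((g k)⁻¹ * g i))
      (fun i _ => Finset.sum_nonneg fun k _ => hnn i k) (Finset.mem_univ i) (Finset.mem_univ j)
      hij.ne
  rw [S.adj_eq_one hij, S.adj_eq_one hij.symm, S.isErrorFunction.symmetric (g j) (g i)] at h2
  have h4 : 0 ≤ ∑ i, S.weight i * S.metric (v i) (v i) :=
    Finset.sum_nonneg fun i _ => mul_nonneg (S.weight_pos i).le (metric_nonneg _)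
  rw [energy]
  nlinarith

variable [LieGroup 𝓘(ℝ, E) ∞ G]

/-- Energy is dissipated by the damping only. -/
lemma IsSolution.hasDerivWithinAt_energy {γ : ℝ → Fin n → G} {v : ℝ → Fin n → E} {s : Set ℝ}
    (h : S.IsSolution γ v s) {t : ℝ} (ht : t ∈ s) :
    HasDerivWithinAt (fun τ => S.energy (γ τ) (v τ))
      (-∑ i, S.metric (S.damping (v t i)) (v t i)) s t := by
  have hs := S.isErrorFunction.smooth
  have d1 : HasDerivWithinAt (fun τ => S.gain / 2 * ∑ i, ∑ j, S.adj i j *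
      S.potential ((γ τ j)⁻¹ * γ τ i)) (S.gain / 2 * ∑ i, ∑ j, S.adj i j *
        relDifferential E S.potential ((γ t j)⁻¹ * γ t i) (v t i, v t j)) s t :=
    (HasDerivWithinAt.fun_sum fun i _ => HasDerivWithinAt.fun_sum fun j _ =>
      (hasDerivWithinAt_comp_relative hs (h.pos t ht i) (h.pos t ht j)).const_mul _).const_mul _
  have d2 : HasDerivWithinAt (fun τ => 1 / 2 * ∑ i, S.weight i * S.metric (v τ i) (v τ i))
      (1 / 2 * ∑ i, S.weight i * (S.metric (S.acceleration (γ t) (v t) i) (v t i) +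
        S.metric (v t i) (S.acceleration (γ t) (v t) i))) s t := by
    refine (HasDerivWithinAt.fun_sum fun i _ => HasDerivWithinAt.const_mul _ ?_).const_mul _
    have hv := h.vel t ht i
    exact (S.metric.hasFDerivAt.comp_hasDerivWithinAt t hv).clm_apply hv
  refine (d1.add d2).congr_deriv ?_
  -- Each edge derivative splits into a term for each endpoint; exchanging the summation indices
  -- identifies the two sums. The resulting force terms cancel against those from the kinetic
  -- energy.
  have e1 : ∑ i, ∑ j, S.adj i j *
      relDifferential E S.potential ((γ t j)⁻¹ * γ t i) (v t i, v t j) =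
      2 * ∑ i, S.metric (S.force (γ t) i) (v t i) := by
    have e2 : ∀ i j, relDifferential E S.potential ((γ t j)⁻¹ * γ t i) (v t i, v t j) =
        leftDifferential E S.potential ((γ t j)⁻¹ * γ t i) (v t i) +
        leftDifferential E S.potential ((γ t i)⁻¹ * γ t j) (v t j) := by
      intro i j
      rw [relDifferential_of_symmetric hs S.isErrorFunction.symmetric]
      simp
    simp only [e2, mul_add, Finset.sum_add_distrib, metric_force]
    rw [two_mul]
    congr 1
    rw [Finset.sum_comm]
    refine Finset.sum_congr rfl fun i _ => Finset.sum_congr rfl fun j _ => ?_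
    rw [S.adj_comm]
  have e3 : ∀ i, S.weight i * (S.metric (S.acceleration (γ t) (v t) i) (v t i) +
        S.metric (v t i) (S.acceleration (γ t) (v t) i)) =
      -2 * S.metric (S.damping (v t i)) (v t i) -
        2 * S.gain * S.metric (S.force (γ t) i) (v t i) := by
    intro i
    rw [S.metric_symm (v t i), ← two_mul, mul_left_comm, ← smul_eq_mul (a := S.weight i),
      ← smul_apply, ← map_smul, weight_smul_acceleration]
    simp
    ring
  rw [e1, Finset.sum_congr rfl fun i _ => e3 i, Finset.sum_sub_distrib, ← Finset.mul_sum,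
    ← Finset.mul_sum]
  ring

/-- The acceleration contains the force, so pairing forces with momenta yields the negative square
of the force that the energy derivative lacks. The other terms are quadratic in the velocities or
mixed. -/
lemma IsSolution.hasDerivWithinAt_cross {γ : ℝ → Fin n → G} {v : ℝ → Fin n → E} {s : Set ℝ}
    (h : S.IsSolution γ v s) {t : ℝ} (ht : t ∈ s) :
    HasDerivWithinAt (fun τ => S.cross (γ τ) (v τ))
      (∑ i, (S.weight i * S.metric (∑ j, S.adj i j •
          relDifferential E S.gradient ((γ t j)⁻¹ * γ t i) (v t i, v t j)) (v t i) -
        S.metric (S.force (γ t) i) (S.damping (v t i)) -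
        S.gain * S.metric (S.force (γ t) i) (S.force (γ t) i))) s t := by
  refine HasDerivWithinAt.fun_sum fun i _ => ?_
  have d1 : HasDerivWithinAt (fun τ => S.force (γ τ) i) (∑ j, S.adj i j •
      relDifferential E S.gradient ((γ t j)⁻¹ * γ t i) (v t i, v t j)) s t :=
    HasDerivWithinAt.fun_sum fun j _ =>
      (hasDerivWithinAt_comp_relative S.contMDiff_gradient
        (h.pos t ht i) (h.pos t ht j)).const_smul _
  have d2 := ((S.metric.hasFDerivAt.comp_hasDerivWithinAt t d1).clm_apply
    (h.vel t ht i)).const_mul (S.weight i)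
  refine d2.congr_deriv ?_
  rw [mul_add, sub_sub, sub_eq_add_neg]
  congr 1
  rw [← smul_eq_mul (a := S.weight i), Function.comp_apply, ← map_smul, weight_smul_acceleration]
  simp

end ConsensusData
end ConsensusSystems

/-! ### Comparison of energy, velocities and forces in regular regions. -/

namespace ConsensusData

variable {E : Type*} [NormedAddCommGroup E] [NormedSpace ℝ E] [FiniteDimensional ℝ E]
  {G : Type*} [TopologicalSpace G] [ChartedSpace E G] [Group G] {n : ℕ}
  {S : ConsensusData E G n}

variable (S) in
/-- A compact set without critical points of the potential other than the identity. -/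
structure IsRegular (D : Set G) : Prop where
  isCompact : IsCompact D
  gradient_ne_zero : ∀ h ∈ D, h ≠ 1 → S.gradient h ≠ 0

variable (S) in
lemma exists_metric_lower : ∃ c > 0, ∀ w, c * ‖w‖ ^ 2 ≤ S.metric w w :=
  exists_pos_mul_norm_sq_le (by fun_prop) (fun r w => by simp; ring) S.metric_pos

variable (S) in
lemma exists_damping_lower : ∃ c > 0, ∀ w, c * ‖w‖ ^ 2 ≤ S.metric (S.damping w) w :=
  exists_pos_mul_norm_sq_le (by fun_prop) (fun r w => by simp; ring) S.damping_pos

lemma norm_sq_le_sum {q : E → ℝ} {c : ℝ} (hc : 0 < c) (hq : ∀ w, c * ‖w‖ ^ 2 ≤ q w)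
    (v : Fin n → E) : c * ‖v‖ ^ 2 ≤ ∑ i, q (v i) := by
  have hq0 : ∀ w, 0 ≤ q w := fun w => le_trans (by positivity) (hq w)
  have hs : 0 ≤ (∑ i, q (v i)) / c := div_nonneg (Finset.sum_nonneg fun i _ => hq0 _) hc.le
  have h1 : ‖v‖ ≤ Real.sqrt ((∑ i, q (v i)) / c) := by
    rw [pi_norm_le_iff_of_nonneg (Real.sqrt_nonneg _)]
    intro i
    apply Real.le_sqrt_of_sq_le
    rw [le_div_iff₀ hc, mul_comm]
    exact (hq _).trans (Finset.single_le_sum (f := fun i => q (v i)) (fun j _ => hq0 _)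
      (Finset.mem_univ i))
  have h2 := (Real.le_sqrt (norm_nonneg _) hs).mp h1
  rw [le_div_iff₀ hc] at h2
  linarith

variable (S) in
/-- The velocities are controlled by the energy. -/
lemma exists_norm_sq_le_energy : ∃ C > 0, ∀ (g : Fin n → G) (v : Fin n → E),
    ‖v‖ ^ 2 ≤ C * S.energy g v := by
  obtain ⟨c, hc, hcw⟩ := S.exists_metric_lower
  obtain ⟨a, ha, haw⟩ : ∃ a > 0, ∀ i, a ≤ S.weight i := by
    rcases isEmpty_or_nonempty (Fin n) with h | h
    · exact ⟨1, one_pos, fun i => h.elim i⟩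
    · obtain ⟨i, hi⟩ := Finite.exists_min S.weight
      exact ⟨S.weight i, S.weight_pos i, hi⟩
  refine ⟨2 / (a * c), by positivity, fun g v => ?_⟩
  have h1 := norm_sq_le_sum hc hcw v
  have h2 : a * ∑ i, S.metric (v i) (v i) ≤ ∑ i, S.weight i * S.metric (v i) (v i) := by
    rw [Finset.mul_sum]
    exact Finset.sum_le_sum fun i _ => mul_le_mul_of_nonneg_right (haw i) (metric_nonneg _)
  have h3 : 0 ≤ S.gain / 2 * ∑ i, ∑ j, S.adj i j * S.potential ((g j)⁻¹ * g i) :=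
    mul_nonneg (half_pos S.gain_pos).le (Finset.sum_nonneg fun i _ => Finset.sum_nonneg fun j _ =>
      mul_nonneg (S.adj_nonneg i j) (S.isErrorFunction.nonneg _))
  rw [div_mul_eq_mul_div, le_div_iff₀ (by positivity), energy]
  nlinarith

variable [LieGroup 𝓘(ℝ, E) ∞ G]

lemma gradient_eq_zero_iff {h : G} :
    S.gradient h = 0 ↔ leftDifferential E S.potential h = 0 := by
  constructor
  · intro h0
    ext v
    rw [← S.metric_gradient, h0]
    simp
  · intro h0
    by_contra hne
    have := S.metric_pos _ hne
    rw [S.metric_gradient, h0] at this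
    simp at this

/-- A zero of a nonnegative function is a minimum. Hence a regular set contains no zero of the
potential besides possibly the identity. -/
lemma gradient_eq_zero_of_potential_eq_zero {h : G} (h0 : S.potential h = 0) :
    S.gradient h = 0 := by
  rw [gradient_eq_zero_iff]
  refine IsLocalMin.hasFDerivAt_eq_zero (f := fun y : E => S.potential (h * ofChart G y)) ?_
    (hasFDerivAt_perturbed_right S.isErrorFunction.smooth h)
  refine Eventually.of_forall fun y => ?_
  simp only [ofChart_chartOrigin, mul_one, h0]
  exact S.isErrorFunction.nonneg _

lemma potential_inv (h : G) : S.potential h⁻¹ = S.potential h := by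
  simpa using S.isErrorFunction.symmetric 1 h

variable (S) in
-- The metric identifies the gradient with the left differential up to norm equivalence, so the
-- local estimates carry over with adjusted constants.
lemma gradient_local_estimates : ∃ C ≥ 0, ∀ᶠ h in 𝓝 (1 : G),
    S.potential h ≤ C * ‖S.gradient h‖ ^ 2 ∧ ‖S.gradient h‖ ^ 2 ≤ C * S.potential h ∧
      (h ≠ 1 → S.gradient h ≠ 0) := by
  obtain ⟨C, hC⟩ := S.isErrorFunction.local_estimates
  obtain ⟨c, hc, hcw⟩ := S.exists_metric_lower
  have up : ∀ h, ‖leftDifferential E S.potential h‖ ≤ ‖S.metric‖ * ‖S.gradient h‖ := by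
    intro h
    have e : leftDifferential E S.potential h = S.metric (S.gradient h) := by
      ext v; rw [S.metric_gradient]
    rw [e]
    exact S.metric.le_opNorm _
  have low : ∀ h, c * ‖S.gradient h‖ ≤ ‖leftDifferential E S.potential h‖ := by
    intro h
    by_cases hw : S.gradient h = 0
    · simp [hw]
    · have h1 := hcw (S.gradient h)
      rw [S.metric_gradient] at h1
      have h2 := h1.trans ((le_abs_self _).trans ((leftDifferential E S.potential h).le_opNorm _))
      rw [pow_two, ← mul_assoc] at h2
      exact le_of_mul_le_mul_right h2 (norm_pos_iff.mpr hw)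
  refine ⟨|C| * ‖S.metric‖ ^ 2 + |C| / c ^ 2, by positivity, ?_⟩
  filter_upwards [hC] with h hh
  obtain ⟨h1, h2, h3⟩ := hh
  have hP := S.isErrorFunction.nonneg h
  have hCa := le_abs_self C
  refine ⟨?_, ?_, fun hne h0 => h3 hne (gradient_eq_zero_iff.mp h0)⟩
  · have e1 : ‖leftDifferential E S.potential h‖ ^ 2 ≤ ‖S.metric‖ ^ 2 * ‖S.gradient h‖ ^ 2 := by
      rw [← mul_pow]; gcongr; exact up h
    have e2 : 0 ≤ |C| / c ^ 2 * ‖S.gradient h‖ ^ 2 := by positivity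
    have e3 : C * ‖leftDifferential E S.potential h‖ ^ 2 ≤
        |C| * (‖S.metric‖ ^ 2 * ‖S.gradient h‖ ^ 2) :=
      mul_le_mul hCa e1 (by positivity) (abs_nonneg C)
    nlinarith
  · have e1 : c ^ 2 * ‖S.gradient h‖ ^ 2 ≤ ‖leftDifferential E S.potential h‖ ^ 2 := by
      rw [← mul_pow]; gcongr; exact low h
    have e2 : 0 ≤ |C| * ‖S.metric‖ ^ 2 * S.potential h := by positivity
    have e3 : C * S.potential h ≤ |C| * S.potential h := mul_le_mul_of_nonneg_right hCa hP
    have e4 : ‖S.gradient h‖ ^ 2 ≤ |C| / c ^ 2 * S.potential h := by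
      rw [div_mul_eq_mul_div, le_div_iff₀ (by positivity)]
      linarith
    rw [add_mul]
    linarith

/-- On a regular compact set, the potential and the squared norm of its gradient are comparable,
and so are the gradients at inverse points. -/
lemma IsRegular.exists_estimates {D : Set G} (hD : S.IsRegular D) : ∃ C > 0, ∀ h ∈ D,
    S.potential h ≤ C * ‖S.gradient h‖ ^ 2 ∧ ‖S.gradient h‖ ^ 2 ≤ C * S.potential h ∧
      ‖S.gradient h⁻¹‖ ≤ C * ‖S.gradient h‖ := by
  obtain ⟨C₀, hC₀, hloc⟩ := S.gradient_local_estimates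
  have hgc : Continuous S.gradient := S.contMDiff_gradient.continuous
  have hg2 : Continuous fun h => ‖S.gradient h‖ ^ 2 := hgc.norm.pow 2
  have hpc : Continuous S.potential := S.isErrorFunction.smooth.continuous
  have hinv : Continuous fun h : G => h⁻¹ := (contMDiff_inv 𝓘(ℝ, E) ∞).continuous
  have hgpos : ∀ h ∈ D, h ≠ 1 → 0 < ‖S.gradient h‖ ^ 2 := fun h hh hne =>
    pow_pos (norm_pos_iff.mpr (hD.gradient_ne_zero h hh hne)) 2
  have hppos : ∀ h ∈ D, h ≠ 1 → 0 < S.potential h := fun h hh hne =>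
    (S.isErrorFunction.nonneg h).lt_of_ne fun h0 =>
      hD.gradient_ne_zero h hh hne (gradient_eq_zero_of_potential_eq_zero h0.symm)
  obtain ⟨C₁, hC₁, h₁⟩ := exists_le_mul_of_isCompact hD.isCompact hpc hg2
    (fun _ => by positivity) hgpos ⟨C₀, hloc.mono fun h hh => hh.1⟩
  obtain ⟨C₂, hC₂, h₂⟩ := exists_le_mul_of_isCompact hD.isCompact hg2 hpc
    S.isErrorFunction.nonneg hppos ⟨C₀, hloc.mono fun h hh => hh.2.1⟩
  -- The potential is invariant under inversion, so near the identity `‖∇Ψ(h⁻¹)‖² ≤ C₀ Ψ(h⁻¹) = C₀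
  -- Ψ(h) ≤ C₀² ‖∇Ψ(h)‖²`. The set `D` need not be closed under inversion.
  obtain ⟨C₃, hC₃, h₃⟩ := exists_le_mul_of_isCompact hD.isCompact
    (hg2.comp hinv) hg2 (fun _ => by positivity) hgpos
    ⟨C₀ * C₀, by
      have hi : Tendsto (fun h : G => h⁻¹) (𝓝 1) (𝓝 1) := by simpa using hinv.tendsto (1 : G)
      filter_upwards [hloc, hi.eventually hloc] with h hh hh'
      have e1 := hh'.2.1
      rw [potential_inv] at e1
      refine e1.trans ?_
      rw [mul_assoc]
      exact mul_le_mul_of_nonneg_left hh.1 hC₀⟩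
  refine ⟨max (max C₁ C₂) (Real.sqrt C₃), lt_max_of_lt_left (lt_max_of_lt_left hC₁),
    fun h hh => ⟨(h₁ h hh).trans ?_, (h₂ h hh).trans ?_, ?_⟩⟩
  · gcongr; exact (le_max_left _ _).trans (le_max_left _ _)
  · exact mul_le_mul_of_nonneg_right ((le_max_right _ _).trans (le_max_left _ _))
      (S.isErrorFunction.nonneg h)
  · have e : ‖S.gradient h⁻¹‖ ≤ Real.sqrt C₃ * ‖S.gradient h‖ := by
      refine abs_le_of_sq_le_sq' ?_ (by positivity) |>.2
      rw [mul_pow, Real.sq_sqrt hC₃.le]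
      exact h₃ h hh
    refine e.trans ?_
    gcongr
    exact le_max_right _ _

/-- In a regular region the energy is controlled by velocities and forces. -/
lemma IsRegular.exists_energy_le {D : Set G} (hD : S.IsRegular D) : ∃ C > 0,
    ∀ (g : Fin n → G) (v : Fin n → E), g ∈ S.region D →
      S.energy g v ≤ C * (‖v‖ ^ 2 + ‖S.force g‖ ^ 2) := by
  obtain ⟨C, hC, hest⟩ := hD.exists_estimates
  obtain ⟨C', hC', htree⟩ := S.isTree.exists_norm_edge_le E hC.le
  set B := ∑ i, S.weight i with hB
  have hB0 : 0 ≤ B := Finset.sum_nonneg fun i _ => (S.weight_pos i).le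
  have hgain := S.gain_pos
  refine ⟨S.gain / 2 * (n * (n * (C * C' ^ 2))) + 1 / 2 * (B * ‖S.metric‖) + 1, by positivity,
    fun g v hg => ?_⟩
  have hedge : ∀ i j, S.adj i j * S.potential ((g j)⁻¹ * g i) ≤ C * C' ^ 2 * ‖S.force g‖ ^ 2 := by
    intro i j
    by_cases hij : S.graph.Adj i j
    · rw [S.adj_eq_one hij, one_mul]
      -- Reversing an edge inverts the relative position, so the third estimate is the comparability
      -- under reversal that the tree lemma asks for; its vertex sums are the forces.
      have h1 := htree (fun i j => S.gradient ((g j)⁻¹ * g i)) (fun i j hij => by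
        simpa using (hest _ (hg i j hij)).2.2) ‖S.force g‖
          (fun i => norm_le_pi_norm (S.force g) i) i j hij
      refine (hest _ (hg i j hij)).1.trans ?_
      rw [mul_assoc, ← mul_pow]
      gcongr
    · rw [S.adj_eq_zero hij, zero_mul]
      positivity
  have h1 : ∑ i, ∑ j, S.adj i j * S.potential ((g j)⁻¹ * g i) ≤
      n * (n * (C * C' ^ 2 * ‖S.force g‖ ^ 2)) := by
    refine (Finset.sum_le_sum fun i _ => Finset.sum_le_sum fun j _ => hedge i j).trans ?_
    simp
  have h2 : ∑ i, S.weight i * S.metric (v i) (v i) ≤ B * (‖S.metric‖ * ‖v‖ ^ 2) := by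
    rw [hB, Finset.sum_mul]
    refine Finset.sum_le_sum fun i _ => mul_le_mul_of_nonneg_left ?_ (S.weight_pos i).le
    refine (le_abs_self _).trans ((S.metric.le_opNorm₂ _ _).trans ?_)
    rw [mul_assoc, ← pow_two]
    gcongr
    exact norm_le_pi_norm v i
  have h3 : 0 ≤ B * ‖S.metric‖ * ‖S.force g‖ ^ 2 := by positivity
  have h4 : 0 ≤ S.gain / 2 * (n * (n * (C * C' ^ 2))) * ‖v‖ ^ 2 := by positivity
  have h5 : 0 ≤ ‖v‖ ^ 2 + ‖S.force g‖ ^ 2 := by positivity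
  have h6 := mul_le_mul_of_nonneg_left h1 (half_pos hgain).le
  rw [energy]
  linarith

/-- In a regular region the forces are controlled by the energy. -/
lemma IsRegular.exists_force_sq_le {D : Set G} (hD : S.IsRegular D) : ∃ C > 0,
    ∀ (g : Fin n → G) (v : Fin n → E), g ∈ S.region D → ‖S.force g‖ ^ 2 ≤ C * S.energy g v := by
  obtain ⟨C, hC, hest⟩ := hD.exists_estimates
  have hgain := S.gain_pos
  refine ⟨n ^ 2 * (C / S.gain) + 1, by positivity, fun g v hg => ?_⟩
  have hW := energy_nonneg (S := S) g v
  set W := S.energy g v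
  have hedge : ∀ i j, ‖S.adj i j • S.gradient ((g j)⁻¹ * g i)‖ ≤ Real.sqrt (C / S.gain * W) := by
    intro i j
    by_cases hij : S.graph.Adj i j
    · rw [S.adj_eq_one hij, one_smul]
      apply Real.le_sqrt_of_sq_le
      refine (hest _ (hg i j hij)).2.1.trans ?_
      rw [div_mul_eq_mul_div, mul_div_assoc]
      gcongr
      rw [le_div_iff₀ hgain, mul_comm]
      exact gain_mul_potential_le_energy g v hij
    · rw [S.adj_eq_zero hij, zero_smul, norm_zero]
      positivity
  have h1 : ‖S.force g‖ ≤ n * Real.sqrt (C / S.gain * W) := by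
    rw [pi_norm_le_iff_of_nonneg (by positivity)]
    intro i
    refine (norm_sum_le_of_le _ fun j _ => hedge i j).trans ?_
    simp
  have h2 : ‖S.force g‖ ^ 2 ≤ (n * Real.sqrt (C / S.gain * W)) ^ 2 := by gcongr
  rw [mul_pow, Real.sq_sqrt (by positivity)] at h2
  nlinarith

variable (S) in
lemma exists_abs_cross_le : ∃ C > 0, ∀ (g : Fin n → G) (v : Fin n → E),
    |S.cross g v| ≤ C * (‖v‖ ^ 2 + ‖S.force g‖ ^ 2) := by
  set B := ∑ i, S.weight i with hB
  have hB0 : 0 ≤ B := Finset.sum_nonneg fun i _ => (S.weight_pos i).le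
  refine ⟨B * ‖S.metric‖ + 1, by positivity, fun g v => ?_⟩
  have h1 : |S.cross g v| ≤ B * (‖S.metric‖ * ‖S.force g‖ * ‖v‖) := by
    rw [hB, Finset.sum_mul]
    refine (Finset.abs_sum_le_sum_abs _ _).trans (Finset.sum_le_sum fun i _ => ?_)
    rw [abs_mul, abs_of_pos (S.weight_pos i)]
    refine mul_le_mul_of_nonneg_left ((S.metric.le_opNorm₂ _ _).trans ?_) (S.weight_pos i).le
    gcongr
    · exact norm_le_pi_norm _ i
    · exact norm_le_pi_norm v i
  have h2 : 0 ≤ B * ‖S.metric‖ := by positivity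
  nlinarith [two_mul_le_add_sq ‖S.force g‖ ‖v‖,
    mul_nonneg (norm_nonneg (S.force g)) (norm_nonneg v)]

end ConsensusData

/-! ### Exponential decay through a strict Lyapunov function, and invariance of regions. -/

/-- Exponential decay from a linear differential inequality. -/
lemma le_mul_exp_of_hasDerivWithinAt_le {V V' : ℝ → ℝ} {r : ℝ}
    (hV : ∀ t ∈ Ici (0 : ℝ), HasDerivWithinAt V (V' t) (Ici 0) t)
    (hle : ∀ t ∈ Ici (0 : ℝ), V' t ≤ -r * V t) {t : ℝ} (ht : 0 ≤ t) :
    V t ≤ V 0 * Real.exp (-(r * t)) := by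
  have hexp : ∀ t : ℝ, HasDerivAt (fun t => Real.exp (r * t)) (Real.exp (r * t) * r) t :=
      fun t => by
    simpa using ((hasDerivAt_id t).const_mul r).exp
  have mono : AntitoneOn (fun t => V t * Real.exp (r * t)) (Ici 0) := by
    refine antitoneOn_of_hasDerivWithinAt_nonpos (convex_Ici 0)
      (fun s hs => ((hV s hs).mul (hexp s).hasDerivWithinAt).continuousWithinAt)
      (fun s hs => ((hV s (interior_subset hs)).mul (hexp s).hasDerivWithinAt).mono
        interior_subset) ?_
    intro s hs
    have := hle s (interior_subset hs)
    have he := Real.exp_pos (r * s)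
    nlinarith
  have := mono (mem_Ici.mpr le_rfl) ht ht
  simp only [mul_zero, Real.exp_zero, mul_one] at this
  rw [Real.exp_neg, ← div_eq_mul_inv, le_div_iff₀ (Real.exp_pos _)]
  exact this

namespace ConsensusData

variable {E : Type*} [NormedAddCommGroup E] [NormedSpace ℝ E] [FiniteDimensional ℝ E]
  {G : Type*} [TopologicalSpace G] [ChartedSpace E G] [Group G] {n : ℕ}
  {S : ConsensusData E G n} [LieGroup 𝓘(ℝ, E) ∞ G]

/-- The derivative of the gradient is bounded on the compact set, so the change of the forces costs
only `‖v‖²`; the mixed damping term is absorbed into half of the negative force term. -/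
lemma IsRegular.exists_cross_deriv_le {D : Set G} (hD : S.IsRegular D) : ∃ C > 0, ∃ k > 0,
    ∀ (g : Fin n → G) (v : Fin n → E), g ∈ S.region D →
      ∑ i, (S.weight i * S.metric (∑ j, S.adj i j •
          relDifferential E S.gradient ((g j)⁻¹ * g i) (v i, v j)) (v i) -
        S.metric (S.force g i) (S.damping (v i)) -
        S.gain * S.metric (S.force g i) (S.force g i)) ≤ C * ‖v‖ ^ 2 - k * ‖S.force g‖ ^ 2 := by
  obtain ⟨M, hM⟩ := hD.isCompact.exists_bound_of_continuousOn
    (contMDiff_relDifferential S.contMDiff_gradient).continuous.continuousOn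
  obtain ⟨c, hc, hcw⟩ := S.exists_metric_lower
  have hM' : ∀ h ∈ D, ‖relDifferential E S.gradient h‖ ≤ |M| := fun h hh =>
    (hM h hh).trans (le_abs_self M)
  have hgain := S.gain_pos
  set B := ∑ i, S.weight i with hB
  have hB0 : 0 ≤ B := Finset.sum_nonneg fun i _ => (S.weight_pos i).le
  set P := ‖S.metric‖ with hP
  have hP0 : 0 ≤ P := norm_nonneg S.metric
  set Q := n * (P * ‖S.damping‖) with hQ
  have hQ0 : 0 ≤ Q := by positivity
  set k := S.gain * c with hk
  have hk0 : 0 < k := by positivity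
  refine ⟨B * (P * (n * |M|)) + Q ^ 2 / (2 * k) + 1, by positivity, k / 2, by positivity,
    fun g v hg => ?_⟩
  have hvi : ∀ i, ‖v i‖ ≤ ‖v‖ := norm_le_pi_norm v
  have hfi : ∀ i, ‖S.force g i‖ ≤ ‖S.force g‖ := norm_le_pi_norm (S.force g)
  have h1 : ∑ i, S.weight i * S.metric (∑ j, S.adj i j •
      relDifferential E S.gradient ((g j)⁻¹ * g i) (v i, v j)) (v i) ≤
      B * (P * (n * |M|)) * ‖v‖ ^ 2 := by
    rw [mul_assoc, hB, Finset.sum_mul]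
    refine Finset.sum_le_sum fun i _ => mul_le_mul_of_nonneg_left ?_ (S.weight_pos i).le
    refine (le_abs_self _).trans ((S.metric.le_opNorm₂ _ _).trans ?_)
    have hs : ‖∑ j, S.adj i j • relDifferential E S.gradient ((g j)⁻¹ * g i) (v i, v j)‖ ≤
        n * (|M| * ‖v‖) := by
      refine (norm_sum_le_of_le (n := fun _ => |M| * ‖v‖) _ fun j _ => ?_).trans (by simp)
      by_cases hij : S.graph.Adj i j
      · rw [S.adj_eq_one hij, one_smul]
        refine (ContinuousLinearMap.le_opNorm _ _).trans ?_
        gcongr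
        · exact hM' _ (hg i j hij)
        · exact max_le (hvi i) (hvi j)
      · rw [S.adj_eq_zero hij, zero_smul, norm_zero]
        positivity
    calc P * ‖∑ j, S.adj i j • relDifferential E S.gradient ((g j)⁻¹ * g i) (v i, v j)‖ * ‖v i‖
        ≤ P * (n * (|M| * ‖v‖)) * ‖v‖ := by gcongr; exact hvi i
      _ = P * (n * |M|) * ‖v‖ ^ 2 := by ring
  have h2 : -∑ i, S.metric (S.force g i) (S.damping (v i)) ≤ Q * (‖S.force g‖ * ‖v‖) := by
    refine (neg_le_abs _).trans ((Finset.abs_sum_le_sum_abs _ _).trans ?_)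
    refine (Finset.sum_le_sum (g := fun _ => P * ‖S.damping‖ * (‖S.force g‖ * ‖v‖))
      fun i _ => ?_).trans (by simp [hQ, mul_assoc])
    refine (S.metric.le_opNorm₂ _ _).trans ?_
    calc P * ‖S.force g i‖ * ‖S.damping (v i)‖
        ≤ P * ‖S.force g‖ * (‖S.damping‖ * ‖v‖) := by
          gcongr
          · exact hfi i
          · exact (S.damping.le_opNorm _).trans (by gcongr; exact hvi i)
      _ = P * ‖S.damping‖ * (‖S.force g‖ * ‖v‖) := by ring
  have h3 : k * ‖S.force g‖ ^ 2 ≤ S.gain * ∑ i, S.metric (S.force g i) (S.force g i) := by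
    rw [hk, mul_assoc]
    exact mul_le_mul_of_nonneg_left (norm_sq_le_sum hc hcw (S.force g)) hgain.le
  -- Young's inequality, weighted so as to spend exactly half of `k`.
  have h4 : Q * (‖S.force g‖ * ‖v‖) ≤ k / 2 * ‖S.force g‖ ^ 2 + Q ^ 2 / (2 * k) * ‖v‖ ^ 2 := by
    have : k / 2 * ‖S.force g‖ ^ 2 + Q ^ 2 / (2 * k) * ‖v‖ ^ 2 - Q * (‖S.force g‖ * ‖v‖) =
        (k * ‖S.force g‖ - Q * ‖v‖) ^ 2 / (2 * k) := by
      field_simp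
      ring
    have h5 : 0 ≤ (k * ‖S.force g‖ - Q * ‖v‖) ^ 2 / (2 * k) := by positivity
    linarith
  rw [Finset.sum_sub_distrib, Finset.sum_sub_distrib, ← Finset.mul_sum]
  nlinarith [sq_nonneg ‖v‖]

lemma IsSolution.antitoneOn_energy {γ : ℝ → Fin n → G} {v : ℝ → Fin n → E} {s : Set ℝ}
    (h : S.IsSolution γ v s) (hs : Convex ℝ s) :
    AntitoneOn (fun t => S.energy (γ t) (v t)) s := by
  refine antitoneOn_of_hasDerivWithinAt_nonpos hs
    (fun t ht => (h.hasDerivWithinAt_energy ht).continuousWithinAt)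
    (fun t ht => (h.hasDerivWithinAt_energy (interior_subset ht)).mono interior_subset) ?_
  intro t _
  refine neg_nonpos.mpr (Finset.sum_nonneg fun i _ => ?_)
  by_cases hw : v t i = 0
  · simp [hw]
  · exact (S.damping_pos _ hw).le

/-- The energy decays exponentially along solutions staying in a regular region. -/
lemma IsRegular.exists_energy_decay {D : Set G} (hD : S.IsRegular D) : ∃ C > 0, ∃ r > 0,
    ∀ (γ : ℝ → Fin n → G) (v : ℝ → Fin n → E), S.IsSolution γ v (Ici 0) →
      (∀ t, 0 ≤ t → γ t ∈ S.region D) → ∀ t, 0 ≤ t →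
        S.energy (γ t) (v t) ≤ C * S.energy (γ 0) (v 0) * Real.exp (-(r * t)) := by
  obtain ⟨C₁, hC₁, h₁⟩ := hD.exists_energy_le
  obtain ⟨C₂, hC₂, h₂⟩ := hD.exists_force_sq_le
  obtain ⟨C₃, hC₃, h₃⟩ := S.exists_norm_sq_le_energy
  obtain ⟨C₄, hC₄, h₄⟩ := S.exists_abs_cross_le
  obtain ⟨C₅, hC₅, k, hk, h₅⟩ := hD.exists_cross_deriv_le
  obtain ⟨d, hd, h₆⟩ := S.exists_damping_lower
  -- The first smallness condition keeps the cross term below half of the energy; the second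
  -- sacrifices only half of the damping to the cross derivative.
  obtain ⟨ε, hε, hε1, hε2⟩ : ∃ ε > 0, ε * (C₄ * (C₂ + C₃)) ≤ 1 / 2 ∧ ε * C₅ ≤ d / 2 := by
    refine ⟨min (1 / 2 / (C₄ * (C₂ + C₃))) (d / 2 / C₅), by positivity, ?_, ?_⟩
    · rw [← le_div_iff₀ (by positivity)]; exact min_le_left _ _
    · rw [← le_div_iff₀ (by positivity)]; exact min_le_right _ _
  set b := min (d / 2) (ε * k) with hb
  have hb0 : 0 < b := by positivity
  have hcross : ∀ (g : Fin n → G) (w : Fin n → E), g ∈ S.region D →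
      |ε * S.cross g w| ≤ 1 / 2 * S.energy g w := by
    intro g w hg
    rw [abs_mul, abs_of_pos hε]
    have e1 := h₄ g w
    have e2 := h₂ g w hg
    have e3 := h₃ g w
    have e4 : |S.cross g w| ≤ C₄ * (C₂ + C₃) * S.energy g w := by nlinarith
    have e5 := energy_nonneg (S := S) g w
    nlinarith [mul_le_mul_of_nonneg_left e4 hε.le, mul_le_mul_of_nonneg_right hε1 e5]
  -- For the modified energy `V`, `W ≤ 2 V` and `V ≤ 2 W` together give the `4`; the rate comes from
  -- `V ≤ 2 W ≤ 2 C₁ (‖v‖² + ‖f‖²)` and `V' ≤ -b (‖v‖² + ‖f‖²)`.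
  refine ⟨4, by norm_num, b / (2 * C₁), by positivity, fun γ v hsol hreg t ht => ?_⟩
  have hder : ∀ t ∈ Ici (0 : ℝ), HasDerivWithinAt
      (fun τ => S.energy (γ τ) (v τ) + ε * S.cross (γ τ) (v τ)) _ (Ici 0) t := fun t ht =>
    (hsol.hasDerivWithinAt_energy ht).add ((hsol.hasDerivWithinAt_cross ht).const_mul ε)
  have key := le_mul_exp_of_hasDerivWithinAt_le (r := b / (2 * C₁)) hder (fun t ht => by
    have e1 := h₅ (γ t) (v t) (hreg t ht)
    have e2 := norm_sq_le_sum (q := fun w => S.metric (S.damping w) w) hd h₆ (v t)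
    have e3 := h₁ (γ t) (v t) (hreg t ht)
    have e4 := abs_le.mp (hcross (γ t) (v t) (hreg t ht))
    have e5 := mul_le_mul_of_nonneg_left e1 hε.le
    have e6 : b * ‖v t‖ ^ 2 ≤ (d / 2) * ‖v t‖ ^ 2 := by gcongr; exact min_le_left _ _
    have e7 : b * ‖S.force (γ t)‖ ^ 2 ≤ ε * k * ‖S.force (γ t)‖ ^ 2 := by
      gcongr; exact min_le_right _ _
    have e8 : b / (2 * C₁) * (S.energy (γ t) (v t) + ε * S.cross (γ t) (v t)) ≤
        b * (‖v t‖ ^ 2 + ‖S.force (γ t)‖ ^ 2) := by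
      rw [div_mul_eq_mul_div, div_le_iff₀ (by positivity)]
      have e9 : S.energy (γ t) (v t) + ε * S.cross (γ t) (v t) ≤ 2 * S.energy (γ t) (v t) := by
        have := energy_nonneg (S := S) (γ t) (v t)
        linarith [e4.2]
      nlinarith
    have e10 : ε * C₅ * ‖v t‖ ^ 2 ≤ d / 2 * ‖v t‖ ^ 2 := by gcongr
    nlinarith) ht
  have e1 := abs_le.mp (hcross (γ t) (v t) (hreg t ht))
  have e2 := abs_le.mp (hcross (γ 0) (v 0) (hreg 0 le_rfl))
  have e3 := energy_nonneg (S := S) (γ 0) (v 0)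
  have e4 := Real.exp_pos (-(b / (2 * C₁) * t))
  have e5 : (S.energy (γ 0) (v 0) + ε * S.cross (γ 0) (v 0)) * Real.exp (-(b / (2 * C₁) * t)) ≤
      2 * S.energy (γ 0) (v 0) * Real.exp (-(b / (2 * C₁) * t)) := by
    gcongr
    linarith [e2.2]
  nlinarith [e1.1]

lemma IsSolution.continuousWithinAt_relative {γ : ℝ → Fin n → G} {v : ℝ → Fin n → E} {s : Set ℝ}
    (h : S.IsSolution γ v s) {t : ℝ} (ht : t ∈ s) (i j : Fin n) :
    ContinuousWithinAt (fun τ => (γ τ j)⁻¹ * γ τ i) s t :=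
  haveI : IsTopologicalGroup G := topologicalGroup_of_lieGroup 𝓘(ℝ, E) ∞
  (h.pos t ht j).continuousWithinAt.inv.mul (h.pos t ht i).continuousWithinAt

/-- If the sublevel set of the potential within `D` avoids the boundary of `D`, then the region is
invariant for sufficiently small energies. -/
lemma IsSolution.mem_region [T2Space G] {D : Set G} (hD : IsCompact D) {c : ℝ}
    (hint : ∀ h ∈ D, S.potential h ≤ c → h ∈ interior D)
    {γ : ℝ → Fin n → G} {v : ℝ → Fin n → E} (h : S.IsSolution γ v (Ici 0))
    (h0 : γ 0 ∈ S.region D) (hc : S.energy (γ 0) (v 0) ≤ S.gain * c) {t : ℝ} (ht : 0 ≤ t) :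
    γ t ∈ S.region D := by
  intro i j hij
  have hpot : ∀ τ ∈ Ici (0 : ℝ), S.potential ((γ τ j)⁻¹ * γ τ i) ≤ c := fun τ hτ => by
    have e1 := gain_mul_potential_le_energy (S := S) (γ τ) (v τ) hij
    have e2 := h.antitoneOn_energy (convex_Ici 0) (mem_Ici.mpr le_rfl) hτ hτ
    exact le_of_mul_le_mul_left (e1.trans (e2.trans hc)) S.gain_pos
  have hcont : ContinuousOn (fun τ => (γ τ j)⁻¹ * γ τ i) (Icc 0 t) := fun τ hτ =>
    (h.continuousWithinAt_relative (mem_Ici.mpr hτ.1) i j).mono Icc_subset_Ici_self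
  have hclosed : IsClosed ((fun τ => (γ τ j)⁻¹ * γ τ i) ⁻¹' D ∩ Icc 0 t) := by
    rw [inter_comm]
    exact hcont.preimage_isClosed_of_isClosed isClosed_Icc hD.isClosed
  -- Continuous induction: the times spent in `D` form a closed set, and at each of them the energy
  -- bound forces the relative position into the interior, so it remains in `D` a little longer.
  have := hclosed.Icc_subset_of_forall_mem_nhdsWithin (h0 i j hij) (fun τ hτ => by
    have h1 : (γ τ j)⁻¹ * γ τ i ∈ interior D := hint _ hτ.1 (hpot τ (mem_Ici.mpr hτ.2.1))
    have h2 := h.continuousWithinAt_relative (mem_Ici.mpr hτ.2.1) i j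
    have h3 := h2.eventually (isOpen_interior.mem_nhds h1)
    have h4 := nhdsWithin_mono τ (s := Ioi τ) (t := Ici 0)
      (fun x hx => mem_Ici.mpr (hτ.2.1.trans (le_of_lt hx))) h3
    filter_upwards [h4] with x hx using (interior_subset : interior D ⊆ D) hx)
  exact this (right_mem_Icc.mpr ht)

end ConsensusData

/-! ### Curves of small or finite length in the group. -/

section Trapping

variable {E : Type*} [NormedAddCommGroup E] [NormedSpace ℝ E]
  {G : Type*} [TopologicalSpace G] [ChartedSpace E G] [Group G]

variable (E G) in
/-- Radii of balls around the origin of the chart at the identity on which left translation has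
tangent map of norm at most two. -/
def IsChartRadius (r : ℝ) : Prop :=
  ∀ x ∈ Metric.closedBall (chartOrigin E G) r, x ∈ chartDomain E G ∧ ‖chartLeftTangent G x‖ ≤ 2

lemma IsChartRadius.mono {r r' : ℝ} (h : IsChartRadius E G r) (hr : r' ≤ r) :
    IsChartRadius E G r' := fun x hx => h x (Metric.closedBall_subset_closedBall hr hx)

variable [LieGroup 𝓘(ℝ, E) ∞ G]

variable (E G) in
lemma exists_isChartRadius : ∃ r > 0, IsChartRadius E G r := by
  have h1 : ∀ᶠ x in 𝓝 (chartOrigin E G), ‖chartLeftTangent G x‖ < 2 := by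
    have hc := (contDiffAt_chartLeftTangent (chartOrigin_mem (E := E) (G := G))).continuousAt.norm
    refine hc.eventually_lt continuousAt_const ?_
    rw [chartLeftTangent_chartOrigin]
    exact ContinuousLinearMap.norm_id_le.trans_lt (by norm_num)
  have h2 := isOpen_chartDomain.mem_nhds (chartOrigin_mem (E := E) (G := G))
  obtain ⟨r, hr, hball⟩ := Metric.nhds_basis_closedBall.mem_iff.mp (inter_mem h1 h2)
  exact ⟨r, hr, fun x hx => ⟨(hball hx).2, le_of_lt (hball hx).1⟩⟩

lemma continuousOn_ofChart : ContinuousOn (ofChart G : E → G) (chartDomain E G) := fun _ hx =>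
  (contMDiffAt_ofChart hx).continuousAt.continuousWithinAt

lemma continuousAt_toChart {g : G} (hg : g ∈ (chartAt E (1 : G)).source) :
    ContinuousAt (toChart E : G → E) g := (contMDiffAt_toChart hg).continuousAt

/-- Displacement in a translated chart is bounded by the length of the left-trivialized velocity. -/
lemma norm_toChart_sub_le {r : ℝ} (hr : IsChartRadius E G r) {c : G} {γ : ℝ → G} {v : ℝ → E}
    {β β' : ℝ → ℝ} {a b : ℝ} (hab : a ≤ b)
    (hγ : ∀ t ∈ Icc a b, HasMFDerivWithinAt 𝓘(ℝ, ℝ) 𝓘(ℝ, E) γ (Ici a) t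
      ((1 : ℝ →L[ℝ] ℝ).smulRight (leftTangent (E := E) (γ t) (v t))))
    (hβ : ∀ t, HasDerivAt β (β' t) t) (hv : ∀ t ∈ Icc a b, ‖v t‖ ≤ β' t)
    (hin : ∀ t ∈ Icc a b, c⁻¹ * γ t ∈ (chartAt E (1 : G)).source ∧
      toChart E (c⁻¹ * γ t) ∈ Metric.closedBall (chartOrigin E G) r) :
    ‖toChart E (c⁻¹ * γ b) - toChart E (c⁻¹ * γ a)‖ ≤ 2 * (β b - β a) := by
  have hd : ∀ t ∈ Icc a b, HasDerivWithinAt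
      (fun τ => toChart E (c⁻¹ * γ τ) - toChart E (c⁻¹ * γ a))
      (chartLeftTangent G (toChart E (c⁻¹ * γ t)) (v t)) (Ici a) t := fun t ht =>
    (hasDerivWithinAt_toChart_translate c (hin t ht).1 (hγ t ht)).sub_const _
  -- Mean value inequality with `β` a primitive of the speed bound; the `2` is the bound on left
  -- translation over a chart radius.
  refine image_norm_le_of_norm_deriv_right_le_deriv_boundary
    (f' := fun t => chartLeftTangent G (toChart E (c⁻¹ * γ t)) (v t))
    (B := fun t => 2 * (β t - β a)) (B' := fun t => 2 * β' t)
    (fun t ht => (hd t ht).continuousWithinAt.mono Icc_subset_Ici_self)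
    (fun t ht => (hd t ⟨ht.1, ht.2.le⟩).mono (Ici_subset_Ici.mpr ht.1)) (by simp)
    (fun t => ((hβ t).sub_const _).const_mul 2) (fun t ht => ?_) (right_mem_Icc.mpr hab)
  have ht' : t ∈ Icc a b := ⟨ht.1, ht.2.le⟩
  refine (ContinuousLinearMap.le_opNorm _ _).trans ?_
  gcongr
  · exact (hr _ (hin t ht').2).2
  · exact hv t ht'

variable [FiniteDimensional ℝ E] [T2Space G]

/-- A curve of small length starting near `c` stays in the translated chart at `c`. -/
lemma toChart_mem_ball_of_length_lt {r : ℝ} (hr : IsChartRadius E G r) {c : G} {γ : ℝ → G}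
    {v : ℝ → E} {β β' : ℝ → ℝ} {a : ℝ}
    (hγ : ∀ t ∈ Ici a, HasMFDerivWithinAt 𝓘(ℝ, ℝ) 𝓘(ℝ, E) γ (Ici a) t
      ((1 : ℝ →L[ℝ] ℝ).smulRight (leftTangent (E := E) (γ t) (v t))))
    (hβ : ∀ t, HasDerivAt β (β' t) t) (hv : ∀ t ∈ Ici a, ‖v t‖ ≤ β' t)
    (ha : c⁻¹ * γ a ∈ (chartAt E (1 : G)).source)
    (hlen : ∀ t ∈ Ici a, ‖toChart E (c⁻¹ * γ a) - chartOrigin E G‖ + 2 * (β t - β a) < r)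
    {t : ℝ} (ht : a ≤ t) :
    c⁻¹ * γ t ∈ (chartAt E (1 : G)).source ∧
      toChart E (c⁻¹ * γ t) ∈ Metric.ball (chartOrigin E G) r := by
  have : IsTopologicalGroup G := topologicalGroup_of_lieGroup 𝓘(ℝ, E) ∞
  have hcont : ContinuousOn (fun t => c⁻¹ * γ t) (Ici a) := fun t ht =>
    continuousWithinAt_const.mul (hγ t ht).continuousWithinAt
  set U : Set G := (chartAt E (1 : G)).source ∩
    (toChart E : G → E) ⁻¹' Metric.ball (chartOrigin E G) r with hU
  have hUo : IsOpen U := ContinuousOn.isOpen_inter_preimage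
    (fun g hg => (continuousAt_toChart hg).continuousWithinAt) (chartAt E (1 : G)).open_source
    Metric.isOpen_ball
  -- `K` is compact, hence closed as `G` is Hausdorff. The first exit point from `U` therefore still
  -- lies in the chart, where the displacement estimate puts it back in `U`.
  set K : Set G := ofChart G '' Metric.closedBall (chartOrigin E G) r with hK
  have hKc : IsClosed K := ((isCompact_closedBall _ _).image_of_continuousOn
    (continuousOn_ofChart.mono fun x hx => (hr x hx).1)).isClosed
  have hUK : U ⊆ K := fun g hg =>
    ⟨toChart E g, Metric.ball_subset_closedBall hg.2, ofChart_toChart hg.1⟩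
  have hKin : ∀ g ∈ K, g ∈ (chartAt E (1 : G)).source ∧
      toChart E g ∈ Metric.closedBall (chartOrigin E G) r := by
    rintro _ ⟨x, hx, rfl⟩
    exact ⟨ofChart_mem_source (hr x hx).1, by rwa [toChart_ofChart (hr x hx).1]⟩
  have haU : c⁻¹ * γ a ∈ U := by
    refine ⟨ha, mem_ball_iff_norm.mpr ?_⟩
    simpa using hlen a (mem_Ici.mpr le_rfl)
  by_contra hout
  have hex : (Icc a t ∩ (fun t => c⁻¹ * γ t) ⁻¹' Uᶜ).Nonempty := ⟨t, ⟨ht, le_rfl⟩, hout⟩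
  have hcomp : IsCompact (Icc a t ∩ (fun t => c⁻¹ * γ t) ⁻¹' Uᶜ) :=
    isCompact_Icc.of_isClosed_subset
      ((hcont.mono Icc_subset_Ici_self).preimage_isClosed_of_isClosed isClosed_Icc
        hUo.isClosed_compl) inter_subset_left
  obtain ⟨b, hb, hmin⟩ := hcomp.exists_isLeast hex
  have hbefore : ∀ s ∈ Ico a b, c⁻¹ * γ s ∈ U := fun s hs => by
    by_contra hsU
    exact absurd (hmin ⟨⟨hs.1, hs.2.le.trans hb.1.2⟩, hsU⟩) (not_le.mpr hs.2)
  have hab : a < b := lt_of_le_of_ne hb.1.1 (by rintro rfl; exact hb.2 haU)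
  have hbK : c⁻¹ * γ b ∈ K := by
    have h1 : Tendsto (fun t => c⁻¹ * γ t) (𝓝[Ico a b] b) (𝓝 (c⁻¹ * γ b)) :=
      (hcont b (mem_Ici.mpr hab.le)).mono (Ico_subset_Icc_self.trans Icc_subset_Ici_self)
    have : (𝓝[Ico a b] b).NeBot := by
      rw [nhdsWithin_Ico_eq_nhdsLT hab]
      infer_instance
    exact hKc.mem_of_tendsto h1 (by
      filter_upwards [self_mem_nhdsWithin] with s hs using hUK (hbefore s hs))
  have hall : ∀ s ∈ Icc a b, c⁻¹ * γ s ∈ K := fun s hs => by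
    rcases hs.2.eq_or_lt with rfl | h
    · exact hbK
    · exact hUK (hbefore s ⟨hs.1, h⟩)
  have hle := norm_toChart_sub_le hr hab.le (fun s hs => hγ s hs.1) hβ (fun s hs => hv s hs.1)
    fun s hs => hKin _ (hall s hs)
  refine hb.2 ⟨(hKin _ hbK).1, mem_ball_iff_norm.mpr ?_⟩
  refine lt_of_le_of_lt ?_ (hlen b hab.le)
  have := norm_add_le (toChart E (c⁻¹ * γ a) - chartOrigin E G)
    (toChart E (c⁻¹ * γ b) - toChart E (c⁻¹ * γ a))
  rw [show toChart E (c⁻¹ * γ a) - chartOrigin E G +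
    (toChart E (c⁻¹ * γ b) - toChart E (c⁻¹ * γ a)) = toChart E (c⁻¹ * γ b) - chartOrigin E G by
    abel] at this
  linarith

/-- A curve of finite length converges. -/
lemma exists_tendsto_of_exp_velocity {γ : ℝ → G} {v : ℝ → E} {B μ : ℝ} (hB : 0 ≤ B) (hμ : 0 < μ)
    (hγ : ∀ t ∈ Ici (0 : ℝ), HasMFDerivWithinAt 𝓘(ℝ, ℝ) 𝓘(ℝ, E) γ (Ici 0) t
      ((1 : ℝ →L[ℝ] ℝ).smulRight (leftTangent (E := E) (γ t) (v t))))
    (hv : ∀ t ∈ Ici (0 : ℝ), ‖v t‖ ≤ B * Real.exp (-(μ * t))) :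
    ∃ g, Tendsto γ atTop (𝓝 g) := by
  obtain ⟨r, hr, hrad⟩ := exists_isChartRadius E G
  have hβ : ∀ t : ℝ, HasDerivAt (fun t => -(B / μ * Real.exp (-(μ * t))))
      (B * Real.exp (-(μ * t))) t := fun t => by
    have h1 : HasDerivAt (fun t : ℝ => -(μ * t)) (-μ) t := by
      simpa using ((hasDerivAt_id t).const_mul (-μ))
    refine ((h1.exp.const_mul (B / μ)).neg).congr_deriv ?_
    field_simp
  have hexp : Tendsto (fun t : ℝ => B / μ * Real.exp (-(μ * t))) atTop (𝓝 0) := by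
    have h1 : Tendsto (fun t : ℝ => -(μ * t)) atTop atBot :=
      tendsto_neg_atTop_atBot.comp (tendsto_id.const_mul_atTop hμ)
    simpa using (Real.tendsto_exp_atBot.comp h1).const_mul (B / μ)
  have hsmall : ∀ δ > 0, ∃ T ≥ 0, ∀ t ≥ T, B / μ * Real.exp (-(μ * t)) < δ := fun δ hδ => by
    obtain ⟨T, hT⟩ := eventually_atTop.mp (hexp.eventually_lt_const hδ)
    exact ⟨max T 0, le_max_right _ _, fun t ht => hT t ((le_max_left _ _).trans ht)⟩
  have hpos : ∀ t : ℝ, 0 ≤ B / μ * Real.exp (-(μ * t)) := fun t => by positivity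
  -- After time `T` the remaining displacement, twice the tail of the speed bound, is less than `r`,
  -- so the whole tail lives in one chart centred at `γ T`.
  obtain ⟨T, hT0, hT⟩ := hsmall (r / 2) (half_pos hr)
  have hγ' : ∀ s ≥ T, ∀ t ∈ Ici s, HasMFDerivWithinAt 𝓘(ℝ, ℝ) 𝓘(ℝ, E) γ (Ici s) t
      ((1 : ℝ →L[ℝ] ℝ).smulRight (leftTangent (E := E) (γ t) (v t))) := fun s hs t ht =>
    (hγ t (hT0.trans (hs.trans ht))).mono (Ici_subset_Ici.mpr (hT0.trans hs))
  have hv' : ∀ t ≥ T, ‖v t‖ ≤ B * Real.exp (-(μ * t)) := fun t ht => hv t (hT0.trans ht)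
  have htrap : ∀ t, T ≤ t → (γ T)⁻¹ * γ t ∈ (chartAt E (1 : G)).source ∧
      toChart E ((γ T)⁻¹ * γ t) ∈ Metric.ball (chartOrigin E G) r := fun t ht =>
    toChart_mem_ball_of_length_lt hrad (hγ' T le_rfl) hβ hv' (by simp) (fun t ht => by
      simp only [inv_mul_cancel, toChart_one, sub_self, norm_zero]
      linarith [hpos t, hT T le_rfl]) ht
  have hcauchy : ∀ s ≥ T, ∀ t ≥ s, ‖toChart E ((γ T)⁻¹ * γ t) - toChart E ((γ T)⁻¹ * γ s)‖ ≤
      2 * (B / μ * Real.exp (-(μ * s))) := fun s hs t ht => by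
    refine (norm_toChart_sub_le hrad ht (fun τ hτ => hγ' s hs τ hτ.1) hβ
      (fun τ hτ => hv' τ (hs.trans hτ.1)) fun τ hτ =>
        ⟨(htrap τ (hs.trans hτ.1)).1,
          Metric.ball_subset_closedBall (htrap τ (hs.trans hτ.1)).2⟩).trans ?_
    linarith [hpos t]
  -- No metric on `G` is needed: the Cauchy property and completeness are used in the model space,
  -- and the limit stays in the closed ball inside the chart domain.
  have hcs : Cauchy (map (fun t => toChart E ((γ T)⁻¹ * γ t)) atTop) := by
    rw [Metric.cauchy_iff]
    refine ⟨inferInstance, fun ε hε => ?_⟩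
    obtain ⟨T', _, hT'⟩ := hsmall (ε / 4) (by positivity)
    refine ⟨_, image_mem_map (Ici_mem_atTop (max T T')), ?_⟩
    have key : ∀ s ∈ Ici (max T T'), ∀ t ∈ Ici (max T T'), s ≤ t →
        ‖toChart E ((γ T)⁻¹ * γ t) - toChart E ((γ T)⁻¹ * γ s)‖ < ε := fun s hs t _ hst => by
      have h1 := hcauchy s ((le_max_left _ _).trans hs) t hst
      have h2 := hT' s ((le_max_right _ _).trans hs)
      linarith
    rintro _ ⟨s, hs, rfl⟩ _ ⟨t, ht, rfl⟩
    rcases le_total s t with h | h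
    · rw [dist_comm, dist_eq_norm]; exact key s hs t ht h
    · rw [dist_eq_norm]; exact key t ht s hs h
  have : CompleteSpace E := FiniteDimensional.complete ℝ E
  obtain ⟨x, hx⟩ := CompleteSpace.complete hcs
  have hx' : Tendsto (fun t => toChart E ((γ T)⁻¹ * γ t)) atTop (𝓝 x) := hx
  have hxmem : x ∈ Metric.closedBall (chartOrigin E G) r :=
    Metric.isClosed_closedBall.mem_of_tendsto hx' (by
      filter_upwards [Ici_mem_atTop T] with t ht using
        Metric.ball_subset_closedBall (htrap t ht).2)
  have hcont := (mdifferentiableAt_translate_ofChart (γ T) (hrad x hxmem).1).continuousAt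
  refine ⟨γ T * ofChart G x, (hcont.tendsto.comp hx').congr' ?_⟩
  filter_upwards [Ici_mem_atTop T] with t ht
  simp [ofChart_toChart (htrap t ht).1]

end Trapping

/-! ### Convergence and stability of consensus. -/

namespace ConsensusData

variable {E : Type*} [NormedAddCommGroup E] [NormedSpace ℝ E] [FiniteDimensional ℝ E]
  {G : Type*} [TopologicalSpace G] [T2Space G] [ChartedSpace E G] [Group G] {n : ℕ}
  {S : ConsensusData E G n} [LieGroup 𝓘(ℝ, E) ∞ G]

/-- Velocities decay exponentially along solutions staying in a regular region. -/
lemma IsRegular.exists_velocity_decay {D : Set G} (hD : S.IsRegular D) : ∃ C > 0, ∃ μ > 0,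
    ∀ (γ : ℝ → Fin n → G) (v : ℝ → Fin n → E), S.IsSolution γ v (Ici 0) →
      (∀ t, 0 ≤ t → γ t ∈ S.region D) → ∀ t, 0 ≤ t →
        ‖v t‖ ≤ C * Real.sqrt (S.energy (γ 0) (v 0)) * Real.exp (-(μ * t)) := by
  obtain ⟨C, hC, r, hr, hdec⟩ := hD.exists_energy_decay
  obtain ⟨C', hC', hvel⟩ := S.exists_norm_sq_le_energy
  refine ⟨Real.sqrt (C' * C), by positivity, r / 2, by positivity, fun γ v hs hreg t ht => ?_⟩
  have hW := energy_nonneg (S := S) (γ 0) (v 0)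
  refine (abs_le_of_sq_le_sq' ?_ (by positivity)).2
  have e1 : Real.exp (-(r / 2 * t)) ^ 2 = Real.exp (-(r * t)) := by
    rw [← Real.exp_nat_mul]; congr 1; push_cast; ring
  rw [mul_pow, mul_pow, Real.sq_sqrt (by positivity), Real.sq_sqrt hW, e1]
  refine (hvel (γ t) (v t)).trans ?_
  have := mul_le_mul_of_nonneg_left (hdec γ v hs hreg t ht) hC'.le
  linarith

/-- Solutions of small energy starting in a regular region converge to a consensus state. -/
lemma IsSolution.exists_tendsto {D : Set G} (hD : S.IsRegular D) {c : ℝ}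
    (hint : ∀ h ∈ D, S.potential h ≤ c → h ∈ interior D)
    {γ : ℝ → Fin n → G} {v : ℝ → Fin n → E} (h : S.IsSolution γ v (Ici 0))
    (h0 : γ 0 ∈ S.region D) (hc : S.energy (γ 0) (v 0) ≤ S.gain * c) :
    ∃ g : Fin n → G, (∀ i j, g i = g j) ∧ Tendsto γ atTop (𝓝 g) ∧ Tendsto v atTop (𝓝 0) := by
  have : IsTopologicalGroup G := topologicalGroup_of_lieGroup 𝓘(ℝ, E) ∞
  have hreg : ∀ t, 0 ≤ t → γ t ∈ S.region D := fun t ht => h.mem_region hD.isCompact hint h0 hc ht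
  obtain ⟨C, hC, μ, hμ, hv⟩ := hD.exists_velocity_decay
  obtain ⟨C', hC', r, hr, hW⟩ := hD.exists_energy_decay
  have hlim : ∀ (a : ℝ) {ν : ℝ}, 0 < ν →
      Tendsto (fun t : ℝ => a * Real.exp (-(ν * t))) atTop (𝓝 0) :=
    fun a ν hν => by
      have h1 : Tendsto (fun t : ℝ => -(ν * t)) atTop atBot :=
        tendsto_neg_atTop_atBot.comp (tendsto_id.const_mul_atTop hν)
      simpa using (Real.tendsto_exp_atBot.comp h1).const_mul a
  have hv0 : Tendsto v atTop (𝓝 0) := by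
    refine squeeze_zero_norm' ?_ (hlim (C * Real.sqrt (S.energy (γ 0) (v 0))) hμ)
    filter_upwards [Ici_mem_atTop 0] with t ht using hv γ v h hreg t ht
  have hγ : ∀ i, ∃ g, Tendsto (fun t => γ t i) atTop (𝓝 g) := fun i =>
    exists_tendsto_of_exp_velocity (B := C * Real.sqrt (S.energy (γ 0) (v 0))) (by positivity) hμ
      (fun t ht => h.pos t ht i)
      (fun t ht => (norm_le_pi_norm (v t) i).trans (hv γ v h hreg t ht))
  choose g hg using hγ
  have hadj : ∀ i j, S.graph.Adj i j → g i = g j := fun i j hij => by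
    have hrel : Tendsto (fun t => (γ t j)⁻¹ * γ t i) atTop (𝓝 ((g j)⁻¹ * g i)) :=
      (hg j).inv.mul (hg i)
    have hmem : (g j)⁻¹ * g i ∈ D := hD.isCompact.isClosed.mem_of_tendsto hrel (by
      filter_upwards [Ici_mem_atTop 0] with t ht using hreg t ht i j hij)
    have hpot : Tendsto (fun t => S.potential ((γ t j)⁻¹ * γ t i)) atTop
        (𝓝 (S.potential ((g j)⁻¹ * g i))) :=
      (S.isErrorFunction.smooth.continuous.tendsto _).comp hrel
    have hpot0 : Tendsto (fun t => S.potential ((γ t j)⁻¹ * γ t i)) atTop (𝓝 0) := by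
      refine squeeze_zero' (Eventually.of_forall fun t => S.isErrorFunction.nonneg _) ?_
        (hlim (C' * S.energy (γ 0) (v 0) / S.gain) hr)
      filter_upwards [Ici_mem_atTop 0] with t ht
      have h1 := gain_mul_potential_le_energy (S := S) (γ t) (v t) hij
      have h2 := hW γ v h hreg t ht
      rw [div_mul_eq_mul_div, le_div_iff₀ S.gain_pos]
      linarith
    -- The limiting relative position lies in the regular set and has zero potential, so it is
    -- critical and must be the identity. Connectedness of the tree then spreads equality to all
    -- agents.
    have hzero := gradient_eq_zero_of_potential_eq_zero (tendsto_nhds_unique hpot hpot0)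
    by_contra hne
    exact hD.gradient_ne_zero _ hmem (fun h1 => hne (inv_mul_eq_one.mp h1).symm) hzero
  refine ⟨g, fun i j => ?_, tendsto_pi_nhds.mpr hg, hv0⟩
  obtain ⟨p⟩ := S.isTree.connected.preconnected i j
  induction p with
  | nil => rfl
  | cons hij _ ih => exact (hadj _ _ hij).trans ih

variable (S) in
/-- A compact neighbourhood of the identity with no other critical points, and a level whose
sublevel set avoids its boundary. -/
lemma exists_isRegular : ∃ D, S.IsRegular D ∧ D ∈ 𝓝 (1 : G) ∧ ∃ c > 0,
    ∀ h ∈ D, S.potential h ≤ c → h ∈ interior D := by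
  obtain ⟨r₀, hr₀, hrad⟩ := exists_isChartRadius E G
  obtain ⟨C, _, hloc⟩ := S.gradient_local_estimates
  have hof : ContinuousAt (ofChart G : E → G) (chartOrigin E G) :=
    (contMDiffAt_ofChart chartOrigin_mem).continuousAt
  rw [ContinuousAt, ofChart_chartOrigin] at hof
  obtain ⟨r₁, hr₁, hball⟩ := Metric.nhds_basis_closedBall.mem_iff.mp (hof.eventually hloc)
  set r := min r₀ r₁ with hrdef
  have hr : 0 < r := lt_min hr₀ hr₁
  have hrad' := hrad.mono (min_le_left r₀ r₁)
  set D : Set G := ofChart G '' Metric.closedBall (chartOrigin E G) r with hDdef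
  have hcomp : IsCompact D := (isCompact_closedBall _ _).image_of_continuousOn
    (continuousOn_ofChart.mono fun x hx => (hrad' x hx).1)
  have hreg : S.IsRegular D := by
    refine ⟨hcomp, ?_⟩
    rintro _ ⟨x, hx, rfl⟩ hne
    exact (hball (Metric.closedBall_subset_closedBall (min_le_right _ _) hx)).2.2 hne
  have hnhds : D ∈ 𝓝 (1 : G) := by
    have h1 : Tendsto (toChart E : G → E) (𝓝 1) (𝓝 (chartOrigin E G)) :=
      continuousAt_toChart (mem_chart_source E (1 : G))
    filter_upwards [h1.eventually (Metric.closedBall_mem_nhds _ hr),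
      eventually_ofChart_toChart (E := E)] with h hh hh' using ⟨toChart E h, hh, hh'⟩
  refine ⟨D, hreg, hnhds, ?_⟩
  -- The potential is positive on this compact boundary; half its minimum there serves as the level
  -- `c`, or any positive number if the boundary is empty.
  have hcomp' : IsCompact (D \ interior D) := hcomp.diff isOpen_interior
  have hpos : ∀ h ∈ D \ interior D, 0 < S.potential h := fun h hh =>
    (S.isErrorFunction.nonneg h).lt_of_ne fun h0 => hreg.gradient_ne_zero h hh.1
      (by rintro rfl; exact hh.2 (mem_interior_iff_mem_nhds.mpr hnhds))
      (gradient_eq_zero_of_potential_eq_zero h0.symm)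
  rcases (D \ interior D).eq_empty_or_nonempty with hemp | hne
  · refine ⟨1, one_pos, fun h hh _ => ?_⟩
    by_contra hni
    exact (hemp ▸ (⟨hh, hni⟩ : h ∈ D \ interior D) : h ∈ (∅ : Set G))
  · obtain ⟨a, ha, hmin⟩ := hcomp'.exists_isMinOn hne
      S.isErrorFunction.smooth.continuous.continuousOn
    refine ⟨S.potential a / 2, half_pos (hpos a ha), fun h hh hle => ?_⟩
    by_contra hni
    have h1 : S.potential a ≤ S.potential h := hmin ⟨hh, hni⟩
    linarith [hpos a ha]

lemma continuous_energy : Continuous fun p : (Fin n → G) × (Fin n → E) => S.energy p.1 p.2 := by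
  have : IsTopologicalGroup G := topologicalGroup_of_lieGroup 𝓘(ℝ, E) ∞
  have hp := S.isErrorFunction.smooth.continuous
  unfold energy
  fun_prop

lemma energy_eq_zero_of_consensus {g : Fin n → G} (hg : ∀ i j, g i = g j) :
    S.energy g 0 = 0 := by
  simp [energy, fun i j => (inv_mul_eq_one.mpr (hg i j)), S.isErrorFunction.map_one]

lemma isOpen_region {U : Set G} (hU : IsOpen U) : IsOpen (S.region U) := by
  have : IsTopologicalGroup G := topologicalGroup_of_lieGroup 𝓘(ℝ, E) ∞
  simp only [region, ofPred_forall]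
  refine isOpen_iInter_of_finite fun i => isOpen_iInter_of_finite fun j =>
    isOpen_iInter_of_finite fun _ => hU.preimage ?_
  fun_prop

/-- States from which solutions converge to consensus. -/
lemma exists_attracting_nhds : ∃ W : Set ((Fin n → G) × (Fin n → E)), IsOpen W ∧
    (∀ g : Fin n → G, (∀ i j, g i = g j) → (g, 0) ∈ W) ∧
    ∀ (γ : ℝ → Fin n → G) (v : ℝ → Fin n → E), S.IsSolution γ v (Ici 0) → (γ 0, v 0) ∈ W →
      ∃ g : Fin n → G, (∀ i j, g i = g j) ∧ Tendsto γ atTop (𝓝 g) ∧ Tendsto v atTop (𝓝 0) := by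
  obtain ⟨D, hD, hD1, c, hc, hint⟩ := S.exists_isRegular
  have hgc : 0 < S.gain * c := mul_pos S.gain_pos hc
  -- Low energy alone is not enough: the potential may be small outside `D` as well, so the initial
  -- relative positions are placed in `interior D` separately.
  refine ⟨{p | S.energy p.1 p.2 < S.gain * c} ∩ {p | p.1 ∈ S.region (interior D)},
    (isOpen_lt continuous_energy continuous_const).inter
      ((isOpen_region isOpen_interior).preimage continuous_fst), fun g hg => ⟨?_, ?_⟩, ?_⟩
  · simpa [energy_eq_zero_of_consensus hg] using hgc
  · intro i j _
    simpa [hg i j] using mem_interior_iff_mem_nhds.mpr hD1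
  · intro γ v hs h0
    exact hs.exists_tendsto hD hint (fun i j hij => interior_subset (h0.2 i j hij))
      (le_of_lt h0.1)

/-- Every consensus state is Lyapunov stable. -/
lemma consensus_stable {g : Fin n → G} (hg : ∀ i j, g i = g j)
    {U : Set ((Fin n → G) × (Fin n → E))} (hU : U ∈ 𝓝 (g, 0)) :
    ∃ W ∈ 𝓝 ((g, 0) : (Fin n → G) × (Fin n → E)),
      ∀ (γ : ℝ → Fin n → G) (v : ℝ → Fin n → E), S.IsSolution γ v (Ici 0) → (γ 0, v 0) ∈ W →
        ∀ t, 0 ≤ t → (γ t, v t) ∈ U := by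
  have : IsTopologicalGroup G := topologicalGroup_of_lieGroup 𝓘(ℝ, E) ∞
  obtain ⟨D, hD, hD1, c, hc, hint⟩ := S.exists_isRegular
  obtain ⟨C, hC, μ, hμ, hdec⟩ := hD.exists_velocity_decay
  have hgc : 0 < S.gain * c := mul_pos S.gain_pos hc
  rw [nhds_prod_eq, nhds_pi] at hU
  obtain ⟨U₁, hU₁, U₂, hU₂, hUU⟩ := mem_prod_iff.mp hU
  obtain ⟨I, hI, V, hV, hVU⟩ := mem_pi.mp hU₁
  obtain ⟨η, hη, hηU⟩ := Metric.mem_nhds_iff.mp hU₂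
  obtain ⟨r₀, hr₀, hrad⟩ := exists_isChartRadius E G
  have hchart : ∀ᶠ x in 𝓝 (chartOrigin E G), ∀ i, g i * ofChart G x ∈ V i := by
    rw [eventually_all]
    intro i
    have h1 := (mdifferentiableAt_translate_ofChart (g i)
      (chartOrigin_mem (E := E) (G := G))).continuousAt
    rw [ContinuousAt, ofChart_chartOrigin, mul_one] at h1
    exact h1.eventually (hV i)
  obtain ⟨r₁, hr₁, hball⟩ := Metric.eventually_nhds_iff_ball.mp hchart
  set r := min r₀ r₁ with hrdef
  have hr : 0 < r := lt_min hr₀ hr₁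
  have hrad' := hrad.mono (min_le_left r₀ r₁)
  have hsqrt : Continuous fun p : (Fin n → G) × (Fin n → E) =>
      C * Real.sqrt (S.energy p.1 p.2) := continuous_const.mul continuous_energy.sqrt
  have hnear : ∀ᶠ p in 𝓝 ((g, 0) : (Fin n → G) × (Fin n → E)), ∀ i,
      (g i)⁻¹ * p.1 i ∈ (chartAt E (1 : G)).source ∧
        toChart E ((g i)⁻¹ * p.1 i) ∈ Metric.ball (chartOrigin E G) (r / 2) := by
    rw [eventually_all]
    intro i
    have h1 : Tendsto (fun p : (Fin n → G) × (Fin n → E) => (g i)⁻¹ * p.1 i) (𝓝 (g, 0))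
        (𝓝 1) := by
      have : Continuous fun p : (Fin n → G) × (Fin n → E) => (g i)⁻¹ * p.1 i := by fun_prop
      simpa using this.tendsto (g, 0)
    have h2 : Tendsto (toChart E : G → E) (𝓝 1) (𝓝 (chartOrigin E G)) :=
      continuousAt_toChart (mem_chart_source E (1 : G))
    exact (h1.eventually (source_mem_nhds_one (E := E))).and
      ((h2.comp h1).eventually (Metric.ball_mem_nhds _ (half_pos hr)))
  have hE0 := energy_eq_zero_of_consensus (S := S) hg
  -- The bound `η` keeps the velocities in the prescribed ball. The bound `μ * (r / 4)` keeps the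
  -- total displacement `2 B / μ` below `r / 2`, which together with a start within `r / 2` traps
  -- each agent in the chart ball of radius `r`.
  refine ⟨{p | S.energy p.1 p.2 < S.gain * c} ∩ {p | p.1 ∈ S.region (interior D)} ∩
    {p | C * Real.sqrt (S.energy p.1 p.2) < min η (μ * (r / 4))} ∩ {p | ∀ i,
      (g i)⁻¹ * p.1 i ∈ (chartAt E (1 : G)).source ∧
        toChart E ((g i)⁻¹ * p.1 i) ∈ Metric.ball (chartOrigin E G) (r / 2)}, ?_, ?_⟩
  · refine inter_mem (inter_mem (inter_mem ?_ ?_) ?_) hnear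
    · exact (isOpen_lt continuous_energy continuous_const).mem_nhds (by
        simpa [hE0] using hgc)
    · refine ((isOpen_region isOpen_interior).preimage continuous_fst).mem_nhds ?_
      intro i j _
      simpa [hg i j] using mem_interior_iff_mem_nhds.mpr hD1
    · refine (isOpen_lt hsqrt continuous_const).mem_nhds ?_
      simp only [mem_ofPred_eq, hE0, Real.sqrt_zero, mul_zero]
      positivity
  · rintro γ v hs ⟨⟨⟨hw1, hw2⟩, hw3⟩, hw4⟩ t ht
    have hreg : ∀ t, 0 ≤ t → γ t ∈ S.region D := fun t ht =>
      hs.mem_region hD.isCompact hint (fun i j hij => interior_subset (hw2 i j hij))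
        (le_of_lt hw1) ht
    have hv := hdec γ v hs hreg
    have hw3' : C * Real.sqrt (S.energy (γ 0) (v 0)) < min η (μ * (r / 4)) := hw3
    set B := C * Real.sqrt (S.energy (γ 0) (v 0)) with hB
    have hB0 : 0 ≤ B := by positivity
    refine hUU ⟨hVU fun i _ => ?_, hηU ?_⟩
    · have hβ : ∀ t : ℝ, HasDerivAt (fun t => -(B / μ * Real.exp (-(μ * t))))
          (B * Real.exp (-(μ * t))) t := fun t => by
        have h1 : HasDerivAt (fun t : ℝ => -(μ * t)) (-μ) t := by
          simpa using ((hasDerivAt_id t).const_mul (-μ))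
        refine ((h1.exp.const_mul (B / μ)).neg).congr_deriv ?_
        field_simp
      have hlen : B / μ < r / 4 := by
        rw [div_lt_iff₀ hμ, mul_comm]
        exact hw3'.trans_le (min_le_right _ _)
      have htrap := toChart_mem_ball_of_length_lt hrad' (c := g i) (a := 0)
        (fun t ht => hs.pos t ht i) hβ
        (fun t ht => (norm_le_pi_norm (v t) i).trans (hv t ht)) (hw4 i).1 (fun t _ => by
          have h1 := mem_ball_iff_norm.mp (hw4 i).2
          have h2 : 0 ≤ B / μ * Real.exp (-(μ * t)) := by positivity
          simp only [mul_zero, neg_zero, Real.exp_zero, mul_one]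
          linarith) ht
      have h1 := hball _ (Metric.ball_subset_ball (min_le_right r₀ r₁) htrap.2) i
      rwa [ofChart_toChart htrap.1, mul_inv_cancel_left] at h1
    · rw [mem_ball_zero_iff]
      refine (hv t ht).trans_lt (lt_of_le_of_lt ?_ (hw3'.trans_le (min_le_left _ _)))
      refine mul_le_of_le_one_right hB0 (Real.exp_le_one_iff.mpr ?_)
      have := mul_nonneg hμ.le ht
      linarith

end ConsensusData

/-! ### Global existence of solutions. -/

/-- The Picard–Lindelöf theorem for an autonomous equation, with a solution staying in the ball. -/
lemma exists_solution_mem_closedBall {Z : Type*} [NormedAddCommGroup Z] [NormedSpace ℝ Z]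
    [CompleteSpace Z] {Y : Z → Z} {z₀ : Z} {r L K ε : NNReal}
    (hb : ∀ z ∈ Metric.closedBall z₀ r, ‖Y z‖ ≤ L)
    (hl : LipschitzOnWith K Y (Metric.closedBall z₀ r)) (hε : L * ε ≤ r) :
    ∃ z : ℝ → Z, z 0 = z₀ ∧ (∀ t, z t ∈ Metric.closedBall z₀ r) ∧
      ∀ t ∈ Icc (0 : ℝ) ε, HasDerivWithinAt z (Y (z t)) (Icc 0 ε) t := by
  have hf : IsPicardLindelof (fun _ => Y) (⟨0, le_rfl, ε.2⟩ : Icc (0 : ℝ) ε) z₀ r 0 L K :=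
    IsPicardLindelof.of_time_independent hb hl (by
      rw [sub_zero, sub_self, max_eq_left (by exact ε.2), NNReal.coe_zero, sub_zero]
      exact_mod_cast hε)
  -- The fixed point of the Picard operator is kept explicit because membership in its function
  -- space confines the curve to the ball, the only place where the field is controlled.
  obtain ⟨α, hα⟩ := ODE.FunSpace.exists_isFixedPt_next hf (Metric.mem_closedBall_self le_rfl)
  refine ⟨α.compProj, ?_, fun t => α.compProj_mem_closedBall hf.mul_max_le, fun t ht => ?_⟩
  · have : α.compProj ((⟨0, le_rfl, ε.2⟩ : Icc (0 : ℝ) ε) : ℝ) = z₀ := by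
      rw [ODE.FunSpace.compProj_val, ← hα, ODE.FunSpace.next_apply₀]
    exact this
  · apply ODE.hasDerivWithinAt_picard_Icc (⟨0, le_rfl, ε.2⟩ : Icc (0 : ℝ) ε).2
      hf.continuousOn_uncurry α.continuous_compProj.continuousOn
      (fun _ _ => α.compProj_mem_closedBall hf.mul_max_le) z₀ ht |>.congr_of_mem _ ht
    intro t' ht'
    nth_rw 1 [← hα]
    rw [ODE.FunSpace.compProj_of_mem ht', ODE.FunSpace.next_apply]

namespace ConsensusData

variable {E : Type*} [NormedAddCommGroup E] [NormedSpace ℝ E]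
  {G : Type*} [TopologicalSpace G] [ChartedSpace E G] [Group G] {n : ℕ}
  {S : ConsensusData E G n}

lemma IsSolution.congr {γ γ' : ℝ → Fin n → G} {v v' : ℝ → Fin n → E} {s : Set ℝ}
    (h : S.IsSolution γ v s) (hγ : ∀ t ∈ s, γ' t = γ t) (hv : ∀ t ∈ s, v' t = v t) :
    S.IsSolution γ' v' s where
  pos t ht i := by
    rw [hγ t ht, hv t ht]
    exact (h.pos t ht i).congr_of_eventuallyEq
      (eventually_nhdsWithin_of_forall fun τ hτ => congrFun (hγ τ hτ) i) (congrFun (hγ t ht) i)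
  vel t ht i := by
    rw [hγ t ht, hv t ht]
    exact (h.vel t ht i).congr (fun τ hτ => congrFun (hv τ hτ) i) (congrFun (hv t ht) i)

lemma IsSolution.shift {γ : ℝ → Fin n → G} {v : ℝ → Fin n → E} {ε : ℝ}
    (h : S.IsSolution γ v (Icc 0 ε)) (a : ℝ) :
    S.IsSolution (fun t => γ (t - a)) (fun t => v (t - a)) (Icc a (a + ε)) where
  pos t ht i := by
    have ht' : t - a ∈ Icc 0 ε := ⟨by linarith [ht.1], by linarith [ht.2]⟩
    have hmaps : Icc a (a + ε) ⊆ (fun t => t - a) ⁻¹' Icc 0 ε := fun s hs =>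
      ⟨by linarith [hs.1], by linarith [hs.2]⟩
    have hd : HasMFDerivWithinAt 𝓘(ℝ, ℝ) 𝓘(ℝ, ℝ) (fun t : ℝ => t - a) (Icc a (a + ε)) t
        (ContinuousLinearMap.id ℝ ℝ : ℝ →L[ℝ] ℝ) :=
      hasMFDerivWithinAt_iff_hasFDerivWithinAt.mpr
        ((hasFDerivWithinAt_id t (Icc a (a + ε))).sub_const a)
    exact ((h.pos (t - a) ht' i).comp t hd hmaps).congr_mfderiv (by ext; rfl)
  vel t ht i := by
    have ht' : t - a ∈ Icc 0 ε := ⟨by linarith [ht.1], by linarith [ht.2]⟩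
    have hmaps : MapsTo (fun t => t - a) (Icc a (a + ε)) (Icc 0 ε) := fun s hs =>
      ⟨by linarith [hs.1], by linarith [hs.2]⟩
    have hd := ((hasDerivWithinAt_id t (Icc a (a + ε))).sub_const a)
    exact ((h.vel (t - a) ht' i).scomp t hd hmaps).congr_deriv (one_smul ℝ _)

lemma IsSolution.union_Icc {γ : ℝ → Fin n → G} {v : ℝ → Fin n → E} {a b c : ℝ}
    (h₁ : S.IsSolution γ v (Icc a b)) (h₂ : S.IsSolution γ v (Icc b c)) (hab : a ≤ b)
    (hbc : b ≤ c) : S.IsSolution γ v (Icc a c) := by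
  have hleft : ∀ t ∈ Icc a c, t < b → Icc a b ∈ 𝓝[Icc a c] t := fun t ht htb => by
    filter_upwards [self_mem_nhdsWithin, mem_nhdsWithin_of_mem_nhds (Iio_mem_nhds htb)]
      with s hs hsb using ⟨hs.1, le_of_lt hsb⟩
  have hright : ∀ t ∈ Icc a c, b < t → Icc b c ∈ 𝓝[Icc a c] t := fun t ht htb => by
    filter_upwards [self_mem_nhdsWithin, mem_nhdsWithin_of_mem_nhds (Ioi_mem_nhds htb)]
      with s hs hsb using ⟨le_of_lt hsb, hs.2⟩
  constructor
  · intro t ht i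
    rcases lt_trichotomy t b with h | rfl | h
    · exact (h₁.pos t ⟨ht.1, h.le⟩ i).mono_of_mem_nhdsWithin (hleft t ht h)
    · rw [← Icc_union_Icc_eq_Icc hab hbc]
      exact (h₁.pos t ⟨hab, le_rfl⟩ i).union (h₂.pos t ⟨le_rfl, hbc⟩ i)
    · exact (h₂.pos t ⟨h.le, ht.2⟩ i).mono_of_mem_nhdsWithin (hright t ht h)
  · intro t ht i
    rcases lt_trichotomy t b with h | rfl | h
    · exact (h₁.vel t ⟨ht.1, h.le⟩ i).mono_of_mem_nhdsWithin (hleft t ht h)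
    · rw [← Icc_union_Icc_eq_Icc hab hbc]
      exact (h₁.vel t ⟨hab, le_rfl⟩ i).union (h₂.vel t ⟨le_rfl, hbc⟩ i)
    · exact (h₂.vel t ⟨h.le, ht.2⟩ i).mono_of_mem_nhdsWithin (hright t ht h)

/-- Solutions of a uniform duration preserving a set of states can be continued forever. -/
lemma exists_isSolution_Ici_of_uniform {X : Set ((Fin n → G) × (Fin n → E))} {ε : ℝ} (hε : 0 < ε)
    (hX : ∀ p ∈ X, ∃ (γ : ℝ → Fin n → G) (v : ℝ → Fin n → E), S.IsSolution γ v (Icc 0 ε) ∧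
      γ 0 = p.1 ∧ v 0 = p.2 ∧ (γ ε, v ε) ∈ X)
    {p : (Fin n → G) × (Fin n → E)} (hp : p ∈ X) :
    ∃ (γ : ℝ → Fin n → G) (v : ℝ → Fin n → E), S.IsSolution γ v (Ici 0) ∧
      γ 0 = p.1 ∧ v 0 = p.2 := by
  choose! Γ V hsol hΓ0 hV0 hend using hX
  set next : (Fin n → G) × (Fin n → E) → (Fin n → G) × (Fin n → E) := fun q => (Γ q ε, V q ε)
    with hnext
  have hmem : ∀ k : ℕ, next^[k] p ∈ X := by
    intro k
    induction k with
    | zero => exact hp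
    | succ k ih =>
      rw [Function.iterate_succ_apply']
      exact hend _ ih
  set γ : ℝ → Fin n → G := fun t => Γ (next^[⌊t / ε⌋₊] p) (t - ⌊t / ε⌋₊ * ε) with hγ
  set v : ℝ → Fin n → E := fun t => V (next^[⌊t / ε⌋₊] p) (t - ⌊t / ε⌋₊ * ε) with hv
  have hpiece : ∀ k : ℕ, ∀ t ∈ Icc (k * ε) (k * ε + ε),
      γ t = Γ (next^[k] p) (t - k * ε) ∧ v t = V (next^[k] p) (t - k * ε) := by
    intro k t ht
    have ht0 : 0 ≤ t := le_trans (by positivity) ht.1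
    rcases ht.2.eq_or_lt with h | h
    -- At the right endpoint the floor has already moved to the next piece, which starts where the
    -- current one ends.
    · have hfl : ⌊t / ε⌋₊ = k + 1 := by
        rw [h, show (k : ℝ) * ε + ε = ((k + 1 : ℕ) : ℝ) * ε by push_cast; ring,
          mul_div_cancel_right₀ _ hε.ne', Nat.floor_natCast]
      have e1 : t - ((k + 1 : ℕ) : ℝ) * ε = 0 := by rw [h]; push_cast; ring
      have e2 : t - k * ε = ε := by rw [h]; ring
      rw [hγ, hv]
      simp only [hfl, e1, e2]
      rw [hΓ0 _ (hmem _), hV0 _ (hmem _), Function.iterate_succ_apply']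
      exact ⟨rfl, rfl⟩
    · have hfl : ⌊t / ε⌋₊ = k := by
        rw [Nat.floor_eq_iff (by positivity), le_div_iff₀ hε, div_lt_iff₀ hε]
        exact ⟨ht.1, by linarith⟩
      rw [hγ, hv]
      simp only [hfl, and_self]
  have hsolk : ∀ k : ℕ, S.IsSolution γ v (Icc (k * ε) (k * ε + ε)) := fun k =>
    ((hsol _ (hmem k)).shift (k * ε)).congr (fun t ht => (hpiece k t ht).1)
      (fun t ht => (hpiece k t ht).2)
  have hfull : ∀ k : ℕ, S.IsSolution γ v (Icc 0 (k * ε + ε)) := by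
    intro k
    induction k with
    | zero => simpa using hsolk 0
    | succ k ih =>
      have h1 := hsolk (k + 1)
      have e : ((k + 1 : ℕ) : ℝ) * ε = k * ε + ε := by push_cast; ring
      rw [e] at h1 ⊢
      exact ih.union_Icc h1 (by positivity) (by linarith)
  have hbig : ∀ t : ℝ, 0 ≤ t → ∃ k : ℕ, t < k * ε + ε := fun t ht => by
    obtain ⟨k, hk⟩ := exists_nat_gt (t / ε)
    rw [div_lt_iff₀ hε] at hk
    exact ⟨k, by linarith⟩
  have hnhds : ∀ t b : ℝ, t < b → Icc 0 b ∈ 𝓝[Ici 0] t := fun t b htb => by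
    filter_upwards [self_mem_nhdsWithin, mem_nhdsWithin_of_mem_nhds (Iio_mem_nhds htb)]
      with s hs hsb using ⟨hs, le_of_lt hsb⟩
  refine ⟨γ, v, ⟨fun t ht i => ?_, fun t ht i => ?_⟩, ?_, ?_⟩
  · obtain ⟨k, hk⟩ := hbig t ht
    exact ((hfull k).pos t ⟨ht, hk.le⟩ i).mono_of_mem_nhdsWithin (hnhds t _ hk)
  · obtain ⟨k, hk⟩ := hbig t ht
    exact ((hfull k).vel t ⟨ht, hk.le⟩ i).mono_of_mem_nhdsWithin (hnhds t _ hk)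
  · simpa using (hpiece 0 0 (by simp [hε.le])).1.trans (by simpa using hΓ0 _ hp)
  · simpa using (hpiece 0 0 (by simp [hε.le])).2.trans (by simpa using hV0 _ hp)

end ConsensusData

/-! ### Uniform existence time at bounded energy. -/

namespace ConsensusData

variable {E : Type*} [NormedAddCommGroup E] [NormedSpace ℝ E] [FiniteDimensional ℝ E]
  {G : Type*} [TopologicalSpace G] [ChartedSpace E G] [Group G] {n : ℕ}
  {S : ConsensusData E G n} [LieGroup 𝓘(ℝ, E) ∞ G]

variable (S) in
/-- The closed-loop vector field in charts translated by the initial positions `g`. -/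
def chartField (g : Fin n → G) (z : (Fin n → E) × (Fin n → E)) : (Fin n → E) × (Fin n → E) :=
  (fun i => chartLeftTangent G (z.1 i) (z.2 i), fun i => -((1 / S.weight i) •
    (S.damping (z.2 i) + S.gain • ∑ j, S.adj i j •
      perturbed S.gradient ((g j)⁻¹ * g i) (z.1 i, z.1 j))))

variable (S) in
/-- Uniform bounds for the chart field over compact sets of relative positions. -/
lemma exists_chart_bounds {Q : Set G} (hQ : IsCompact Q) : ∃ r > 0, ∃ M ≥ 0,
    (∀ x ∈ Metric.closedBall (chartOrigin E G) r, x ∈ chartDomain E G) ∧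
    (∀ x ∈ Metric.closedBall (chartOrigin E G) r, ‖chartLeftTangent G x‖ ≤ M) ∧
    (∀ x ∈ Metric.closedBall (chartOrigin E G) r, ∀ y ∈ Metric.closedBall (chartOrigin E G) r,
      ‖chartLeftTangent G x - chartLeftTangent G y‖ ≤ M * ‖x - y‖) ∧
    (∀ h ∈ Q, ‖S.gradient h‖ ≤ M) ∧
    ∀ h ∈ Q, ∀ z ∈ Metric.closedBall (chartOrigin E G, chartOrigin E G) r,
      ∀ w ∈ Metric.closedBall (chartOrigin E G, chartOrigin E G) r,
        ‖perturbed S.gradient h z - perturbed S.gradient h w‖ ≤ M * ‖z - w‖ := by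
  obtain ⟨r₀, hr₀, hrad⟩ := exists_isChartRadius E G
  obtain ⟨K, t, ht, hK⟩ := ((contDiffAt_chartLeftTangent
    (chartOrigin_mem (E := E) (G := G))).of_le
      (by exact_mod_cast le_top : (1 : WithTop ℕ∞) ≤ ∞)).exists_lipschitzOnWith
  obtain ⟨r₁, hr₁, hball₁⟩ := Metric.nhds_basis_closedBall.mem_iff.mp ht
  obtain ⟨N, hN⟩ := hQ.exists_bound_of_continuousOn
    S.contMDiff_gradient.continuous.continuousOn
  obtain ⟨N', hN'⟩ := hQ.exists_bound_of_continuousOn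
    (contMDiff_relDifferential S.contMDiff_gradient).continuous.continuousOn
  -- Tube lemma: joint continuity of the derivative and compactness of `Q` give one neighbourhood
  -- valid for all `h`.
  have hderiv : ∀ᶠ z in 𝓝 (chartOrigin E G, chartOrigin E G), ∀ h ∈ Q,
      ‖fderiv ℝ (perturbed S.gradient h : E × E → E) z‖ < N' + 1 := by
    refine hQ.eventually_forall_of_forall_eventually fun h hh => ?_
    have hc := (continuousAt_fderiv_perturbed S.contMDiff_gradient h
      (z := (chartOrigin E G, chartOrigin E G)) ⟨chartOrigin_mem, chartOrigin_mem⟩).norm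
    have hc' := hc.comp_of_eq (x := ((chartOrigin E G, chartOrigin E G), h))
      continuous_swap.continuousAt rfl
    refine hc'.eventually_lt continuousAt_const ?_
    exact (hN' h hh).trans_lt (lt_add_one N')
  obtain ⟨r₂, hr₂, hball₂⟩ := Metric.nhds_basis_closedBall.mem_iff.mp hderiv
  set r := min r₀ (min r₁ r₂) with hr
  have hsub₀ : r ≤ r₀ := min_le_left _ _
  have hsub₁ : r ≤ r₁ := (min_le_right _ _).trans (min_le_left _ _)
  have hsub₂ : r ≤ r₂ := (min_le_right _ _).trans (min_le_right _ _)
  set M := max (max 2 (K : ℝ)) (max |N| |N' + 1|) with hM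
  have hM1 : 2 ≤ M := (le_max_left _ _).trans (le_max_left _ _)
  have hM2 : (K : ℝ) ≤ M := (le_max_right _ _).trans (le_max_left _ _)
  have hM3 : N ≤ M := (le_abs_self N).trans ((le_max_left _ _).trans (le_max_right _ _))
  have hM4 : N' + 1 ≤ M := (le_abs_self _).trans ((le_max_right _ _).trans (le_max_right _ _))
  have hdom : ∀ x ∈ Metric.closedBall (chartOrigin E G) r, x ∈ chartDomain E G := fun x hx =>
    (hrad x (Metric.closedBall_subset_closedBall hsub₀ hx)).1
  refine ⟨r, lt_min hr₀ (lt_min hr₁ hr₂), M, by linarith, hdom, fun x hx =>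
    (hrad x (Metric.closedBall_subset_closedBall hsub₀ hx)).2.trans hM1, fun x hx y hy => ?_,
    fun h hh => (hN h hh).trans hM3, fun h hh z hz w hw => ?_⟩
  · refine (hK.norm_sub_le (hball₁ (Metric.closedBall_subset_closedBall hsub₁ hx))
      (hball₁ (Metric.closedBall_subset_closedBall hsub₁ hy))).trans ?_
    gcongr
  · refine Convex.norm_image_sub_le_of_norm_fderiv_le (𝕜 := ℝ)
      (s := Metric.closedBall (chartOrigin E G, chartOrigin E G) r) (fun u hu => ?_)
      (fun u hu => ?_) (convex_closedBall _ _) hw hz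
    · rw [← closedBall_prod_same] at hu
      exact differentiableAt_perturbed S.contMDiff_gradient h ⟨hdom _ hu.1, hdom _ hu.2⟩
    · exact (le_of_lt (hball₂ (Metric.closedBall_subset_closedBall hsub₂ hu) h hh)).trans hM4

lemma isCompact_sublevel (c : ℝ) : IsCompact {h | S.potential h ≤ c} := by
  have : {h | S.potential h ≤ c} = S.potential ⁻¹' Icc 0 c := by
    ext h
    exact ⟨fun hh => ⟨S.isErrorFunction.nonneg h, hh⟩, fun hh => hh.2⟩
  rw [this]
  exact S.isErrorFunction.proper.isCompact_preimage isCompact_Icc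

variable (S) in
/-- Solutions of bounded energy exist for a uniform time. -/
lemma exists_uniform_solution (c : ℝ) : ∃ ε > 0, ∀ (g : Fin n → G) (v : Fin n → E),
    S.energy g v ≤ c → ∃ (γ : ℝ → Fin n → G) (w : ℝ → Fin n → E),
      S.IsSolution γ w (Icc 0 ε) ∧ γ 0 = g ∧ w 0 = v := by
  have : CompleteSpace E := FiniteDimensional.complete ℝ E
  obtain ⟨r, hr, M, hM, hdom, hA, hAL, hgrad, hL⟩ :=
    S.exists_chart_bounds (isCompact_sublevel (S := S) (c / S.gain))
  obtain ⟨C, hC, hvel⟩ := S.exists_norm_sq_le_energy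
  set R := Real.sqrt (C * |c|) with hR
  have hR0 : 0 ≤ R := Real.sqrt_nonneg _
  have hgain := S.gain_pos
  set b := ∑ i, 1 / S.weight i with hb
  have hb0 : 0 ≤ b := Finset.sum_nonneg fun i _ => (one_div_pos.mpr (S.weight_pos i)).le
  have hbi : ∀ i, |1 / S.weight i| ≤ b := fun i => by
    rw [abs_of_pos (one_div_pos.mpr (S.weight_pos i))]
    exact Finset.single_le_sum (f := fun i => 1 / S.weight i)
      (fun j _ => (one_div_pos.mpr (S.weight_pos j)).le) (Finset.mem_univ i)
  set P := ‖S.damping‖ with hP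
  have hP0 : 0 ≤ P := norm_nonneg S.damping
  -- `K₁` and `K₂` are Lipschitz constants of the position and velocity components on the ball; `L`
  -- below is the size of the field at the centre plus `K * r`. All depend on the initial state only
  -- through the energy bound `c`.
  set K₁ := M * (R + r) + M with hK₁
  set K₂ := b * (P + S.gain * (n * M)) with hK₂
  have hK₁0 : 0 ≤ K₁ := by positivity
  have hK₂0 : 0 ≤ K₂ := by positivity
  set K := K₁ + K₂ with hK
  have hK0 : 0 ≤ K := by positivity
  set L := M * R + b * (P * R + S.gain * (n * M)) + K * r with hLdef
  have hL0 : 0 ≤ L := by positivity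
  refine ⟨r / (L + 1), by positivity, fun g v hgv => ?_⟩
  have hvR : ‖v‖ ≤ R := by
    apply Real.le_sqrt_of_sq_le
    refine (hvel g v).trans ?_
    gcongr
    exact hgv.trans (le_abs_self c)
  have hrel : ∀ i j, S.graph.Adj i j → (g j)⁻¹ * g i ∈ {h | S.potential h ≤ c / S.gain} :=
    fun i j hij => by
      rw [mem_ofPred_eq, le_div_iff₀ hgain, mul_comm]
      exact (gain_mul_potential_le_energy g v hij).trans hgv
  set z₀ : (Fin n → E) × (Fin n → E) := (fun _ => chartOrigin E G, v) with hz₀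
  have hx : ∀ z ∈ Metric.closedBall z₀ r, ∀ i, z.1 i ∈ Metric.closedBall (chartOrigin E G) r := by
    intro z hz i
    rw [← closedBall_prod_same] at hz
    exact (dist_le_pi_dist z.1 _ i).trans hz.1
  have hpair : ∀ z ∈ Metric.closedBall z₀ r, ∀ i j,
      (z.1 i, z.1 j) ∈ Metric.closedBall (chartOrigin E G, chartOrigin E G) r := by
    intro z hz i j
    rw [← closedBall_prod_same]
    exact ⟨hx z hz i, hx z hz j⟩
  have hw : ∀ z ∈ Metric.closedBall z₀ r, ∀ i, ‖z.2 i‖ ≤ R + r := by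
    intro z hz i
    rw [← closedBall_prod_same] at hz
    have h1 : ‖z.2 - v‖ ≤ r := by rw [← dist_eq_norm]; exact hz.2
    have h2 := norm_sub_norm_le z.2 v
    exact (norm_le_pi_norm z.2 i).trans (by linarith)
  have hlip : ∀ z ∈ Metric.closedBall z₀ r, ∀ y ∈ Metric.closedBall z₀ r,
      ‖S.chartField g z - S.chartField g y‖ ≤ K * ‖z - y‖ := by
    intro z hz y hy
    have h1 : ∀ i, ‖z.1 i - y.1 i‖ ≤ ‖z - y‖ := fun i =>
      (norm_le_pi_norm (z.1 - y.1) i).trans (norm_fst_le (z - y))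
    have h2 : ∀ i, ‖z.2 i - y.2 i‖ ≤ ‖z - y‖ := fun i =>
      (norm_le_pi_norm (z.2 - y.2) i).trans (norm_snd_le (z - y))
    have hd0 : 0 ≤ ‖z - y‖ := norm_nonneg (z - y)
    refine max_le ?_ ?_
    · refine le_trans ?_ (mul_le_mul_of_nonneg_right (le_add_of_nonneg_right hK₂0 : K₁ ≤ K) hd0)
      refine (pi_norm_le_iff_of_nonneg (by positivity)).mpr fun i => ?_
      have e : (S.chartField g z - S.chartField g y).1 i =
          (chartLeftTangent G (z.1 i) - chartLeftTangent G (y.1 i)) (z.2 i) +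
            chartLeftTangent G (y.1 i) (z.2 i - y.2 i) := by
        simp [chartField]
      rw [e]
      refine (norm_add_le _ _).trans ?_
      rw [hK₁, add_mul]
      refine add_le_add ?_ ?_
      · refine (ContinuousLinearMap.le_opNorm _ _).trans ?_
        calc ‖chartLeftTangent G (z.1 i) - chartLeftTangent G (y.1 i)‖ * ‖z.2 i‖
            ≤ (M * ‖z - y‖) * (R + r) := by
              gcongr
              · exact (hAL _ (hx z hz i) _ (hx y hy i)).trans (by gcongr; exact h1 i)
              · exact hw z hz i
          _ = M * (R + r) * ‖z - y‖ := by ring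
      · refine (ContinuousLinearMap.le_opNorm _ _).trans ?_
        gcongr
        · exact hA _ (hx y hy i)
        · exact h2 i
    · refine le_trans ?_ (mul_le_mul_of_nonneg_right (le_add_of_nonneg_left hK₁0 : K₂ ≤ K) hd0)
      refine (pi_norm_le_iff_of_nonneg (by positivity)).mpr fun i => ?_
      have e : (S.chartField g z - S.chartField g y).2 i = -((1 / S.weight i) •
          (S.damping (z.2 i - y.2 i) + S.gain • ∑ j, S.adj i j •
            (perturbed S.gradient ((g j)⁻¹ * g i) (z.1 i, z.1 j) -
              perturbed S.gradient ((g j)⁻¹ * g i) (y.1 i, y.1 j)))) := by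
        simp only [chartField, Prod.snd_sub, Pi.sub_apply, map_sub, smul_sub,
          Finset.sum_sub_distrib, smul_add]
        abel
      have hsum : ‖∑ j, S.adj i j • (perturbed S.gradient ((g j)⁻¹ * g i) (z.1 i, z.1 j) -
          perturbed S.gradient ((g j)⁻¹ * g i) (y.1 i, y.1 j))‖ ≤ n * (M * ‖z - y‖) := by
        refine (norm_sum_le_of_le (n := fun _ => M * ‖z - y‖) _ fun j _ => ?_).trans (by simp)
        by_cases hij : S.graph.Adj i j
        · rw [S.adj_eq_one hij, one_smul]
          refine (hL _ (hrel i j hij) _ (hpair z hz i j) _ (hpair y hy i j)).trans ?_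
          gcongr
          exact max_le (h1 i) (h1 j)
        · rw [S.adj_eq_zero hij, zero_smul, norm_zero]
          positivity
      rw [e, norm_neg, norm_smul, hK₂, mul_assoc]
      refine mul_le_mul (hbi i) ((norm_add_le _ _).trans ?_) (norm_nonneg _) hb0
      rw [norm_smul, Real.norm_of_nonneg hgain.le, add_mul]
      refine add_le_add ((S.damping.le_opNorm _).trans (by gcongr; exact h2 i)) ?_
      rw [mul_assoc, mul_assoc]
      gcongr
  have hcenter : ‖S.chartField g z₀‖ ≤ M * R + b * (P * R + S.gain * (n * M)) := by
    have e1 : 0 ≤ M * R := by positivity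
    have e2 : 0 ≤ b * (P * R + S.gain * (n * M)) := by positivity
    refine max_le ?_ ?_
    · refine le_trans ?_ (le_add_of_nonneg_right e2)
      refine (pi_norm_le_iff_of_nonneg e1).mpr fun i => ?_
      refine (ContinuousLinearMap.le_opNorm _ _).trans ?_
      gcongr
      · exact hA _ (Metric.mem_closedBall_self hr.le)
      · exact (norm_le_pi_norm v i).trans hvR
    · refine le_trans ?_ (le_add_of_nonneg_left e1)
      refine (pi_norm_le_iff_of_nonneg e2).mpr fun i => ?_
      simp only [chartField]
      rw [norm_neg, norm_smul]
      refine mul_le_mul (hbi i) ((norm_add_le _ _).trans ?_) (norm_nonneg _) hb0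
      rw [norm_smul, Real.norm_of_nonneg hgain.le]
      refine add_le_add ((S.damping.le_opNorm _).trans ?_) ?_
      · gcongr
        exact (norm_le_pi_norm v i).trans hvR
      · gcongr
        refine (norm_sum_le_of_le (n := fun _ => M) _ fun j _ => ?_).trans (by simp)
        by_cases hij : S.graph.Adj i j
        · rw [S.adj_eq_one hij, one_smul]
          simpa [hz₀, perturbed, ofChart_chartOrigin] using hgrad _ (hrel i j hij)
        · rw [S.adj_eq_zero hij, zero_smul, norm_zero]
          exact hM
  have hbound : ∀ z ∈ Metric.closedBall z₀ r, ‖S.chartField g z‖ ≤ L := by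
    intro z hz
    have h1 := hlip z hz z₀ (Metric.mem_closedBall_self hr.le)
    have h2 : ‖z - z₀‖ ≤ r := by rw [← dist_eq_norm]; exact hz
    have h3 := norm_sub_norm_le (S.chartField g z) (S.chartField g z₀)
    have h4 : K * ‖z - z₀‖ ≤ K * r := by gcongr
    linarith
  obtain ⟨z, hz0, hzmem, hzd⟩ := exists_solution_mem_closedBall (Y := S.chartField g) (z₀ := z₀)
    (r := ⟨r, hr.le⟩) (L := ⟨L, hL0⟩) (K := ⟨K, hK0⟩) (ε := ⟨r / (L + 1), by positivity⟩)
    hbound (LipschitzOnWith.of_dist_le_mul fun z hz y hy => by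
      rw [dist_eq_norm, dist_eq_norm]; exact hlip z hz y hy) (by
      refine NNReal.coe_le_coe.mp ?_
      change L * (r / (L + 1)) ≤ r
      rw [mul_div_assoc', div_le_iff₀ (by positivity)]
      nlinarith)
  have hzd' : ∀ t ∈ Icc (0 : ℝ) (r / (L + 1)),
      HasDerivWithinAt z (S.chartField g (z t)) (Icc 0 (r / (L + 1))) t := hzd
  have hzmem' : ∀ t, z t ∈ Metric.closedBall z₀ r := hzmem
  refine ⟨fun t i => g i * ofChart G ((z t).1 i), fun t => (z t).2, ⟨fun t ht i => ?_,
    fun t ht i => ?_⟩, ?_, ?_⟩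
  · have h1 : HasDerivWithinAt (fun τ => (z τ).1) (S.chartField g (z t)).1
        (Icc 0 (r / (L + 1))) t :=
      (ContinuousLinearMap.fst ℝ (Fin n → E) (Fin n → E)).hasFDerivAt.comp_hasDerivWithinAt t
        (hzd' t ht)
    exact hasMFDerivWithinAt_translate_ofChart (g i) (x := fun τ => (z τ).1 i)
      (hdom _ (hx _ (hzmem' t) i)) (hasDerivWithinAt_pi.mp h1 i)
  · have h1 : HasDerivWithinAt (fun τ => (z τ).2) (S.chartField g (z t)).2
        (Icc 0 (r / (L + 1))) t :=
      (ContinuousLinearMap.snd ℝ (Fin n → E) (Fin n → E)).hasFDerivAt.comp_hasDerivWithinAt t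
        (hzd' t ht)
    refine (hasDerivWithinAt_pi.mp h1 i).congr_deriv ?_
    simp [chartField, acceleration, force, perturbed, mul_assoc]
  · ext i
    simp [hz0, hz₀, ofChart_chartOrigin]
  · simp [hz0, hz₀]

variable (S) in
/-- Solutions of the closed-loop equations exist for all forward times. -/
lemma exists_isSolution (g : Fin n → G) (v : Fin n → E) :
    ∃ (γ : ℝ → Fin n → G) (w : ℝ → Fin n → E), S.IsSolution γ w (Ici 0) ∧ γ 0 = g ∧ w 0 = v := by
  obtain ⟨ε, hε, h⟩ := S.exists_uniform_solution (S.energy g v)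
  -- Each piece ends in the same energy sublevel set because the energy does not increase, so the
  -- uniform time is available again.
  refine exists_isSolution_Ici_of_uniform (X := {p | S.energy p.1 p.2 ≤ S.energy g v}) hε
    (fun p hp => ?_) (p := (g, v)) (le_refl (S.energy g v))
  obtain ⟨γ, w, hs, h1, h2⟩ := h p.1 p.2 hp
  refine ⟨γ, w, hs, h1, h2, ?_⟩
  have := hs.antitoneOn_energy (convex_Icc 0 ε) (left_mem_Icc.mpr hε.le) (right_mem_Icc.mpr hε.le)
    hε.le
  simp only [h1, h2] at this
  exact this.trans hp

end ConsensusData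

/-! ### Regular levels and the critical threshold. -/

namespace ConsensusData

variable {E : Type*} [NormedAddCommGroup E] [NormedSpace ℝ E] [FiniteDimensional ℝ E]
  {G : Type*} [TopologicalSpace G] [T2Space G] [ChartedSpace E G] [Group G] {n : ℕ}
  {S : ConsensusData E G n} [LieGroup 𝓘(ℝ, E) ∞ G]

lemma gradient_eq_zero_iff_groupDifferential {h : G} :
    S.gradient h = 0 ↔ groupDifferential E S.potential h = 0 := by
  rw [gradient_eq_zero_iff]
  refine ⟨groupDifferential_eq_zero_of_leftDifferential S.isErrorFunction.smooth, fun h0 => ?_⟩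
  ext v
  have h2 := leftCotangent_groupDifferential S.isErrorFunction.smooth h 1 v
  have e : (fun x : G => rightTrackingError S.potential x 1) = S.potential := by
    ext x; simp [rightTrackingError]
  rw [e, h0, inv_one, one_mul] at h2
  exact h2.symm

lemma mem_regularLevels_iff {L : ℝ} : L ∈ regularLevels E S.potential ↔
    0 ≤ L ∧ ∀ h, S.potential h ≤ L → h ≠ 1 → S.gradient h ≠ 0 := by
  simp only [regularLevels, mem_ofPred_eq, S.isErrorFunction.map_one, Set.mem_sdiff,
    mem_singleton_iff,
    and_imp, ne_eq, gradient_eq_zero_iff_groupDifferential]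

/-- If some level is regular, then some positive level is. -/
lemma exists_pos_mem_regularLevels (hne : (regularLevels E S.potential).Nonempty) :
    ∃ L > 0, L ∈ regularLevels E S.potential := by
  obtain ⟨L₀, hL₀⟩ := hne
  rw [mem_regularLevels_iff] at hL₀
  obtain ⟨D, hD, hD1, -⟩ := S.exists_isRegular
  have hcont := S.isErrorFunction.smooth.continuous
  have hK : IsCompact ({h | S.potential h ≤ 1} \ interior D) :=
    (isCompact_sublevel 1).diff isOpen_interior
  -- A regular level is nonnegative, so its sublevel set contains all zeros of the potential; these
  -- are critical, hence only the identity.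
  have hpos : ∀ h ∈ {h | S.potential h ≤ 1} \ interior D, 0 < S.potential h := fun h hh =>
    (S.isErrorFunction.nonneg h).lt_of_ne fun h0 =>
      hL₀.2 h (h0 ▸ hL₀.1) (by rintro rfl; exact hh.2 (mem_interior_iff_mem_nhds.mpr hD1))
        (gradient_eq_zero_of_potential_eq_zero h0.symm)
  obtain ⟨δ, hδ, hδ1, hmin⟩ : ∃ δ > 0, δ ≤ 1 ∧
      ∀ h ∈ {h | S.potential h ≤ 1} \ interior D, δ ≤ S.potential h := by
    rcases ({h | S.potential h ≤ 1} \ interior D).eq_empty_or_nonempty with h | h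
    · exact ⟨1, one_pos, le_rfl, fun a ha => by rw [h] at ha; exact ha.elim⟩
    · obtain ⟨a, ha, hmin⟩ := hK.exists_isMinOn h hcont.continuousOn
      exact ⟨S.potential a, hpos a ha, ha.1, fun b hb => hmin hb⟩
  refine ⟨δ / 2, half_pos hδ, mem_regularLevels_iff.mpr ⟨(half_pos hδ).le, fun h hh hne => ?_⟩⟩
  refine hD.gradient_ne_zero h ?_ hne
  by_contra hnD
  have := hmin h ⟨by simp only [mem_ofPred_eq]; linarith, fun hi => hnD (interior_subset hi)⟩
  linarith

/-- Below the critical threshold there is room up to a regular level. -/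
lemma exists_regularLevel_gt {W : ℝ}
    (hW : (W : EReal) ≤ ((S.gain / 2 : ℝ) : EReal) * criticalThreshold E S.potential) :
    ∃ L ∈ regularLevels E S.potential, W < S.gain * L := by
  have hgain := S.gain_pos
  rcases (regularLevels E S.potential).eq_empty_or_nonempty with hemp | hne
  · rw [criticalThreshold, hemp, image_empty, sSup_empty,
      EReal.coe_mul_bot_of_pos (half_pos hgain)] at hW
    exact absurd hW (not_le.mpr (EReal.bot_lt_coe W))
  -- If `gain * L' ≤ W` for every regular level, then the threshold is at most `W / gain`, so `W ≤ W
  -- / 2`; a positive regular level forces `W > 0`, a contradiction.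
  · obtain ⟨L, hL, hLmem⟩ := exists_pos_mem_regularLevels hne
    by_contra! hall
    have hle : criticalThreshold E S.potential ≤ ((W / S.gain : ℝ) : EReal) := by
      refine sSup_le ?_
      rintro _ ⟨L', hL', rfl⟩
      rw [EReal.coe_le_coe_iff, le_div_iff₀ hgain, mul_comm]
      exact hall L' hL'
    have h1 : (W : EReal) ≤ ((S.gain / 2 : ℝ) : EReal) * ((W / S.gain : ℝ) : EReal) :=
      hW.trans (mul_le_mul_of_nonneg_left hle (EReal.coe_nonneg.mpr (half_pos hgain).le))
    rw [← EReal.coe_mul, EReal.coe_le_coe_iff] at h1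
    have h2 : S.gain / 2 * (W / S.gain) = W / 2 := by field_simp
    have h3 := hall L hLmem
    nlinarith [mul_pos hgain hL]

/-- Solutions starting below the critical threshold converge to consensus. -/
lemma IsSolution.exists_tendsto_of_le_criticalThreshold {γ : ℝ → Fin n → G} {v : ℝ → Fin n → E}
    (h : S.IsSolution γ v (Ici 0)) (hW : ((S.energy (γ 0) (v 0) : ℝ) : EReal) ≤
      ((S.gain / 2 : ℝ) : EReal) * criticalThreshold E S.potential) :
    ∃ g : Fin n → G, (∀ i j, g i = g j) ∧ Tendsto γ atTop (𝓝 g) ∧ Tendsto v atTop (𝓝 0) := by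
  have hgain := S.gain_pos
  obtain ⟨L, hL, hlt⟩ := exists_regularLevel_gt hW
  rw [mem_regularLevels_iff] at hL
  have hcL : S.energy (γ 0) (v 0) / S.gain < L := by
    rw [div_lt_iff₀ hgain, mul_comm]; exact hlt
  -- With `c = W / gain < L`, the sublevel set at `c` lies in the open set where the potential is
  -- below `L`, and the initial relative positions along edges lie in it automatically.
  refine h.exists_tendsto (D := {h | S.potential h ≤ L}) ⟨isCompact_sublevel L, hL.2⟩
    (c := S.energy (γ 0) (v 0) / S.gain) (fun a _ ha => ?_) (fun i j hij => ?_)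
    (mul_div_cancel₀ _ hgain.ne').ge
  · refine mem_interior.mpr ⟨{h | S.potential h < L}, fun b (hb : S.potential b < L) =>
      show S.potential b ≤ L from le_of_lt hb,
      isOpen_lt S.isErrorFunction.smooth.continuous continuous_const, ha.trans_lt hcL⟩
  · refine le_trans ?_ hcL.le
    rw [le_div_iff₀ hgain, mul_comm]
    exact gain_mul_potential_le_energy _ _ hij

lemma isSolution_const {g : Fin n → G} (hg : ∀ i j, g i = g j) (s : Set ℝ) :
    S.IsSolution (fun _ => g) (fun _ => 0) s where
  pos t _ i := by
    refine (hasMFDerivWithinAt_const (g i) s t).congr_mfderiv ?_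
    have h1 : leftTangent (E := E) (g i) 0 = 0 := map_zero _
    have h2 : (1 : ℝ →L[ℝ] ℝ).smulRight (leftTangent (E := E) (g i) 0) =
        (0 : ℝ →L[ℝ] TangentSpace 𝓘(ℝ, E) (g i)) := by
      rw [h1]
      exact ContinuousLinearMap.ext fun c => smul_zero _
    exact h2.symm
  vel t _ i := by
    have h1 : S.gradient 1 = 0 := gradient_eq_zero_of_potential_eq_zero S.isErrorFunction.map_one
    have h2 : S.acceleration g 0 i = 0 := by
      simp [acceleration, force, fun j => inv_mul_eq_one.mpr (hg j i), h1]
    simpa [h2] using hasDerivWithinAt_const t s (0 : E)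

end ConsensusData

/-! ### Identification of the controlled system with the reduced one. -/

section Main

variable {E : Type*} [NormedAddCommGroup E] [NormedSpace ℝ E] [FiniteDimensional ℝ E]
  {G : Type*} [TopologicalSpace G] [ChartedSpace E G] [Group G]
  [LieGroup 𝓘(ℝ, E) ∞ G] {n : ℕ}

/-- The kinetic energy tensor as a continuous bilinear form. -/
def KineticEnergyTensor.toContinuous (K : KineticEnergyTensor E) : E →L[ℝ] E →L[ℝ] ℝ :=
  LinearMap.toContinuousLinearMap
    ((LinearMap.toContinuousLinearMap (𝕜 := ℝ) (E := E) (F' := ℝ)).toLinearMap ∘ₗ K.form)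

lemma KineticEnergyTensor.form_sharp (K : KineticEnergyTensor E) (μ : Module.Dual ℝ E) (w : E) :
    K.form (K.sharp μ) w = μ w :=
  DFunLike.congr_fun (K.flat_sharp μ) w

/-- The closed-loop consensus system of a graph, kinetic energy, dissipation and error function. -/
def consensusData (𝒢 : SimpleGraph (Fin n)) [inst : DecidableRel 𝒢.Adj] (h𝒢 : 𝒢.IsTree)
    (K : KineticEnergyTensor E) (R : LinearMap.BilinForm ℝ E) (hR : ∀ v, v ≠ 0 → 0 < R v v)
    (Ψ : G → ℝ) (hΨ : IsErrorFunction E Ψ) (Kp : ℝ) (hKp : 0 < Kp) (α : Fin n → ℝ)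
    (hα : ∀ i, 0 < α i) : ConsensusData E G n where
  graph := 𝒢
  dec := inst
  isTree := h𝒢
  metric := K.toContinuous
  metric_symm := K.symm
  metric_pos := K.pos
  damping := LinearMap.toContinuousLinearMap (K.sharp ∘ₗ R)
  damping_pos v hv := (hR v hv).trans_eq (K.form_sharp (R v) v).symm
  potential := Ψ
  isErrorFunction := hΨ
  gradient h := K.sharp (leftDifferential E Ψ h).toLinearMap
  contMDiff_gradient :=
    (LinearMap.toContinuousLinearMap
      (K.sharp ∘ₗ ContinuousLinearMap.coeLM ℝ (M := E) (N₃ := ℝ))).contMDiff.comp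
      (contMDiff_leftDifferential hΨ.smooth)
  metric_gradient _ v := K.form_sharp _ v
  gain := Kp
  gain_pos := hKp
  weight := α
  weight_pos := hα

/-- The feedback cancels the coadjoint term, here an arbitrary covector `c`, so no property of the
Lie bracket is needed. -/
lemma KineticEnergyTensor.sharp_add_sharp_feedback {V ι : Type*} [AddCommGroup V] [Module ℝ V]
    [FiniteDimensional ℝ V] [Fintype ι] (K : KineticEnergyTensor V) (c r : Module.Dual ℝ V)
    (a k : ℝ) (w : ι → ℝ) (μ : ι → Module.Dual ℝ V) :
    K.sharp c + K.sharp (-c - a • (r + k • ∑ j, w j • μ j)) =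
      -(a • (K.sharp r + k • ∑ j, w j • K.sharp (μ j))) := by
  simp only [map_sub, map_neg, map_add, map_smul, map_sum]
  abel

lemma isControlledTrajectory_iff (𝒢 : SimpleGraph (Fin n)) [DecidableRel 𝒢.Adj] (h𝒢 : 𝒢.IsTree)
    (K : KineticEnergyTensor (GroupLieAlgebra 𝓘(ℝ, E) G))
    (R : LinearMap.BilinForm ℝ (GroupLieAlgebra 𝓘(ℝ, E) G)) (hR : ∀ v, v ≠ 0 → 0 < R v v)
    (Ψ : G → ℝ) (hΨ : IsErrorFunction E Ψ) (Kp : ℝ) (hKp : 0 < Kp) (α : Fin n → ℝ)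
    (hα : ∀ i, 0 < α i) (ξ : ℝ → AgentState E G n) :
    IsControlledTrajectory K (consensusInput 𝒢 K R Ψ Kp α) ξ ↔
      (consensusData (E := E) 𝒢 h𝒢 K R hR Ψ hΨ Kp hKp α hα).IsSolution
        (fun t => (ξ t).1) (fun t => (ξ t).2) (Ici 0) := by
  have key : ∀ (x : AgentState E G n) (i : Fin n),
      K.sharp (coadjoint (x.2 i) (K.flat (x.2 i))) +
        K.sharp (consensusInput 𝒢 K R Ψ Kp α x i) =
      (consensusData (E := E) 𝒢 h𝒢 K R hR Ψ hΨ Kp hKp α hα).acceleration x.1 x.2 i := by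
    intro x i
    have e : ∀ j, leftCotangent (x.1 i)
        (groupDifferential E (fun g => rightTrackingError Ψ g (x.1 j)) (x.1 i)) =
        (leftDifferential E Ψ ((x.1 j)⁻¹ * x.1 i)).toLinearMap := fun j => by
      ext w
      exact leftCotangent_groupDifferential hΨ.smooth (x.1 i) (x.1 j) w
    unfold consensusInput
    simp only [e]
    exact K.sharp_add_sharp_feedback _ _ _ _ _ _
  constructor
  · intro h
    refine ⟨fun t ht i => (h t ht i).1, fun t ht i => ?_⟩
    obtain ⟨v', hv', he⟩ := (h t ht i).2
    have he' := (sub_eq_iff_eq_add'.mp he).trans (key (ξ t) i)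
    exact he' ▸ hv'
  · intro h t ht i
    refine ⟨h.pos t ht i, _, h.vel t ht i, ?_⟩
    have hk := (key (ξ t) i).symm
    exact (sub_eq_iff_eq_add' (G := GroupLieAlgebra 𝓘(ℝ, E) G)).mpr hk

end Main

end

theorem theorem1
    {E : Type*} [NormedAddCommGroup E] [NormedSpace ℝ E] [FiniteDimensional ℝ E]
    {G : Type*} [TopologicalSpace G] [T2Space G] [ChartedSpace E G] [Group G]
    [LieGroup 𝓘(ℝ, E) ∞ G]
    {n : ℕ} (𝒢 : SimpleGraph (Fin n)) [DecidableRel 𝒢.Adj] (h𝒢 : 𝒢.IsTree)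
    (K : KineticEnergyTensor (GroupLieAlgebra 𝓘(ℝ, E) G))
    (R : LinearMap.BilinForm ℝ (GroupLieAlgebra 𝓘(ℝ, E) G)) (hR : ∀ v, v ≠ 0 → 0 < R v v)
    (Ψ : G → ℝ) (hΨ : IsErrorFunction E Ψ)
    (Kp : ℝ) (hKp : 0 < Kp) (α : Fin n → ℝ) (hα : ∀ i, 0 < α i) :
    let traj : (ℝ → AgentState E G n) → Prop :=
      IsControlledTrajectory K (consensusInput 𝒢 K R Ψ Kp α)
    (∀ x : AgentState E G n, ∃ ξ, traj ξ ∧ ξ 0 = x) ∧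
    (∀ x ∈ consensusSet E G n, traj (fun _ => x)) ∧
    SetLocallyAsymptoticallyStable traj (consensusSet E G n) ∧
    SetAttracts traj (consensusSet E G n) (lowEnergySet 𝒢 K Ψ Kp α) := by
  intro traj
  have htraj : ∀ ξ, traj ξ ↔ _ := isControlledTrajectory_iff 𝒢 h𝒢 K R hR Ψ hΨ Kp hKp α hα
  set S := consensusData (E := E) 𝒢 h𝒢 K R hR Ψ hΨ Kp hKp α hα with hS
  -- Convergence to a single consensus point is stronger than small relative errors, and it gives
  -- convergence in the set neighbourhood filter even if the consensus set is noncompact.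
  have hlim : ∀ ξ : ℝ → AgentState E G n,
      (∃ g : Fin n → G, (∀ i j, g i = g j) ∧ Tendsto (fun t => (ξ t).1) atTop (𝓝 g) ∧
        Tendsto (fun t => (ξ t).2 : ℝ → Fin n → E) atTop (𝓝 0)) →
      Tendsto ξ atTop (𝓝ˢ (consensusSet E G n)) := by
    rintro ξ ⟨g, hg, h1, h2⟩
    have h3 : Tendsto ξ atTop (𝓝 ((g, 0) : AgentState E G n)) := h1.prodMk_nhds h2
    exact h3.mono_right (nhds_le_nhdsSet ⟨hg, fun i => rfl⟩)
  refine ⟨fun x => ?_, fun x hx => ?_, ⟨fun U hU => ?_, ?_⟩, fun ξ hξ h0 => ?_⟩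
  · obtain ⟨γ, w, hs, h1, h2⟩ := S.exists_isSolution x.1 x.2
    exact ⟨fun t => (γ t, w t), (htraj _).mpr hs, Prod.ext h1 h2⟩
  · rw [htraj]
    have h2 : x.2 = 0 := funext hx.2
    simp only [h2]
    exact ConsensusData.isSolution_const hx.1 _
  -- The largest admissible set of initial states is a neighbourhood of each consensus point by
  -- pointwise stability, so no uniformity along the consensus set is required.
  · refine ⟨{x | ∀ ξ, traj ξ → ξ 0 = x → ∀ t, 0 ≤ t → ξ t ∈ U}, ?_,
      fun ξ hξ h0 => h0 ξ hξ rfl⟩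
    rw [mem_nhdsSet_iff_forall]
    intro x hx
    obtain ⟨g, v⟩ := x
    obtain rfl : v = fun _ => 0 := funext hx.2
    obtain ⟨W, hW, hstable⟩ := ConsensusData.consensus_stable (E := E) (S := S) hx.1
      (mem_nhdsSet_iff_forall.mp hU _ hx)
    refine mem_of_superset hW fun y hy ξ hξ h0 => ?_
    exact hstable _ _ ((htraj ξ).mp hξ) (by subst h0; exact hy)
  · obtain ⟨W, hWo, hWA, hW⟩ := ConsensusData.exists_attracting_nhds (E := E) (S := S)
    refine ⟨W, hWo.mem_nhdsSet.mpr fun x hx => ?_, fun ξ hξ h0 =>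
      hlim ξ (hW _ _ ((htraj ξ).mp hξ) h0)⟩
    obtain ⟨g, v⟩ := x
    obtain rfl : v = fun _ => 0 := funext hx.2
    exact hWA g hx.1
  · exact hlim ξ (ConsensusData.IsSolution.exists_tendsto_of_le_criticalThreshold
      (E := E) (S := S) ((htraj ξ).mp hξ) h0)
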